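/- **Setting.** Let $F$ be a local field: $\mathbb R$, $\mathbb C$, or a non-archimedean local field (for instance the completion of a number field at a finite place). Let $|\cdot|$ be its normalized absolute value (the factor by which multiplication scales additive Haar measure, so $|z|=z\bar z$ on $\mathbb C$). Let $\lambda$ be the additive character $\lambda(x)=e^{-2\pi i\,\mathrm{Tr}(x)}$ if $F$ is archimedean (trace down to $\mathbb R$), and any nontrivial continuous unitary additive character of $F$ (for instance $e^{2\pi i\,\mathrm{Tr}(x)}$) otherwise. Let $dy$ be the additive Haar measure that is self-dual for $\lambda$ (Lebesgue measure on $\mathbb R$, twice Lebesgue measure on $\mathbb C$), and write $\widetilde\varphi(x)=\int_F\varphi(y)\lambda(-xy)\,dy$. Test functions are the Schwartz functions if $F$ is archimedean, and the locally constant compactly supported functions otherwise. For a continuous unitary character $\chi:F^\times\to U(1)$ and $0<\mathrm{Re}(s)<1$, the Gamma function $\Gamma(\chi,s)$ is the number such that for every test function $\varphi$ $$\int_F\widetilde\varphi(x)\,\chi(x)|x|^{s-1}\,dx=\Gamma(\chi,s)\int_F\varphi(y)\,\chi^{-1}(y)|y|^{-s}\,dy ,$$ and the spectral function of the commutator is $K(\chi,s)=-i\,\frac{\partial^2}{\partial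 s^2}\log\Gamma(\chi,s)$, that is $-i\,\frac{\partial}{\partial s}\frac{\Gamma'(\chi,s)}{\Gamma(\chi,s)}$. On $L^2(F,dy)$ let $A$ be multiplication by $\log|y|$ with its maximal domain, let $B$ be the Fourier conjugate operator, which multiplies the Fourier transform by $\log|x|$, with its maximal domain, and consider the commutator $i[B,A]f=i(BAf-ABf)$ on the domain $D$ of all $f$ for which both $BAf$ and $ABf$ are defined. **Theorem.** For each such $F$ (with $\lambda$): 1. For every unitary $\chi$, $\Gamma(\chi,s)$ is well defined (it exists, with absolutely convergent integrals, and is unique), analytic and non-vanishing in the strip $0<\mathrm{Re}(s)<1$. 2. There is a constant $C$ such that $|K(\chi,\tfrac12+it)|\le C$ for all unitary characters $\chi$ of $F^\times$ and all $t\in\mathbb R$. 3. $D$ is dense in $L^2(F,dy)$, and $i[B,A]$ agrees on $D$ with a bounded hermitian (self-adjoint) operator $K$ on $L^2(F,dy)$. Every test function $\alpha$ vanishing in a neighbourhood of the origin belongs to $D$, and for all unitary $\chi$ and all $s=\tfrac12+it$ with $t\in\mathbb R$, $$-\int_F (K\alpha)(y)\,\chi^{-1}(y)|y|^{-s}\,dy=K(\chi,s)\int_F\alpha(y)\,\chi^{-1}(y)|y|^{-s}\,dy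 ,$$ the integral on the left being absolutely convergent. 4. Let $\psi=\Gamma'/\Gamma$ be the digamma function (logarithmic derivative of Euler's Gamma function). For $F=\mathbb R$, with $\chi_+=1$ and $\chi_-=\mathrm{sgn}$, and for $0<\mathrm{Re}(s)<1$, $$K(\chi_+,s)=-\tfrac i4\left(\psi'(\tfrac s2)-\psi'(\tfrac{1-s}2)\right),\qquad K(\chi_-,s)=-\tfrac i4\left(\psi'(\tfrac{1+s}2)-\psi'(\tfrac{2-s}2)\right),$$ and for $t\in\mathbb R$ $$K(\chi_+,\tfrac12+it)=-\sum_{j\ge0}\frac{(4j+1)\,2t}{((2j+\frac12)^2+t^2)^2},\qquad K(\chi_-,\tfrac12+it)=-\sum_{j\ge0}\frac{(4j+3)\,2t}{((2j+\frac32)^2+t^2)^2}.$$ For $F=\mathbb C$, $\chi_N(z)=z^N(z\bar z)^{-N/2}$ with $N\in\mathbb Z$, and for $0<\mathrm{Re}(s)<1$, $$K(\chi_N,s)=-i\left(\psi'(\tfrac{|N|}2+s)-\psi'(\tfrac{|N|}2+1-s)\right),$$ and for $t\in\mathbb R$ $$K(\chi_N,\tfrac12+it)=-\sum_{j\ge0}\frac{(2j+|N|+1)\,2t}{((j+\frac{|N|+1}2)^2+t^2)^2}.$$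 -/

import Mathlib

open MeasureTheory Filter Topology
open scoped ENNReal SchwartzMap

noncomputable section

namespace LocalCommutator

section General

variable {F : Type*} [NontriviallyNormedField F] [ProperSpace F]

/-- The normalized absolute value `|x|` of a locally compact field: the factor by which
multiplication by `x` scales additive Haar measure (the usual absolute value on `ℝ`, its square
on `ℂ`, and `q ^ (-v x)` on a non-archimedean local field with residue field of cardinality `q`). -/
def modulus (x : F) : ℝ :=
  open Classical in
  if h : x = 0 then 0 else (distribHaarChar F (Units.mk0 x h) : ℝ)

/-- The multiplicative quasi-character `x ↦ χ(x) |x| ^ s` on the nonzero elements of `F`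
(given the value `0` at the origin). -/
def quasiChar (χ : Fˣ →ₜ* Circle) (s : ℂ) (x : F) : ℂ :=
  open Classical in
  if h : x = 0 then 0 else (χ (Units.mk0 x h) : ℂ) * ((modulus x : ℝ) : ℂ) ^ s

variable [MeasurableSpace F]

/-- The Fourier transform `x ↦ ∫ ψ(-xy) φ(y) dμ(y)`. -/
def fourier (ψ : AddChar F Circle) (μ : Measure F) (φ : F → ℂ) : F → ℂ :=
  VectorFourier.fourierIntegral ψ μ (LinearMap.mul F F) φ

/-- `μ` is self-dual for `ψ`: Fourier inversion `φ^^(x) = φ(-x)` holds on the space `S` of test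
functions. -/
def IsSelfDual (ψ : AddChar F Circle) (μ : Measure F) (S : Set (F → ℂ)) : Prop :=
  ∀ φ ∈ S, ∀ x, fourier ψ μ (fourier ψ μ φ) x = φ (-x)

/-! ### The Tate-Gel'fand-Graev Gamma function and the spectral function -/

/-- `c` is a possible value of `Γ(χ, s)`: for all test functions `φ`, both integrals below converge
absolutely and `∫ φ^(x) χ(x) |x| ^ (s - 1) dx = c * ∫ φ(y) χ⁻¹(y) |y| ^ (-s) dy`. -/
def IsGammaValue (ψ : AddChar F Circle) (μ : Measure F) (S : Set (F → ℂ))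
    (χ : Fˣ →ₜ* Circle) (s c : ℂ) : Prop :=
  ∀ φ ∈ S,
    Integrable (fun x => fourier ψ μ φ x * quasiChar χ (s - 1) x) μ ∧
    Integrable (fun y => φ y * quasiChar χ⁻¹ (-s) y) μ ∧
    ∫ x, fourier ψ μ φ x * quasiChar χ (s - 1) x ∂μ =
      c * ∫ y, φ y * quasiChar χ⁻¹ (-s) y ∂μ

/-- The Gamma function `Γ(χ, s)` of a unitary character `χ`, for `s` in the critical strip. -/
def gammaFactor (ψ : AddChar F Circle) (μ : Measure F) (S : Set (F → ℂ))
    (χ : Fˣ →ₜ* Circle) (s : ℂ) : ℂ :=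
  Classical.epsilon (IsGammaValue ψ μ S χ s)

/-- For every unitary character, `Γ(χ, s)` is well defined (it satisfies its defining identity and
is the only number that does), non-vanishing, and analytic for `s` in the critical strip. -/
def HasGammaFactor (ψ : AddChar F Circle) (μ : Measure F) (S : Set (F → ℂ)) : Prop :=
  ∀ χ : Fˣ →ₜ* Circle,
    (∀ s : ℂ, 0 < s.re → s.re < 1 →
      IsGammaValue ψ μ S χ s (gammaFactor ψ μ S χ s) ∧
      (∀ c, IsGammaValue ψ μ S χ s c → c = gammaFactor ψ μ S χ s) ∧
      gammaFactor ψ μ S χ s ≠ 0) ∧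
    DifferentiableOn ℂ (gammaFactor ψ μ S χ) {s | 0 < s.re ∧ s.re < 1}

/-- The spectral function of the commutator operator,
`K(χ, s) = -i ∂²/∂s² log Γ(χ, s)`, for `s` in the critical strip. -/
def spectralK (ψ : AddChar F Circle) (μ : Measure F) (S : Set (F → ℂ))
    (χ : Fˣ →ₜ* Circle) (s : ℂ) : ℂ :=
  -Complex.I * deriv (logDeriv (gammaFactor ψ μ S χ)) s

/-! ### The unbounded operators `A`, `B` and their commutator on `L²(F, μ)` -/

/-- `g = A f`, where `A` is multiplication by `log |y|` with its maximal domain in `L²`. -/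
def GraphA (μ : Measure F) (f g : Lp ℂ 2 μ) : Prop :=
  (g : F → ℂ) =ᵐ[μ] fun y => ((Real.log (modulus y) : ℝ) : ℂ) * f y

/-- `g ∈ L²` is the Fourier transform of `f ∈ L²` in the sense of distributions. -/
def IsFourierTransform (ψ : AddChar F Circle) (μ : Measure F) (S : Set (F → ℂ))
    (f g : Lp ℂ 2 μ) : Prop :=
  ∀ φ ∈ S, ∫ x, g x * φ x ∂μ = ∫ y, f y * fourier ψ μ φ y ∂μ

/-- `g = B f`, where `B` acts as multiplication by `log |x|` on Fourier transforms (with its maximal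
domain in `L²`). -/
def GraphB (ψ : AddChar F Circle) (μ : Measure F) (S : Set (F → ℂ)) (f g : Lp ℂ 2 μ) : Prop :=
  ∃ f' g' : Lp ℂ 2 μ,
    IsFourierTransform ψ μ S f f' ∧ IsFourierTransform ψ μ S g g' ∧ GraphA μ f' g'

/-- `g = i [B, A] f = i (B A f - A B f)`, on the natural domain of all `f` in the domains
of both `A B` and `B A`. -/
def GraphCommutator (ψ : AddChar F Circle) (μ : Measure F) (S : Set (F → ℂ))
    (f g : Lp ℂ 2 μ) : Prop :=
  ∃ a b ba ab : Lp ℂ 2 μ,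
    GraphA μ f a ∧ GraphB ψ μ S a ba ∧ GraphB ψ μ S f b ∧ GraphA μ b ab ∧
    g = Complex.I • (ba - ab)

/-- The natural domain of the commutator. -/
def commutatorDomain (ψ : AddChar F Circle) (μ : Measure F) (S : Set (F → ℂ)) :
    Set (Lp ℂ 2 μ) :=
  {f | ∃ g, GraphCommutator ψ μ S f g}

/-- Test functions vanishing near the origin lie in the domain of the commutator, and on them the
bounded operator `K` has spectral function `K(χ, s)` on the critical line `s = 1/2 + it`: the
identity of distributions `K(χ⁻¹(y) |y| ^ (-s)) = K(χ, s) χ⁻¹(y) |y| ^ (-s)` holds on the punctured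
line, `K` acting on distributions by `⟨K D, α⟩ = -⟨D, K α⟩`. -/
def HasSpectralFunction (ψ : AddChar F Circle) (μ : Measure F) (S : Set (F → ℂ))
    (K : Lp ℂ 2 μ →L[ℂ] Lp ℂ 2 μ) : Prop :=
  ∀ α ∈ S, α =ᶠ[𝓝 (0 : F)] 0 → ∀ f : Lp ℂ 2 μ, (f : F → ℂ) =ᵐ[μ] α →
    f ∈ commutatorDomain ψ μ S ∧
    ∀ (χ : Fˣ →ₜ* Circle) (t : ℝ),
      Integrable (fun y => (K f) y * quasiChar χ⁻¹ (-(1 / 2 + t * Complex.I)) y) μ ∧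
      -∫ y, (K f) y * quasiChar χ⁻¹ (-(1 / 2 + t * Complex.I)) y ∂μ =
        spectralK ψ μ S χ (1 / 2 + t * Complex.I) *
          ∫ y, α y * quasiChar χ⁻¹ (-(1 / 2 + t * Complex.I)) y ∂μ

/-- The commutator operator `i [B, A]` is densely defined, and agrees on its domain with a bounded
hermitian operator on `L²(F, μ)`, whose spectral functions are the `K(χ, 1/2 + it)`. -/
def CommutatorIsBoundedHermitian (ψ : AddChar F Circle) (μ : Measure F) (S : Set (F → ℂ)) :
    Prop :=
  Dense (commutatorDomain ψ μ S) ∧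
  ∃ K : Lp ℂ 2 μ →L[ℂ] Lp ℂ 2 μ,
    IsSelfAdjoint K ∧
    (∀ f g, GraphCommutator ψ μ S f g → g = K f) ∧
    HasSpectralFunction ψ μ S K

end General

/-! ### Test functions, additive characters and measures at the three kinds of places -/

/-- Schwartz-Bruhat functions on a non-archimedean local field: locally constant functions with
compact support. -/
def bruhat (F : Type*) [TopologicalSpace F] : Set (F → ℂ) :=
  {φ | IsLocallyConstant φ ∧ HasCompactSupport φ}

/-- Schwartz functions on `ℝ` or `ℂ`. -/
def schwartz (F : Type*) [NormedAddCommGroup F] [NormedSpace ℝ F] : Set (F → ℂ) :=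
  Set.range fun φ : 𝓢(F, ℂ) => (φ : F → ℂ)

/-- `x ↦ exp(-2πi Tr x)` on `ℝ` or `ℂ`, with the trace down to `ℝ`. -/
def archChar (F : Type*) [NormedField F] [NormedAlgebra ℝ F] : AddChar F Circle :=
  Real.fourierChar⁻¹.compAddMonoidHom (Algebra.trace ℝ F).toAddMonoidHom

/-- The measure on `ℂ` that is self-dual for `exp(-2πi Tr)`: twice Lebesgue measure. -/
abbrev complexMeasure : Measure ℂ := (2 : ℝ≥0∞) • volume

/-- The point `u / ‖u‖` of the unit circle. -/
def unitVal (u : ℂˣ) : Circle :=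
  ⟨(u : ℂ) / (‖(u : ℂ)‖ : ℂ), mem_sphere_zero_iff_norm.2 (by
    have h : ‖(u : ℂ)‖ ≠ 0 := norm_ne_zero_iff.mpr u.ne_zero
    simp [h])⟩

theorem coe_unitVal (u : ℂˣ) : (unitVal u : ℂ) = (u : ℂ) / (‖(u : ℂ)‖ : ℂ) := rfl

/-- The character `u ↦ u / ‖u‖` of `ℂˣ`. -/
def unitPart : ℂˣ →ₜ* Circle where
  toFun := unitVal
  map_one' := by
    apply Circle.ext
    rw [coe_unitVal]
    simp
  map_mul' u v := by
    apply Circle.ext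
    rw [Circle.coe_mul]
    simp only [coe_unitVal, Units.val_mul, norm_mul, Complex.ofReal_mul]
    rw [mul_div_mul_comm]
  continuous_toFun := by
    refine Continuous.subtype_mk ?_ _
    refine Units.continuous_val.div
      (Complex.continuous_ofReal.comp (continuous_norm.comp Units.continuous_val)) fun u => ?_
    simp

/-- The character `χ_N(z) = z ^ N (z z̄) ^ (-N/2) = (z / ‖z‖) ^ N` of `ℂˣ`. -/
def complexChar (N : ℤ) : ℂˣ →ₜ* Circle where
  toMonoidHom := (zpowGroupHom N).comp unitPart.toMonoidHom
  continuous_toFun := (continuous_zpow N).comp unitPart.continuous_toFun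

/-- The sign character `χ₋(u) = u / |u|` of `ℝˣ`. -/
def signChar : ℝˣ →ₜ* Circle :=
  unitPart.comp
    { toMonoidHom := Units.map (Complex.ofRealHom : ℝ →* ℂ)
      continuous_toFun := Continuous.units_map _ Complex.continuous_ofReal }

end LocalCommutator

end

noncomputable section

namespace LocalCommutator

/-! ### The modulus and Haar measure -/

section Modulus

set_option linter.unusedSectionVars false

open scoped Pointwise

variable {F : Type*} [NontriviallyNormedField F] [ProperSpace F]

/-! The commutator is an integral operator whose kernel can be written down. By homogeneity the
Fourier transform of `log |x|` is, away from the origin, a multiple `-c |y|⁻¹`, so `B` is formally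
convolution with `-c |x - y|⁻¹`, suitably regularised on the diagonal. Commuting with multiplication
by `log |y|` multiplies the kernel by a difference of logarithms. This removes the regularisation
and leaves `i c (log |x| - log |y|) / |x - y|`, which is hermitian and homogeneous of degree `-1`
(`commutator_apply`).

Everything about this operator reduces to the convergence of the single integral `∫ |log |u|| |1 -
u|⁻¹ |u|^(-1/2) du` (`integrable_kernel`). Near `u = 1` it converges because `log |u|` vanishes
there; at `0` and infinity the exponent `-1/2` suffices. By homogeneity the Schur test with weight
`|x|^(-1/2)` gives boundedness (`exists_isSchurKernel`). The same substitution `x = y u` shows that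
`χ⁻¹(y) |y|^(-1/2 - it)` is an eigenfunction whose eigenvalue is bounded by a constant times that
integral, uniformly in `χ` and `t` (`integral_kernel_quasiChar`, `norm_kernelEigenvalue_le`).

The Gamma function enters through Tate's exchange argument: `∫∫ f(y) γ(yz) χ(z)|z|^(s-1) dy dz` is
unchanged when `(f, γ)` is replaced by `(g, η)`, where `f` and `g` are the inverse Fourier
transforms of `η` and `γ` (`tate_exchange`). Hence the quotient of the two Mellin integrals does not
depend on the test function, and numerator and denominator are holomorphic. With `log |z|` as
weight, the same argument computes the transform of `log |x|` (`log_exchange`). Differentiating the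
defining identity of `Γ(χ, s)` in `s` shows that `A + B` acts by `Γ'/Γ` (`conductor_eigenvalue`);
differentiating again shows that `B A - A B` acts by `(Γ'/Γ)'` (`commutator_eigenvalue`). Comparing
with the kernel on one bump function near `1` identifies `K(χ, 1/2 + it)` with minus the kernel
eigenvalue (`spectralK_eq`), which yields the uniform bound without knowing `Γ` explicitly.

All of this uses only the properties collected in `IsTestSpace`, which are verified for locally
constant functions (`isTestSpace_bruhat`) and for Schwartz functions (`isTestSpace_schwartz`). For
`ℝ` and `ℂ`, Gaussians times powers evaluate `Γ(χ, s)` as a quotient of Euler Gamma functions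
(`gammaFactor_of_gaussian`), and the series come from the partial fraction expansion of the trigamma
function (`hasSum_deriv_digamma`). -/

@[simp] theorem modulus_zero : modulus (0 : F) = 0 := by simp [modulus]

theorem modulus_of_ne {x : F} (h : x ≠ 0) :
    modulus x = (distribHaarChar F (Units.mk0 x h) : ℝ) := by simp [modulus, h]

theorem modulus_pos {x : F} (h : x ≠ 0) : 0 < modulus x := by
  rw [modulus_of_ne h]; exact_mod_cast distribHaarChar_pos

theorem modulus_nonneg (x : F) : 0 ≤ modulus x := by
  by_cases h : x = 0
  · simp [h]
  · exact (modulus_pos h).le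

theorem modulus_ne_zero {x : F} (h : x ≠ 0) : modulus x ≠ 0 := (modulus_pos h).ne'

@[simp] theorem modulus_one : modulus (1 : F) = 1 := by
  rw [modulus_of_ne one_ne_zero]; simp

theorem modulus_mul (x y : F) : modulus (x * y) = modulus x * modulus y := by
  by_cases hx : x = 0
  · simp [hx]
  by_cases hy : y = 0
  · simp [hy]
  rw [modulus_of_ne hx, modulus_of_ne hy, modulus_of_ne (mul_ne_zero hx hy), Units.mk0_mul,
    map_mul, NNReal.coe_mul]

theorem modulus_inv (x : F) : modulus x⁻¹ = (modulus x)⁻¹ := by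
  by_cases hx : x = 0
  · simp [hx]
  refine eq_inv_of_mul_eq_one_left ?_
  rw [← modulus_mul, inv_mul_cancel₀ hx, modulus_one]

theorem modulus_div (x y : F) : modulus (x / y) = modulus x / modulus y := by
  rw [div_eq_mul_inv, modulus_mul, modulus_inv, div_eq_mul_inv]

theorem modulus_pow (x : F) (n : ℕ) : modulus (x ^ n) = modulus x ^ n := by
  induction n with
  | zero => simp
  | succ n ih => rw [pow_succ, modulus_mul, ih, pow_succ]

@[simp] theorem modulus_neg (x : F) : modulus (-x) = modulus x := by
  have h : modulus (-1 : F) = 1 := by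
    have h1 : modulus (-1 : F) * modulus (-1 : F) = 1 := by rw [← modulus_mul]; simp
    nlinarith [modulus_nonneg (-1 : F)]
  rw [← neg_one_mul, modulus_mul, h, one_mul]

theorem modulus_sub_comm (x y : F) : modulus (x - y) = modulus (y - x) := by
  rw [← modulus_neg, neg_sub]

variable [MeasurableSpace F] [BorelSpace F] (μ : Measure F) [μ.IsAddHaarMeasure]

theorem measure_smul_set {x : F} (hx : x ≠ 0) (s : Set F) :
    μ (x • s) = ENNReal.ofReal (modulus x) * μ s := by
  have := distribHaarChar_mul μ (Units.mk0 x hx) s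
  rw [modulus_of_ne hx, ENNReal.ofReal_coe_nnreal, this]
  rfl

theorem map_mul_left {x : F} (hx : x ≠ 0) :
    Measure.map (x * ·) μ = ENNReal.ofReal (modulus x)⁻¹ • μ := by
  ext s hs
  rw [Measure.map_apply (by fun_prop) hs, Measure.smul_apply, ← modulus_inv, smul_eq_mul,
    ← measure_smul_set μ (inv_ne_zero hx)]
  congr 1
  ext y
  simp [Set.mem_smul_set_iff_inv_smul_mem₀ (inv_ne_zero hx)]

theorem measurableEmbedding_mul_left {x : F} (hx : x ≠ 0) : MeasurableEmbedding (x * ·) :=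
  (Homeomorph.mulLeft₀ x hx).measurableEmbedding

theorem lintegral_comp_mul {x : F} (hx : x ≠ 0) (f : F → ℝ≥0∞) :
    ∫⁻ y, f (x * y) ∂μ = ENNReal.ofReal (modulus x)⁻¹ * ∫⁻ y, f y ∂μ := by
  rw [← (measurableEmbedding_mul_left hx).lintegral_map, map_mul_left μ hx, lintegral_smul_measure,
    smul_eq_mul]

theorem integral_comp_mul {x : F} (hx : x ≠ 0) (f : F → ℂ) :
    ∫ y, f (x * y) ∂μ = ((modulus x)⁻¹ : ℝ) * ∫ y, f y ∂μ := by
  rw [← (measurableEmbedding_mul_left hx).integral_map, map_mul_left μ hx, integral_smul_measure,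
    ENNReal.toReal_ofReal (inv_nonneg.2 (modulus_nonneg x)), Complex.real_smul]

theorem integral_eq_comp_mul {x : F} (hx : x ≠ 0) (f : F → ℂ) :
    ∫ y, f y ∂μ = (modulus x : ℝ) * ∫ y, f (x * y) ∂μ := by
  rw [integral_comp_mul μ hx, ← mul_assoc, ← Complex.ofReal_mul,
    mul_inv_cancel₀ (modulus_ne_zero hx), Complex.ofReal_one, one_mul]

theorem integrable_comp_mul_iff {E : Type*} [NormedAddCommGroup E] {x : F} (hx : x ≠ 0)
    (f : F → E) : Integrable (fun y => f (x * y)) μ ↔ Integrable f μ := by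
  have := (measurableEmbedding_mul_left hx).integrable_map_iff (μ := μ) (g := f)
  rw [map_mul_left μ hx, integrable_smul_measure] at this
  · exact this.symm
  · simpa using modulus_pos hx
  · simp

omit [MeasurableSpace F] [BorelSpace F] in
-- For `x` near `x₀` the set `x • V`, with `V` the unit ball, lies in a thin closed thickening of
-- the compact set `x₀ • V`, and the measures of these thickenings tend to that of `x₀ • V`.
theorem modulus_usc (x₀ : F) {ε : ℝ} (hε : 0 < ε) :
    ∀ᶠ x in 𝓝 x₀, modulus x < modulus x₀ + ε := by
  borelize F
  let μ : Measure F := Measure.addHaar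
  set V : Set F := Metric.closedBall 0 1 with hV
  have hVc : IsCompact V := isCompact_closedBall _ _
  have hV0 : 0 < μ V := Metric.measure_closedBall_pos _ _ one_pos
  have hVf : μ V ≠ ∞ := hVc.measure_lt_top.ne
  have key : ∀ x : F, μ (x • V) = ENNReal.ofReal (modulus x) * μ V := by
    intro x
    by_cases hx : x = 0
    · rw [hx, Set.zero_smul_set ⟨0, by simp [hV]⟩, ← Set.singleton_zero, measure_singleton]
      simp
    · exact measure_smul_set μ hx V
  have hc : IsCompact (x₀ • V) := hVc.smul x₀
  have ht := (tendsto_measure_cthickening_of_isCompact (μ := μ) hc)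
  have ht2 : Tendsto (fun x : F => μ (Metric.cthickening ‖x - x₀‖ (x₀ • V))) (𝓝 x₀)
      (𝓝 (μ (x₀ • V))) := by
    refine ht.comp ?_
    have : ContinuousAt (fun x : F => ‖x - x₀‖) x₀ := by fun_prop
    simpa [ContinuousAt] using this
  have hlt : μ (x₀ • V) < ENNReal.ofReal (modulus x₀ + ε) * μ V := by
    rw [key, ENNReal.ofReal_add (modulus_nonneg _) hε.le, add_mul]
    refine ENNReal.lt_add_right ?_ ?_
    · exact ENNReal.mul_ne_top (by simp) hVf
    · simp [hε, hV0.ne']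
  filter_upwards [ht2.eventually_lt_const hlt] with x hx
  have h1 : x • V ⊆ Metric.cthickening ‖x - x₀‖ (x₀ • V) := by
    rintro _ ⟨v, hv, rfl⟩
    refine Metric.mem_cthickening_of_dist_le _ (x₀ • v) _ _ ⟨v, hv, rfl⟩ ?_
    have : ‖v‖ ≤ 1 := by simpa [hV] using hv
    simp only [smul_eq_mul]
    rw [dist_eq_norm, ← sub_mul, norm_mul]
    exact mul_le_of_le_one_right (norm_nonneg _) this
  have h2 := (measure_mono h1).trans_lt hx
  rw [key, ENNReal.mul_lt_mul_iff_left hV0.ne' hVf] at h2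
  exact (ENNReal.ofReal_lt_ofReal_iff_of_nonneg (modulus_nonneg _)).1 h2

omit [MeasurableSpace F] [BorelSpace F] in
-- Lower semicontinuity at `x₀ ≠ 0` is upper semicontinuity at `x₀⁻¹`, read through inversion.
@[fun_prop] theorem continuous_modulus : Continuous (modulus : F → ℝ) := by
  rw [continuous_iff_continuousAt]
  intro x₀
  by_cases hx₀ : x₀ = 0
  · subst hx₀
    rw [Metric.continuousAt_iff']
    intro ε hε
    filter_upwards [modulus_usc (0 : F) hε] with x hx
    simpa [abs_of_nonneg (modulus_nonneg x)] using hx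
  · refine tendsto_order.2 ⟨fun a ha => ?_, fun a ha => ?_⟩
    · rcases le_or_gt a 0 with h0 | h0
      · filter_upwards [isOpen_ne.mem_nhds hx₀] with x hx using h0.trans_lt (modulus_pos hx)
      · have h3 : 0 < a⁻¹ - (modulus x₀)⁻¹ := sub_pos.2 ((inv_lt_inv₀ (modulus_pos hx₀) h0).2 ha)
        have h4 := (tendsto_inv₀ hx₀).eventually (modulus_usc x₀⁻¹ h3)
        filter_upwards [h4, isOpen_ne.mem_nhds hx₀] with x hx hx0
        rw [modulus_inv, modulus_inv, add_sub_cancel] at hx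
        exact (inv_lt_inv₀ (modulus_pos hx0) h0).1 hx
    · filter_upwards [modulus_usc x₀ (sub_pos.2 ha)] with x hx
      linarith

omit [MeasurableSpace F] [BorelSpace F] in
-- The powers of `x` tend to `0`, so by continuity the powers of its modulus do too.
theorem modulus_lt_one {x : F} (hx : ‖x‖ < 1) : modulus x < 1 := by
  have h1 := tendsto_pow_atTop_nhds_zero_of_norm_lt_one hx
  have h2 := (continuous_modulus (F := F)).continuousAt.tendsto.comp h1
  simp only [modulus_zero, Function.comp_def, modulus_pow] at h2
  by_contra! h
  have h3 : ∀ n : ℕ, 1 ≤ modulus x ^ n := fun n => one_le_pow₀ h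
  exact absurd (ge_of_tendsto' h2 h3) (by norm_num)

omit [MeasurableSpace F] [BorelSpace F] in
-- If the modulus exceeded `1`, then for a fixed `a` with `0 < ‖a‖ < 1` and large `n` the element `x
-- ^ n * a` would have norm below `1` but modulus above `1`.
theorem modulus_le_one {x : F} (hx : ‖x‖ ≤ 1) : modulus x ≤ 1 := by
  by_contra! h
  have hx0 : x ≠ 0 := by rintro rfl; simp at h; linarith
  obtain ⟨a, ha0, ha1⟩ := NormedField.exists_norm_lt F one_pos
  have ha0' : a ≠ 0 := norm_pos_iff.1 ha0
  obtain ⟨n, hn⟩ := pow_unbounded_of_one_lt ((modulus a)⁻¹) h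
  have h1 : modulus (x ^ n * a) < 1 := by
    apply modulus_lt_one
    rw [norm_mul, norm_pow]
    exact (mul_le_of_le_one_left ha0.le (pow_le_one₀ (norm_nonneg _) hx)).trans_lt ha1
  rw [modulus_mul, modulus_pow] at h1
  have := (inv_lt_iff_one_lt_mul₀ (modulus_pos ha0')).1 hn
  linarith

omit [MeasurableSpace F] [BorelSpace F] in
theorem one_le_modulus {x : F} (hx : 1 ≤ ‖x‖) : 1 ≤ modulus x := by
  have h0 : x ≠ 0 := norm_pos_iff.1 (by linarith)
  have := modulus_le_one (x := x⁻¹) (by rw [norm_inv]; exact inv_le_one_of_one_le₀ hx)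
  rw [modulus_inv] at this
  exact (inv_le_one₀ (modulus_pos h0)).1 this

@[fun_prop] theorem measurable_modulus : Measurable (modulus : F → ℝ) :=
  continuous_modulus.measurable

theorem ae_ne_zero : ∀ᵐ x ∂μ, x ≠ 0 := by
  simp [ae_iff]

end Modulus

/-! ### Quasi-characters -/

section QuasiChar

set_option linter.unusedSectionVars false

variable {F : Type*} [NontriviallyNormedField F] [ProperSpace F]

@[simp] theorem quasiChar_zero (χ : Fˣ →ₜ* Circle) (s : ℂ) : quasiChar χ s (0 : F) = 0 := by
  simp [quasiChar]

theorem quasiChar_of_ne (χ : Fˣ →ₜ* Circle) (s : ℂ) {x : F} (h : x ≠ 0) :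
    quasiChar χ s x = (χ (Units.mk0 x h) : ℂ) * ((modulus x : ℝ) : ℂ) ^ s := by
  simp [quasiChar, h]

theorem norm_quasiChar (χ : Fˣ →ₜ* Circle) (s : ℂ) {x : F} (h : x ≠ 0) :
    ‖quasiChar χ s x‖ = modulus x ^ s.re := by
  rw [quasiChar_of_ne _ _ h, norm_mul, Circle.norm_coe, one_mul,
    Complex.norm_cpow_eq_rpow_re_of_pos (modulus_pos h)]

theorem quasiChar_mul (χ : Fˣ →ₜ* Circle) (s : ℂ) (x y : F) :
    quasiChar χ s (x * y) = quasiChar χ s x * quasiChar χ s y := by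
  by_cases hx : x = 0
  · simp [hx]
  by_cases hy : y = 0
  · simp [hy]
  rw [quasiChar_of_ne _ _ hx, quasiChar_of_ne _ _ hy, quasiChar_of_ne _ _ (mul_ne_zero hx hy),
    Units.mk0_mul, map_mul, modulus_mul, Complex.ofReal_mul,
    Complex.mul_cpow_ofReal_nonneg (modulus_nonneg _) (modulus_nonneg _), Circle.coe_mul]
  ring

theorem quasiChar_mul_cpow (χ : Fˣ →ₜ* Circle) (s t : ℂ) {x : F} (hx : x ≠ 0) :
    quasiChar χ s x * ((modulus x : ℝ) : ℂ) ^ t = quasiChar χ (s + t) x := by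
  rw [quasiChar_of_ne _ _ hx, quasiChar_of_ne _ _ hx,
    Complex.cpow_add _ _ (Complex.ofReal_ne_zero.2 (modulus_ne_zero hx)), mul_assoc]

theorem quasiChar_mul_modulus (χ : Fˣ →ₜ* Circle) (s : ℂ) (x : F) :
    quasiChar χ s x * (modulus x : ℝ) = quasiChar χ (s + 1) x := by
  by_cases hx : x = 0
  · simp [hx]
  · rw [← quasiChar_mul_cpow _ _ _ hx, Complex.cpow_one]

theorem quasiChar_mul_inv (χ : Fˣ →ₜ* Circle) (s : ℂ) {x : F} (hx : x ≠ 0) :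
    quasiChar χ s x * quasiChar χ⁻¹ (-s) x = 1 := by
  rw [quasiChar_of_ne _ _ hx, quasiChar_of_ne _ _ hx, Complex.cpow_neg]
  have h1 : (χ (Units.mk0 x hx) : ℂ) ≠ 0 := Circle.coe_ne_zero _
  have h2 : ((modulus x : ℝ) : ℂ) ^ s ≠ 0 := by
    simp [Complex.cpow_eq_zero_iff, modulus_ne_zero hx]
  have h3 : ((χ⁻¹ (Units.mk0 x hx) : Circle) : ℂ) = (χ (Units.mk0 x hx) : ℂ)⁻¹ := by
    rw [← Circle.coe_inv]; rfl
  rw [h3]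
  field_simp

theorem quasiChar_one_ofReal (r : ℝ) {x : F} (hx : x ≠ 0) :
    quasiChar 1 (r : ℂ) x = ((modulus x ^ r : ℝ) : ℂ) := by
  rw [quasiChar_of_ne _ _ hx, Complex.ofReal_cpow (modulus_nonneg x)]
  simp

theorem continuousOn_quasiChar (χ : Fˣ →ₜ* Circle) (s : ℂ) :
    ContinuousOn (quasiChar χ s) ({0}ᶜ : Set F) := by
  rw [continuousOn_iff_continuous_domRestrict]
  have h : ({0}ᶜ : Set F).domRestrict (quasiChar χ s) = fun x =>
      (χ (Units.mk0 x.1 x.2) : ℂ) * ((modulus x.1 : ℝ) : ℂ) ^ s := by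
    ext x
    exact quasiChar_of_ne _ _ x.2
  rw [h]
  refine Continuous.mul ?_ ?_
  · refine continuous_subtype_val.comp (χ.continuous_toFun.comp ?_)
    refine Units.continuous_iff.2 ⟨continuous_subtype_val, ?_⟩
    exact continuousOn_iff_continuous_domRestrict.1 continuousOn_inv₀
  · rw [continuous_iff_continuousAt]
    intro x
    have h1 : ((modulus x.1 : ℝ) : ℂ) ∈ Complex.slitPlane :=
      Complex.ofReal_mem_slitPlane.2 (modulus_pos x.2)
    have h2 : ContinuousAt (fun x : ({0}ᶜ : Set F) => ((modulus x.1 : ℝ) : ℂ)) x := by fun_prop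
    exact h2.cpow continuousAt_const h1

variable [MeasurableSpace F] [BorelSpace F]

@[fun_prop] theorem measurable_quasiChar (χ : Fˣ →ₜ* Circle) (s : ℂ) :
    Measurable (quasiChar χ s : F → ℂ) :=
  measurable_of_continuousOn_compl_singleton 0 (continuousOn_quasiChar χ s)

end QuasiChar

/-! ### Integrability against powers of the modulus -/

section Weights

set_option linter.unusedSectionVars false

variable {F : Type*} [NontriviallyNormedField F] [ProperSpace F] [MeasurableSpace F] [BorelSpace F]
  (μ : Measure F) [μ.IsAddHaarMeasure]

/-- A union of geometrically scaled copies of a bounded set has finite weighted measure. -/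
theorem setLIntegral_iUnion_scaled_lt_top {σ : ℝ} {u : F} (hu : u ≠ 0)
    (hr : modulus u ^ (1 - σ) < 1) {B : Set F} (hB : MeasurableSet B)
    (hBf : ∫⁻ x in B, ENNReal.ofReal (modulus x ^ (-σ)) ∂μ < ∞) :
    ∫⁻ x in ⋃ n : ℕ, (fun x => u⁻¹ ^ n * x) ⁻¹' B, ENNReal.ofReal (modulus x ^ (-σ)) ∂μ < ∞ := by
  set r := modulus u ^ (1 - σ) with hrdef
  have hr0 : 0 ≤ r := Real.rpow_nonneg (modulus_nonneg _) _
  set I := ∫⁻ x in B, ENNReal.ofReal (modulus x ^ (-σ)) ∂μ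
  -- Scaling by `u ^ n` multiplies the measure by `|u|^n` and the weight by `|u|^(-nσ)`, so the
  -- pieces form a geometric series.
  have key : ∀ n : ℕ, ∫⁻ x in (fun x => u⁻¹ ^ n * x) ⁻¹' B, ENNReal.ofReal (modulus x ^ (-σ)) ∂μ
      = ENNReal.ofReal r ^ n * I := by
    intro n
    have hun : u⁻¹ ^ n ≠ 0 := pow_ne_zero _ (inv_ne_zero hu)
    have hm : 0 < modulus u ^ n := pow_pos (modulus_pos hu) _
    have hmeas : MeasurableSet ((fun x => u⁻¹ ^ n * x) ⁻¹' B) := by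
      exact (measurable_const_mul (u⁻¹ ^ n)) hB
    rw [← lintegral_indicator hmeas, show I = ∫⁻ x, B.indicator
      (fun x => ENNReal.ofReal (modulus x ^ (-σ))) x ∂μ from (lintegral_indicator hB _).symm]
    have h1 : ∀ x, ((fun x => u⁻¹ ^ n * x) ⁻¹' B).indicator
        (fun x => ENNReal.ofReal (modulus x ^ (-σ))) x =
        ENNReal.ofReal ((modulus u ^ n) ^ (-σ)) *
          B.indicator (fun x => ENNReal.ofReal (modulus x ^ (-σ))) (u⁻¹ ^ n * x) := by
      intro x
      by_cases hx : u⁻¹ ^ n * x ∈ B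
      · rw [Set.indicator_of_mem hx, Set.indicator_of_mem (by exact hx),
          ← ENNReal.ofReal_mul (by positivity), ← Real.mul_rpow hm.le (modulus_nonneg _),
          ← modulus_pow, ← modulus_mul, ← mul_assoc, ← mul_pow, mul_inv_cancel₀ hu, one_pow,
          one_mul]
      · rw [Set.indicator_of_notMem hx, Set.indicator_of_notMem (by exact hx), mul_zero]
    simp_rw [h1]
    rw [lintegral_const_mul' _ _ ENNReal.ofReal_ne_top, lintegral_comp_mul μ hun, ← mul_assoc]
    congr 1
    rw [← ENNReal.ofReal_mul (by positivity), ← ENNReal.ofReal_pow hr0]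
    congr 1
    rw [modulus_pow, modulus_inv, inv_pow, inv_inv, hrdef, sub_eq_neg_add,
      Real.rpow_add (modulus_pos hu), Real.rpow_one, mul_pow, ← Real.rpow_natCast,
      ← Real.rpow_natCast, ← Real.rpow_mul (modulus_nonneg _),
      ← Real.rpow_mul (modulus_nonneg _), mul_comm (n : ℝ)]
  calc _ ≤ ∑' n : ℕ, ∫⁻ x in (fun x => u⁻¹ ^ n * x) ⁻¹' B,
        ENNReal.ofReal (modulus x ^ (-σ)) ∂μ := lintegral_iUnion_le _ _
    _ = (∑' n : ℕ, ENNReal.ofReal r ^ n) * I := by simp_rw [key]; rw [ENNReal.tsum_mul_right]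
    _ < ∞ := by
      refine ENNReal.mul_lt_top ?_ hBf
      rw [ENNReal.tsum_geometric]
      simpa using hr

theorem setLIntegral_shell_lt_top (σ : ℝ) {ϖ : F} (h0 : 0 < ‖ϖ‖) :
    ∫⁻ x in {x : F | ‖ϖ‖ ≤ ‖x‖ ∧ ‖x‖ ≤ 1}, ENNReal.ofReal (modulus x ^ (-σ)) ∂μ < ∞ := by
  have hc : IsCompact {x : F | ‖ϖ‖ ≤ ‖x‖ ∧ ‖x‖ ≤ 1} := by
    refine (isCompact_closedBall (0 : F) 1).of_isClosed_subset ?_ ?_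
    · exact (isClosed_le continuous_const continuous_norm).inter
        (isClosed_le continuous_norm continuous_const)
    · intro x hx; simpa using hx.2
  have hcont : ContinuousOn (fun x : F => modulus x ^ (-σ)) {x : F | ‖ϖ‖ ≤ ‖x‖ ∧ ‖x‖ ≤ 1} := by
    refine continuous_modulus.continuousOn.rpow_const fun x hx => Or.inl (modulus_ne_zero ?_)
    exact norm_pos_iff.1 (h0.trans_le hx.1)
  have := (hcont.integrableOn_compact hc (μ := μ)).lintegral_lt_top
  exact this

/-- The punctured ball is covered by the copies `ϖ ^ n • {‖ϖ‖ ≤ ‖x‖ ≤ 1}` of a compact shell, which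
contribute a geometric series of ratio `|ϖ|^(1-σ) < 1`. Overlaps do no harm to an upper bound. -/
theorem integrableOn_closedBall_rpow {σ : ℝ} (hσ : σ < 1) :
    IntegrableOn (fun x : F => modulus x ^ (-σ)) (Metric.closedBall 0 1) μ := by
  obtain ⟨ϖ, h0, h1⟩ := NormedField.exists_norm_lt F one_pos
  have hϖ : ϖ ≠ 0 := norm_pos_iff.1 h0
  have hsub : (Metric.closedBall 0 1 : Set F) ⊆
      ({0} : Set F) ∪ ⋃ n : ℕ, (fun x => ϖ⁻¹ ^ n * x) ⁻¹' {x : F | ‖ϖ‖ ≤ ‖x‖ ∧ ‖x‖ ≤ 1} := by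
    intro x hx
    by_cases hx0 : x = 0
    · exact Or.inl hx0
    · right
      have hx1 : ‖x‖ ≤ 1 := by simpa using hx
      obtain ⟨n, hn1, hn2⟩ := exists_nat_pow_near_of_lt_one (norm_pos_iff.2 hx0) hx1 h0 h1
      refine Set.mem_iUnion.2 ⟨n, ?_⟩
      have hp : 0 < ‖ϖ‖ ^ n := pow_pos h0 n
      simp only [Set.mem_preimage, Set.mem_ofPred_eq, norm_mul, norm_pow, norm_inv]
      rw [inv_pow, inv_mul_eq_div]
      constructor
      · rw [le_div_iff₀ hp]; rw [pow_succ] at hn1; linarith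
      · rw [div_le_one hp]; exact hn2
  have hm : AEStronglyMeasurable (fun x : F => modulus x ^ (-σ))
      (μ.restrict (Metric.closedBall 0 1)) :=
    (measurable_modulus.pow_const _).aestronglyMeasurable
  refine ⟨hm, ?_⟩
  rw [hasFiniteIntegral_iff_ofReal (.of_forall fun x => Real.rpow_nonneg (modulus_nonneg _) _)]
  refine (lintegral_mono_set hsub).trans_lt ((lintegral_union_le _ _ _).trans_lt ?_)
  refine ENNReal.add_lt_top.2 ⟨by simp, ?_⟩
  refine setLIntegral_iUnion_scaled_lt_top μ hϖ ?_ ?_ (setLIntegral_shell_lt_top μ σ h0)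
  · exact Real.rpow_lt_one (modulus_nonneg _) (modulus_lt_one h1) (by linarith)
  · exact ((isClosed_le continuous_const continuous_norm).inter
      (isClosed_le continuous_norm continuous_const)).measurableSet

theorem integrableOn_compl_closedBall_rpow {σ : ℝ} (hσ : 1 < σ) :
    IntegrableOn (fun x : F => modulus x ^ (-σ)) (Metric.closedBall 0 1)ᶜ μ := by
  obtain ⟨ϖ, h0, h1⟩ := NormedField.exists_norm_lt F one_pos
  have hϖ : ϖ ≠ 0 := norm_pos_iff.1 h0
  have hsub : (Metric.closedBall 0 1 : Set F)ᶜ ⊆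
      ⋃ n : ℕ, (fun x => (ϖ⁻¹)⁻¹ ^ n * x) ⁻¹' {x : F | ‖ϖ‖ ≤ ‖x‖ ∧ ‖x‖ ≤ 1} := by
    intro x hx
    have hx1 : 1 < ‖x‖ := by simpa using hx
    obtain ⟨n, hn1, hn2⟩ := exists_nat_pow_near_of_lt_one (inv_pos.2 (zero_lt_one.trans hx1))
      (inv_le_one_of_one_le₀ hx1.le) h0 h1
    -- Here `‖ϖ‖ ^ (n+1) < ‖x‖⁻¹ ≤ ‖ϖ‖ ^ n`, so it takes `n + 1` factors of `ϖ` to bring `x` into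
    -- the shell.
    refine Set.mem_iUnion.2 ⟨n + 1, ?_⟩
    have hp : 0 < ‖ϖ‖ ^ n := pow_pos h0 n
    have hx0 : 0 < ‖x‖ := by linarith
    simp only [Set.mem_preimage, Set.mem_ofPred_eq, norm_mul, norm_pow, inv_inv]
    constructor
    · rw [inv_le_comm₀ hx0 hp, inv_le_iff_one_le_mul₀' hp] at hn2
      rw [pow_succ]
      nlinarith
    · exact ((lt_div_iff₀ hx0).1 (by rwa [one_div])).le
  have hm : AEStronglyMeasurable (fun x : F => modulus x ^ (-σ))
      (μ.restrict (Metric.closedBall 0 1)ᶜ) :=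
    (measurable_modulus.pow_const _).aestronglyMeasurable
  refine ⟨hm, ?_⟩
  rw [hasFiniteIntegral_iff_ofReal (.of_forall fun x => Real.rpow_nonneg (modulus_nonneg _) _)]
  refine (lintegral_mono_set hsub).trans_lt ?_
  refine setLIntegral_iUnion_scaled_lt_top μ (inv_ne_zero hϖ) ?_ ?_
    (setLIntegral_shell_lt_top μ σ h0)
  · refine Real.rpow_lt_one_of_one_lt_of_neg ?_ (by linarith)
    rw [modulus_inv]
    exact (one_lt_inv₀ (modulus_pos hϖ)).2 (modulus_lt_one h1)
  · exact ((isClosed_le continuous_const continuous_norm).inter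
      (isClosed_le continuous_norm continuous_const)).measurableSet

/-- Measurable functions that are integrable against `|x| ^ (-σ)` for all `σ` in `(a, b)`. -/
def WeightIntegrable (a b : ℝ) (f : F → ℂ) : Prop :=
  Measurable f ∧ ∀ σ, a < σ → σ < b → Integrable (fun x => modulus x ^ (-σ) * ‖f x‖) μ

variable {μ}

theorem WeightIntegrable.mono {a b a' b' : ℝ} {f : F → ℂ} (h : WeightIntegrable μ a b f)
    (ha : a ≤ a') (hb : b' ≤ b) : WeightIntegrable μ a' b' f :=
  ⟨h.1, fun σ h1 h2 => h.2 σ (ha.trans_lt h1) (h2.trans_le hb)⟩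

theorem WeightIntegrable.integrable {a b : ℝ} {f : F → ℂ} (h : WeightIntegrable μ a b f)
    (ha : a < 0) (hb : 0 < b) : Integrable f μ := by
  refine (integrable_norm_iff h.1.aestronglyMeasurable).1 ?_
  simpa using h.2 0 ha hb

theorem abs_log_le {t ε : ℝ} (ht : 0 < t) (hε : 0 < ε) :
    |Real.log t| ≤ ε⁻¹ * (t ^ ε + t ^ (-ε)) := by
  have h1 := Real.log_le_rpow_div ht.le hε
  have h2 := Real.log_le_rpow_div (inv_pos.2 ht).le hε
  rw [Real.log_inv, Real.inv_rpow ht.le, ← Real.rpow_neg ht.le] at h2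
  have h3 : 0 < t ^ ε := Real.rpow_pos_of_pos ht _
  have h4 : 0 < t ^ (-ε) := Real.rpow_pos_of_pos ht _
  rw [div_eq_inv_mul] at h1 h2
  have h5 : 0 < ε⁻¹ := inv_pos.2 hε
  rw [abs_le]
  constructor <;> nlinarith [mul_pos h5 h3, mul_pos h5 h4]

/-- Multiplication by `log |x|`. -/
def logMul (f : F → ℂ) : F → ℂ := fun x => ((Real.log (modulus x) : ℝ) : ℂ) * f x

/-- The range of exponents is open, so the logarithm is absorbed by moving the exponent by a small
`ε` in either direction. -/
theorem WeightIntegrable.logMul {a b : ℝ} {f : F → ℂ} (h : WeightIntegrable μ a b f) :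
    WeightIntegrable μ a b (logMul f) := by
  have hm : Measurable (LocalCommutator.logMul f) := by
    have := h.1
    unfold LocalCommutator.logMul
    fun_prop
  refine ⟨hm, fun σ h1 h2 => ?_⟩
  obtain ⟨ε, hε, h3⟩ : ∃ ε > 0, ε < min (σ - a) (b - σ) :=
    exists_between (lt_min (by linarith) (by linarith))
  rw [lt_min_iff] at h3
  have hi := ((h.2 (σ - ε) (by linarith) (by linarith)).add
    (h.2 (σ + ε) (by linarith) (by linarith))).const_mul ε⁻¹
  refine hi.mono' ?_ ?_
  · exact ((measurable_modulus.pow_const _).mul hm.norm).aestronglyMeasurable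
  · filter_upwards [ae_ne_zero μ] with x hx
    have hp := modulus_pos hx
    have h0 : 0 ≤ modulus x ^ (-σ) := Real.rpow_nonneg hp.le _
    rw [Real.norm_of_nonneg (by positivity)]
    simp only [LocalCommutator.logMul, norm_mul, Complex.norm_real, Pi.add_apply, Real.norm_eq_abs]
    have e1 : modulus x ^ (-(σ - ε)) = modulus x ^ (-σ) * modulus x ^ ε := by
      rw [← Real.rpow_add hp]; ring_nf
    have e2 : modulus x ^ (-(σ + ε)) = modulus x ^ (-σ) * modulus x ^ (-ε) := by
      rw [← Real.rpow_add hp]; ring_nf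
    rw [e1, e2]
    calc modulus x ^ (-σ) * (|Real.log (modulus x)| * ‖f x‖)
        ≤ modulus x ^ (-σ) * ((ε⁻¹ * (modulus x ^ ε + modulus x ^ (-ε))) * ‖f x‖) := by
          gcongr; exact abs_log_le hp hε
      _ = _ := by ring

/-- The power `|x|^(-τ)` is integrable at the origin for `τ < 1` and at infinity for `τ > 1`; the
behaviour of `f` at `0` thus fixes the upper end of the interval and its decay the lower end. -/
theorem weightIntegrable_of_bound {f : F → ℂ} (hf : Measurable f) {C p q : ℝ}
    (h0 : ∀ x, x ≠ 0 → ‖x‖ ≤ 1 → ‖f x‖ ≤ C * modulus x ^ p)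
    (h1 : ∀ x, 1 < ‖x‖ → ‖f x‖ ≤ C * modulus x ^ (-q)) :
    WeightIntegrable μ (1 - q) (1 + p) f := by
  refine ⟨hf, fun σ ha hb => ?_⟩
  have hm : Measurable (fun x => modulus x ^ (-σ) * ‖f x‖) :=
    (measurable_modulus.pow_const _).mul hf.norm
  rw [← integrableOn_univ, ← Set.union_compl_self (Metric.closedBall (0 : F) 1)]
  have hball : MeasurableSet (Metric.closedBall (0 : F) 1) := Metric.isClosed_closedBall.measurableSet
  refine IntegrableOn.union ?_ ?_
  · refine Integrable.mono' ((integrableOn_closedBall_rpow μ (σ := σ - p) (by linarith)).const_mul C)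
      hm.aestronglyMeasurable ?_
    filter_upwards [ae_restrict_mem hball, ae_restrict_of_ae (ae_ne_zero μ)] with x hx hx0
    have hp := modulus_pos hx0
    have hn : 0 ≤ modulus x ^ (-σ) := Real.rpow_nonneg hp.le _
    rw [Real.norm_of_nonneg (by positivity), neg_sub, sub_eq_add_neg, Real.rpow_add hp]
    have := h0 x hx0 (by simpa using hx)
    calc _ ≤ modulus x ^ (-σ) * (C * modulus x ^ p) := by gcongr
      _ = _ := by ring
  · refine Integrable.mono' ((integrableOn_compl_closedBall_rpow μ (σ := σ + q)
      (by linarith)).const_mul C) hm.aestronglyMeasurable ?_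
    filter_upwards [ae_restrict_mem hball.compl, ae_restrict_of_ae (ae_ne_zero μ)] with x hx hx0
    have hp := modulus_pos hx0
    have hn : 0 ≤ modulus x ^ (-σ) := Real.rpow_nonneg hp.le _
    rw [Real.norm_of_nonneg (by positivity), neg_add, Real.rpow_add hp]
    have := h1 x (by simpa using hx)
    calc _ ≤ modulus x ^ (-σ) * (C * modulus x ^ (-q)) := by gcongr
      _ = _ := by ring

theorem WeightIntegrable.integrable_mul_quasiChar {a b : ℝ} {f : F → ℂ}
    (h : WeightIntegrable μ a b f) (χ : Fˣ →ₜ* Circle) {s : ℂ} (h1 : a < -s.re) (h2 : -s.re < b) :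
    Integrable (fun x => f x * quasiChar χ s x) μ := by
  refine (h.2 _ h1 h2).mono' (h.1.mul (measurable_quasiChar χ s)).aestronglyMeasurable ?_
  filter_upwards [ae_ne_zero μ] with x hx
  rw [norm_mul, norm_quasiChar _ _ hx, neg_neg, mul_comm]

end Weights

/-! ### The Fourier transform -/

section Fourier

set_option linter.unusedSectionVars false

variable {F : Type*} [NontriviallyNormedField F] [ProperSpace F] [MeasurableSpace F] [BorelSpace F]
  {μ : Measure F} [μ.IsAddHaarMeasure] {ψ : AddChar F Circle}

theorem fourier_apply (φ : F → ℂ) (x : F) :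
    fourier ψ μ φ x = ∫ y, (ψ (-(y * x)) : ℂ) * φ y ∂μ := rfl

theorem norm_fourier_le (φ : F → ℂ) (x : F) : ‖fourier ψ μ φ x‖ ≤ ∫ y, ‖φ y‖ ∂μ :=
  VectorFourier.norm_fourierIntegral_le_integral_norm _ _ _ _ _

theorem continuous_fourier (hψ : Continuous ψ) {φ : F → ℂ} (hφ : Integrable φ μ) :
    Continuous (fourier ψ μ φ) :=
  VectorFourier.fourierIntegral_continuous hψ (by simpa using continuous_mul) hφ

theorem integral_fourier_mul (hψ : Continuous ψ) {φ θ : F → ℂ} (hφ : Integrable φ μ)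
    (hθ : Integrable θ μ) :
    ∫ x, fourier ψ μ φ x * θ x ∂μ = ∫ y, φ y * fourier ψ μ θ y ∂μ := by
  have h : (LinearMap.mul F F).flip = LinearMap.mul F F := by
    ext; simp
  have := VectorFourier.integral_fourierIntegral_smul_eq_flip (L := LinearMap.mul F F) (μ := μ)
    (ν := μ) hψ (by simpa using continuous_mul) hφ hθ
  rw [h] at this
  simpa [fourier] using this

theorem fourier_comp_mul (φ : F → ℂ) {a : F} (ha : a ≠ 0) (x : F) :
    fourier ψ μ (fun y => φ (a * y)) x = ((modulus a)⁻¹ : ℝ) * fourier ψ μ φ (a⁻¹ * x) := by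
  rw [fourier_apply, fourier_apply, ← integral_comp_mul μ ha]
  congr 1
  ext y
  congr 3
  field_simp

theorem fourier_comp_add (φ : F → ℂ) (a x : F) :
    fourier ψ μ (fun y => φ (a + y)) x = ψ (a * x) * fourier ψ μ φ x := by
  rw [fourier_apply, fourier_apply,
    ← integral_add_left_eq_self (fun y => (ψ (-(y * x)) : ℂ) * φ y) a, ← integral_const_mul]
  congr 1
  ext y
  rw [← mul_assoc, ← Circle.coe_mul, ← AddChar.map_add_eq_mul]
  congr 3
  ring

theorem fourier_comp_neg (φ : F → ℂ) (x : F) :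
    fourier ψ μ (fun y => φ (-y)) x = fourier ψ μ φ (-x) := by
  rw [fourier_apply, fourier_apply, ← integral_neg_eq_self]
  simp

theorem fourier_conj (φ : F → ℂ) (x : F) :
    fourier ψ μ (fun y => starRingEnd ℂ (φ y)) x = starRingEnd ℂ (fourier ψ μ φ (-x)) := by
  rw [fourier_apply, fourier_apply, ← integral_conj]
  congr 1
  ext y
  rw [map_mul, ← Circle.coe_inv_eq_conj, ← AddChar.map_neg_eq_inv]
  simp

/-! ### Tate's exchange argument -/

/-- This is the multiplication formula `∫ φ^ θ = ∫ φ θ^` applied to a dilate: the factor `|z|⁻¹`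
from dilating under the Fourier transform cancels against the Jacobian of `w ↦ z w`. -/
theorem integral_mul_fourier_scaled (hψ : Continuous ψ) {η γ : F → ℂ} (hη : Integrable η μ)
    (hγ : Integrable γ μ) {z : F} (hz : z ≠ 0) :
    ∫ y, fourier ψ μ η (-y) * γ (y * z) ∂μ = ∫ w, fourier ψ μ γ (-w) * η (w * z) ∂μ := by
  have hγz : Integrable (fun y => γ (-z * y)) μ :=
    (integrable_comp_mul_iff μ (neg_ne_zero.2 hz) γ).2 hγ
  rw [← integral_neg_eq_self]
  have h1 : ∀ y, fourier ψ μ η (- -y) * γ (-y * z) = fourier ψ μ η y * γ (-z * y) := by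
    intro y; rw [neg_neg]; congr 2; ring
  simp_rw [h1]
  rw [integral_fourier_mul hψ hη hγz, integral_eq_comp_mul μ hz, ← integral_const_mul]
  congr 1
  ext w
  rw [fourier_comp_mul _ (neg_ne_zero.2 hz), modulus_neg]
  have h2 : (-z)⁻¹ * (z * w) = -w := by field_simp
  rw [h2, Complex.ofReal_inv, mul_comm w z]
  have : ((modulus z : ℝ) : ℂ) ≠ 0 := Complex.ofReal_ne_zero.2 (modulus_ne_zero hz)
  field_simp

theorem integrable_scaled_prod {u v : F → ℂ} (hu : Measurable u) (hv : Measurable v)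
    (hui : Integrable (fun y => u y * ((modulus y)⁻¹ : ℝ)) μ) (hvi : Integrable v μ) :
    Integrable (fun p : F × F => u p.1 * v (p.1 * p.2)) (μ.prod μ) := by
  have hm : Measurable (fun p : F × F => u p.1 * v (p.1 * p.2)) := by fun_prop
  rw [integrable_prod_iff hm.aestronglyMeasurable]
  constructor
  · filter_upwards [ae_ne_zero μ] with y hy
    exact ((integrable_comp_mul_iff μ hy v).2 hvi).const_mul _
  · refine (hui.norm.mul_const (∫ x, ‖v x‖ ∂μ)).congr ?_
    filter_upwards [ae_ne_zero μ] with y hy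
    simp_rw [norm_mul]
    rw [integral_const_mul]
    have := integral_comp_mul μ hy (fun x => ((‖v x‖ : ℝ) : ℂ))
    rw [integral_complex_ofReal, integral_complex_ofReal, ← Complex.ofReal_mul] at this
    rw [Complex.ofReal_injective this, Complex.norm_real, Real.norm_of_nonneg
      (inv_nonneg.2 (modulus_nonneg _)), mul_assoc]

theorem integral_integral_scaled {u v : F → ℂ} (hu : Measurable u) (hv : Measurable v)
    (hui : Integrable (fun y => u y * ((modulus y)⁻¹ : ℝ)) μ) (hvi : Integrable v μ) :
    ∫ z, ∫ y, u y * v (y * z) ∂μ ∂μ =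
      (∫ y, u y * ((modulus y)⁻¹ : ℝ) ∂μ) * ∫ x, v x ∂μ := by
  rw [← integral_integral_swap (integrable_scaled_prod hu hv hui hvi), ← integral_mul_const]
  refine integral_congr_ae ?_
  filter_upwards [ae_ne_zero μ] with y hy
  rw [integral_const_mul, integral_comp_mul μ hy, mul_assoc]

/-- The Mellin transform of a multiplicative convolution is a product. Substituting `x = y z`
produces `|y|⁻¹`, which turns the exponent `1 - s` on `y` into `-s`. -/
theorem integral_quasiChar_mul_integral {f γ : F → ℂ} (hf : Measurable f) (hγ : Measurable γ)
    (χ : Fˣ →ₜ* Circle) (s : ℂ)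
    (hfi : Integrable (fun y => f y * quasiChar χ⁻¹ (-s) y) μ)
    (hγi : Integrable (fun x => γ x * quasiChar χ (s - 1) x) μ) :
    ∫ z, quasiChar χ (s - 1) z * ∫ y, f y * γ (y * z) ∂μ ∂μ =
      (∫ y, f y * quasiChar χ⁻¹ (-s) y ∂μ) * ∫ x, γ x * quasiChar χ (s - 1) x ∂μ := by
  have e1 : ∀ y, f y * quasiChar χ⁻¹ (1 - s) y * ((modulus y)⁻¹ : ℝ) =
      f y * quasiChar χ⁻¹ (-s) y := by
    intro y
    by_cases hy : y = 0
    · simp [hy]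
    have h := quasiChar_mul_modulus χ⁻¹ (-s) y
    rw [neg_add_eq_sub] at h
    have : ((modulus y : ℝ) : ℂ) ≠ 0 := Complex.ofReal_ne_zero.2 (modulus_ne_zero hy)
    rw [← h, Complex.ofReal_inv]
    field_simp
  have key := integral_integral_scaled (μ := μ) (u := fun y => f y * quasiChar χ⁻¹ (1 - s) y)
    (v := fun x => γ x * quasiChar χ (s - 1) x) (hf.mul (measurable_quasiChar _ _))
    (hγ.mul (measurable_quasiChar _ _)) (by simpa only [e1] using hfi) hγi
  simp only [e1] at key
  rw [← key]
  congr 1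
  ext z
  rw [← integral_const_mul]
  refine integral_congr_ae ?_
  filter_upwards [ae_ne_zero μ] with y hy
  have h := quasiChar_mul_inv χ (s - 1) hy
  rw [neg_sub] at h
  rw [quasiChar_mul]
  linear_combination (-quasiChar χ (s - 1) z * f y * γ (y * z)) * h

/-- **Tate's local functional equation**, for a pair of functions with integrable inverse Fourier
transforms `η` and `γ`. -/
theorem tate_exchange (hψ : Continuous ψ) {η γ f g : F → ℂ} (hη : Integrable η μ)
    (hγ : Integrable γ μ) (hηm : Measurable η) (hγm : Measurable γ)
    (hf : ∀ y, f y = fourier ψ μ η (-y)) (hg : ∀ y, g y = fourier ψ μ γ (-y))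
    (χ : Fˣ →ₜ* Circle) (s : ℂ)
    (hfi : Integrable (fun y => f y * quasiChar χ⁻¹ (-s) y) μ)
    (hγi : Integrable (fun x => γ x * quasiChar χ (s - 1) x) μ)
    (hgi : Integrable (fun y => g y * quasiChar χ⁻¹ (-s) y) μ)
    (hηi : Integrable (fun x => η x * quasiChar χ (s - 1) x) μ) :
    (∫ y, f y * quasiChar χ⁻¹ (-s) y ∂μ) * ∫ x, γ x * quasiChar χ (s - 1) x ∂μ =
      (∫ y, g y * quasiChar χ⁻¹ (-s) y ∂μ) * ∫ x, η x * quasiChar χ (s - 1) x ∂μ := by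
  have hfm : Measurable f := by
    rw [funext hf]; exact ((continuous_fourier hψ hη).comp continuous_neg).measurable
  have hgm : Measurable g := by
    rw [funext hg]; exact ((continuous_fourier hψ hγ).comp continuous_neg).measurable
  rw [← integral_quasiChar_mul_integral hfm hγm χ s hfi hγi,
    ← integral_quasiChar_mul_integral hgm hηm χ s hgi hηi]
  refine integral_congr_ae ?_
  filter_upwards [ae_ne_zero μ] with z hz
  simp only [hf, hg]
  rw [integral_mul_fourier_scaled hψ hη hγ hz]

/-- Write `log |z| = log |yz| - log |y|`. The second term factors through `∫ γ = 0`, so only the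
first survives. -/
theorem integral_log_mul_integral {f γ : F → ℂ} (hf : Measurable f) (hγ : Measurable γ)
    (hf1 : Integrable (fun y => f y * ((modulus y)⁻¹ : ℝ)) μ)
    (hf2 : Integrable (fun y => logMul f y * ((modulus y)⁻¹ : ℝ)) μ)
    (hγ1 : Integrable γ μ) (hγ2 : Integrable (logMul γ) μ) (h0 : ∫ x, γ x ∂μ = 0) :
    ∫ z, (Real.log (modulus z) : ℂ) * ∫ y, f y * γ (y * z) ∂μ ∂μ =
      (∫ y, f y * ((modulus y)⁻¹ : ℝ) ∂μ) * ∫ x, logMul γ x ∂μ := by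
  have mf : Measurable (logMul f) := by unfold logMul; fun_prop
  have mγ : Measurable (logMul γ) := by unfold logMul; fun_prop
  have k1 := integral_integral_scaled hf mγ hf1 hγ2
  have k2 := integral_integral_scaled mf hγ hf2 hγ1
  rw [h0, mul_zero] at k2
  have i1 := integrable_scaled_prod hf mγ hf1 hγ2
  have i2 := integrable_scaled_prod mf hγ hf2 hγ1
  rw [← k1, ← sub_zero (∫ z, ∫ y, f y * logMul γ (y * z) ∂μ ∂μ), ← k2, ← integral_sub]
  · refine integral_congr_ae ?_
    filter_upwards [i1.swap.prod_right_ae, i2.swap.prod_right_ae, ae_ne_zero μ] with z h1 h2 hz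
    simp only [Function.comp_def, Prod.swap_prod_mk] at h1 h2
    rw [← integral_sub h1 h2, ← integral_const_mul]
    refine integral_congr_ae ?_
    filter_upwards [ae_ne_zero μ] with y hy
    simp only [logMul]
    rw [modulus_mul, Real.log_mul (modulus_ne_zero hy) (modulus_ne_zero hz)]
    push_cast
    ring
  · exact i1.integral_prod_right
  · exact i2.integral_prod_right

/-- The exchange argument for the functional `f ↦ ∫ log |x| f^(x) dx`. -/
theorem log_exchange (hψ : Continuous ψ) {η γ f g : F → ℂ} (hη : Integrable η μ)
    (hγ : Integrable γ μ) (hηm : Measurable η) (hγm : Measurable γ)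
    (hf : ∀ y, f y = fourier ψ μ η (-y)) (hg : ∀ y, g y = fourier ψ μ γ (-y))
    (hη2 : Integrable (logMul η) μ) (hγ2 : Integrable (logMul γ) μ)
    (hη0 : ∫ x, η x ∂μ = 0) (hγ0 : ∫ x, γ x ∂μ = 0)
    (hf1 : Integrable (fun y => f y * ((modulus y)⁻¹ : ℝ)) μ)
    (hf2 : Integrable (fun y => logMul f y * ((modulus y)⁻¹ : ℝ)) μ)
    (hg1 : Integrable (fun y => g y * ((modulus y)⁻¹ : ℝ)) μ)
    (hg2 : Integrable (fun y => logMul g y * ((modulus y)⁻¹ : ℝ)) μ) :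
    (∫ y, f y * ((modulus y)⁻¹ : ℝ) ∂μ) * ∫ x, logMul γ x ∂μ =
      (∫ y, g y * ((modulus y)⁻¹ : ℝ) ∂μ) * ∫ x, logMul η x ∂μ := by
  have hfm : Measurable f := by
    rw [funext hf]; exact ((continuous_fourier hψ hη).comp continuous_neg).measurable
  have hgm : Measurable g := by
    rw [funext hg]; exact ((continuous_fourier hψ hγ).comp continuous_neg).measurable
  rw [← integral_log_mul_integral hfm hγm hf1 hf2 hγ hγ2 hγ0,
    ← integral_log_mul_integral hgm hηm hg1 hg2 hη hη2 hη0]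
  refine integral_congr_ae ?_
  filter_upwards [ae_ne_zero μ] with z hz
  simp only [hf, hg]
  rw [integral_mul_fourier_scaled hψ hη hγ hz]

end Fourier

/-! ### Derivatives of Mellin transforms -/

section Mellin

set_option linter.unusedSectionVars false

variable {F : Type*} [NontriviallyNormedField F] [ProperSpace F] [MeasurableSpace F] [BorelSpace F]
  {μ : Measure F} [μ.IsAddHaarMeasure]

theorem hasDerivAt_quasiChar (χ : Fˣ →ₜ* Circle) (s : ℂ) (x : F) :
    HasDerivAt (fun s => quasiChar χ s x) ((Real.log (modulus x) : ℂ) * quasiChar χ s x) s := by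
  by_cases hx : x = 0
  · simpa [hx] using hasDerivAt_const s (0 : ℂ)
  simp only [quasiChar_of_ne _ _ hx]
  have h := (hasDerivAt_id s).const_cpow
    (Or.inl (Complex.ofReal_ne_zero.2 (modulus_ne_zero hx)) : ((modulus x : ℝ) : ℂ) ≠ 0 ∨ id s ≠ 0)
  refine (h.const_mul (χ (Units.mk0 x hx) : ℂ)).congr_deriv ?_
  rw [Complex.ofReal_log (modulus_nonneg x)]
  simp only [id]
  ring

theorem WeightIntegrable.hasDerivAt {a b : ℝ} {f : F → ℂ} (h : WeightIntegrable μ a b f)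
    (χ : Fˣ →ₜ* Circle) {s : ℂ} (h1 : a < -s.re) (h2 : -s.re < b) :
    HasDerivAt (fun s => ∫ x, f x * quasiChar χ s x ∂μ)
      (∫ x, LocalCommutator.logMul f x * quasiChar χ s x ∂μ) s := by
  obtain ⟨ε, hε, h3⟩ : ∃ ε > 0, ε < min (-s.re - a) (b - -s.re) :=
    exists_between (lt_min (by linarith) (by linarith))
  rw [lt_min_iff] at h3
  have hl := h.logMul
  refine (hasDerivAt_integral_of_dominated_loc_of_deriv_le (𝕜 := ℂ)
    (F := fun s x => f x * quasiChar χ s x)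
    (F' := fun s x => LocalCommutator.logMul f x * quasiChar χ s x) (Metric.ball_mem_nhds s hε)
    -- On the disc of radius `ε` around `s` the quasi-character is dominated by one extreme power
    -- where `|x| ≥ 1` and by the other where `|x| ≤ 1`; their sum serves everywhere.
    (bound := fun x => modulus x ^ (-(-s.re - ε)) * ‖LocalCommutator.logMul f x‖ +
      modulus x ^ (-(-s.re + ε)) * ‖LocalCommutator.logMul f x‖) ?_ ?_ ?_ ?_ ?_ ?_).2
  · exact .of_forall fun t => (h.1.mul (measurable_quasiChar χ t)).aestronglyMeasurable
  · exact h.integrable_mul_quasiChar χ h1 h2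
  · exact (hl.1.mul (measurable_quasiChar χ s)).aestronglyMeasurable
  · filter_upwards [ae_ne_zero μ] with x hx t ht
    have hp := modulus_pos hx
    have hre : |t.re - s.re| < ε := by
      rw [← Complex.sub_re]
      exact (Complex.abs_re_le_norm _).trans_lt (by simpa [dist_eq_norm] using ht)
    rw [abs_lt] at hre
    rw [norm_mul, norm_quasiChar _ _ hx, ← add_mul, mul_comm]
    gcongr
    rcases le_total 1 (modulus x) with h4 | h4
    · have : modulus x ^ t.re ≤ modulus x ^ (-(-s.re - ε)) :=
        Real.rpow_le_rpow_of_exponent_le h4 (by linarith)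
      have := Real.rpow_nonneg hp.le (-(-s.re + ε))
      linarith
    · have : modulus x ^ t.re ≤ modulus x ^ (-(-s.re + ε)) :=
        Real.rpow_le_rpow_of_exponent_ge hp h4 (by linarith)
      have := Real.rpow_nonneg hp.le (-(-s.re - ε))
      linarith
  · exact (hl.2 _ (by linarith) (by linarith)).add (hl.2 _ (by linarith) (by linarith))
  · refine .of_forall fun x t _ => ?_
    refine ((hasDerivAt_quasiChar χ t x).const_mul (f x)).congr_deriv ?_
    simp only [LocalCommutator.logMul]
    ring

end Mellin

/-! ### The Schur test -/

section Schur

set_option linter.unusedSectionVars false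

variable {α : Type*} [MeasurableSpace α] {μ : Measure α} [SFinite μ]

theorem lintegral_sq_lp (f : Lp ℂ 2 μ) : ∫⁻ y, ‖f y‖ₑ ^ 2 ∂μ = ENNReal.ofReal (‖f‖ ^ 2) := by
  have h1 : eLpNorm f 2 μ = ENNReal.ofReal ‖f‖ := by
    rw [Lp.norm_def, ENNReal.ofReal_toReal (Lp.eLpNorm_ne_top f)]
  rw [ENNReal.ofReal_pow (norm_nonneg _), ← h1,
    eLpNorm_eq_lintegral_rpow_enorm_toReal (by norm_num) (by norm_num), ← ENNReal.rpow_natCast,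
    ← ENNReal.rpow_mul]
  norm_num

/-- A kernel satisfying the hypotheses of the Schur test with weight `w`. -/
structure IsSchurKernel (μ : Measure α) (κ : α → α → ℂ) (w : α → ℝ≥0∞) (M : ℝ) : Prop where
  measurable : Measurable (Function.uncurry κ)
  weight_measurable : Measurable w
  weight_ne_zero : ∀ᵐ x ∂μ, w x ≠ 0
  weight_ne_top : ∀ᵐ x ∂μ, w x ≠ ∞
  nonneg : 0 ≤ M
  symm : ∀ x y, ‖κ x y‖ = ‖κ y x‖
  bound : ∀ᵐ x ∂μ, ∫⁻ y, ‖κ x y‖ₑ * w y ∂μ ≤ ENNReal.ofReal M * w x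

namespace IsSchurKernel

variable {κ : α → α → ℂ} {w : α → ℝ≥0∞} {M : ℝ} (h : IsSchurKernel μ κ w M)
include h

theorem enorm_symm (x y : α) : ‖κ x y‖ₑ = ‖κ y x‖ₑ := by
  rw [← ofReal_norm, ← ofReal_norm, h.symm]

theorem measurable_left (x : α) : Measurable (κ x) := h.measurable.of_uncurry_left

/-- Cauchy–Schwarz for the splitting `|κ| g = (|κ| w)^(1/2) * (|κ| w⁻¹ g²)^(1/2)`. -/
theorem sq_le {g : α → ℝ≥0∞} (hg : Measurable g) (x : α) :
    (∫⁻ y, ‖κ x y‖ₑ * g y ∂μ) ^ 2 ≤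
      (∫⁻ y, ‖κ x y‖ₑ * w y ∂μ) * ∫⁻ y, ‖κ x y‖ₑ * (w y)⁻¹ * g y ^ 2 ∂μ := by
  have hk : Measurable fun y => ‖κ x y‖ₑ := (h.measurable_left x).enorm
  have hw := h.weight_measurable
  have key := ENNReal.lintegral_mul_le_Lp_mul_Lq μ Real.HolderConjugate.two_two
    (f := fun y => (‖κ x y‖ₑ * w y) ^ (1 / 2 : ℝ))
    (g := fun y => (‖κ x y‖ₑ * (w y)⁻¹ * g y ^ 2) ^ (1 / 2 : ℝ))
    (by fun_prop) (by fun_prop)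
  have e : ∀ a : ℝ≥0∞, (a ^ (1 / 2 : ℝ)) ^ (2 : ℝ) = a := by
    intro a; rw [← ENNReal.rpow_mul]; norm_num
  have e2 : ∀ a : ℝ≥0∞, (a ^ (1 / 2 : ℝ)) ^ 2 = a := by
    intro a; rw [← ENNReal.rpow_natCast, ← ENNReal.rpow_mul]; norm_num
  have e' : ∀ a : ℝ≥0∞, (a ^ 2) ^ (1 / 2 : ℝ) = a := by
    intro a; rw [← ENNReal.rpow_natCast, ← ENNReal.rpow_mul]; norm_num
  have e1 : ∫⁻ y, ‖κ x y‖ₑ * g y ∂μ = ∫⁻ y, ((fun y => (‖κ x y‖ₑ * w y) ^ (1 / 2 : ℝ)) *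
      fun y => (‖κ x y‖ₑ * (w y)⁻¹ * g y ^ 2) ^ (1 / 2 : ℝ)) y ∂μ := by
    refine lintegral_congr_ae ?_
    filter_upwards [h.weight_ne_zero, h.weight_ne_top] with y h0 h1
    rw [Pi.mul_apply, ← ENNReal.mul_rpow_of_nonneg _ _ (by norm_num)]
    rw [show ‖κ x y‖ₑ * w y * (‖κ x y‖ₑ * (w y)⁻¹ * g y ^ 2) =
      (w y * (w y)⁻¹) * (‖κ x y‖ₑ * g y) ^ 2 by ring, ENNReal.mul_inv_cancel h0 h1, one_mul, e']
  simp only [e] at key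
  rw [← e1] at key
  calc _ ≤ _ := pow_le_pow_left₀ (zero_le) key 2
    _ = _ := by
      rw [mul_pow, e2, e2]

/-- The Schur bound is used twice: for fixed `x` after Cauchy–Schwarz, and again, after Tonelli and
by the symmetry of `|κ|`, for fixed `y`. The weight cancels between the two uses. -/
theorem lintegral_sq_le {g : α → ℝ≥0∞} (hg : Measurable g) :
    ∫⁻ x, (∫⁻ y, ‖κ x y‖ₑ * g y ∂μ) ^ 2 ∂μ ≤ ENNReal.ofReal M ^ 2 * ∫⁻ y, g y ^ 2 ∂μ := by
  have hk : Measurable fun p : α × α => ‖κ p.1 p.2‖ₑ := h.measurable.enorm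
  have hk2 : Measurable fun p : α × α => ‖κ p.2 p.1‖ₑ := hk.comp measurable_swap
  have hw := h.weight_measurable
  calc _ ≤ ∫⁻ x, ENNReal.ofReal M * w x * ∫⁻ y, ‖κ x y‖ₑ * (w y)⁻¹ * g y ^ 2 ∂μ ∂μ := by
        refine lintegral_mono_ae ?_
        filter_upwards [h.bound] with x hx
        exact (h.sq_le hg x).trans (by gcongr)
    _ = ∫⁻ x, ∫⁻ y, ENNReal.ofReal M * w x * (‖κ x y‖ₑ * (w y)⁻¹ * g y ^ 2) ∂μ ∂μ := by
        congr 1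
        ext x
        rw [lintegral_const_mul]
        exact (((hk.comp measurable_prodMk_left).mul hw.inv).mul (hg.pow_const 2))
    _ = ∫⁻ y, ∫⁻ x, ENNReal.ofReal M * w x * (‖κ x y‖ₑ * (w y)⁻¹ * g y ^ 2) ∂μ ∂μ := by
        refine lintegral_lintegral_swap ?_
        fun_prop
    _ = ∫⁻ y, ENNReal.ofReal M * (w y)⁻¹ * g y ^ 2 * ∫⁻ x, ‖κ y x‖ₑ * w x ∂μ ∂μ := by
        congr 1
        ext y
        rw [← lintegral_const_mul _ (by exact (h.measurable_left y).enorm.mul hw)]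
        congr 1
        ext x
        rw [h.enorm_symm x y]
        ring
    _ ≤ ∫⁻ y, ENNReal.ofReal M ^ 2 * g y ^ 2 ∂μ := by
        refine lintegral_mono_ae ?_
        filter_upwards [h.bound, h.weight_ne_zero, h.weight_ne_top] with y hy h0 h1
        calc _ ≤ ENNReal.ofReal M * (w y)⁻¹ * g y ^ 2 * (ENNReal.ofReal M * w y) := by gcongr
          _ = ENNReal.ofReal M ^ 2 * g y ^ 2 * (w y * (w y)⁻¹) := by ring
          _ = _ := by rw [ENNReal.mul_inv_cancel h0 h1, mul_one]
    _ = _ := lintegral_const_mul _ (hg.pow_const 2)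

theorem ae_integrable (f : Lp ℂ 2 μ) : ∀ᵐ x ∂μ, Integrable (fun y => κ x y * f y) μ := by
  have hf : Measurable (f : α → ℂ) := (Lp.stronglyMeasurable f).measurable
  have h1 := h.lintegral_sq_le hf.enorm
  rw [lintegral_sq_lp f] at h1
  have hk : Measurable fun p : α × α => ‖κ p.1 p.2‖ₑ := h.measurable.enorm
  have hm : Measurable fun x => (∫⁻ y, ‖κ x y‖ₑ * ‖f y‖ₑ ∂μ) ^ 2 :=
    (Measurable.lintegral_prod_right' (f := fun p : α × α => ‖κ p.1 p.2‖ₑ * ‖f p.2‖ₑ)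
      (by fun_prop)).pow_const 2
  filter_upwards [ae_lt_top hm (h1.trans_lt (by
    rw [← ENNReal.ofReal_pow h.nonneg, ← ENNReal.ofReal_mul (by positivity)]
    exact ENNReal.ofReal_lt_top)).ne] with x hx
  refine ⟨((h.measurable_left x).mul hf).aestronglyMeasurable, ?_⟩
  rw [hasFiniteIntegral_iff_enorm]
  simp_rw [enorm_mul]
  by_contra hc
  rw [not_lt, top_le_iff] at hc
  simp [hc] at hx

theorem stronglyMeasurable_integral (f : Lp ℂ 2 μ) :
    StronglyMeasurable fun x => ∫ y, κ x y * f y ∂μ := by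
  have hf : Measurable (f : α → ℂ) := (Lp.stronglyMeasurable f).measurable
  have hk := h.measurable
  refine StronglyMeasurable.integral_prod_right' (f := fun p : α × α => κ p.1 p.2 * f p.2) ?_
  exact (hk.mul (hf.comp measurable_snd)).stronglyMeasurable

theorem eLpNorm_integral_le (f : Lp ℂ 2 μ) :
    eLpNorm (fun x => ∫ y, κ x y * f y ∂μ) 2 μ ≤ ENNReal.ofReal (M * ‖f‖) := by
  have hf : Measurable (f : α → ℂ) := (Lp.stronglyMeasurable f).measurable
  have h1 := h.lintegral_sq_le hf.enorm
  rw [lintegral_sq_lp f, ← ENNReal.ofReal_pow h.nonneg, ← ENNReal.ofReal_mul (by positivity),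
    ← mul_pow] at h1
  have h2 : ∫⁻ x, ‖∫ y, κ x y * f y ∂μ‖ₑ ^ 2 ∂μ ≤ ENNReal.ofReal ((M * ‖f‖) ^ 2) := by
    refine le_trans (lintegral_mono fun x => ?_) h1
    refine pow_le_pow_left₀ (zero_le) ?_ 2
    refine (enorm_integral_le_lintegral_enorm _).trans (le_of_eq ?_)
    simp_rw [enorm_mul]
  rw [eLpNorm_eq_lintegral_rpow_enorm_toReal (by norm_num) (by norm_num)]
  have h3 := ENNReal.rpow_le_rpow h2 (z := 1 / 2) (by norm_num)
  have h4 := h.nonneg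
  rw [ENNReal.ofReal_pow (by positivity), ← ENNReal.rpow_natCast (ENNReal.ofReal _),
    ← ENNReal.rpow_mul] at h3
  norm_num at h3 ⊢
  exact h3

theorem memLp_integral (f : Lp ℂ 2 μ) : MemLp (fun x => ∫ y, κ x y * f y ∂μ) 2 μ :=
  ⟨(h.stronglyMeasurable_integral f).aestronglyMeasurable,
    (h.eLpNorm_integral_le f).trans_lt ENNReal.ofReal_lt_top⟩

/-- The bounded operator on `L²` with a given Schur kernel. -/
def toCLM : Lp ℂ 2 μ →L[ℂ] Lp ℂ 2 μ :=
  LinearMap.mkContinuous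
    { toFun := fun f => (h.memLp_integral f).toLp _
      map_add' := by
        intro f g
        rw [← MemLp.toLp_add]
        refine MemLp.toLp_congr _ _ ?_
        filter_upwards [h.ae_integrable f, h.ae_integrable g] with x hf hg
        rw [Pi.add_apply, ← integral_add hf hg]
        refine integral_congr_ae ?_
        filter_upwards [Lp.coeFn_add f g] with y hy
        rw [hy, Pi.add_apply, mul_add]
      map_smul' := by
        intro c f
        rw [RingHom.id_apply, ← MemLp.toLp_const_smul]
        refine MemLp.toLp_congr _ _ (.of_forall fun x => ?_)
        rw [Pi.smul_apply, smul_eq_mul, ← integral_const_mul]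
        refine integral_congr_ae ?_
        filter_upwards [Lp.coeFn_smul c f] with y hy
        rw [hy, Pi.smul_apply, smul_eq_mul]
        ring } M (by
    intro f
    simp only [LinearMap.coe_mk, AddHom.coe_mk, Lp.norm_toLp]
    exact ENNReal.toReal_le_of_le_ofReal (mul_nonneg h.nonneg (norm_nonneg _))
      (h.eLpNorm_integral_le f))

theorem toCLM_apply (f : Lp ℂ 2 μ) : h.toCLM f =ᵐ[μ] fun x => ∫ y, κ x y * f y ∂μ :=
  (h.memLp_integral f).coeFn_toLp

theorem integrable_prod (f g : Lp ℂ 2 μ) :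
    Integrable (fun p : α × α => g p.1 * (κ p.1 p.2 * f p.2)) (μ.prod μ) := by
  have hf : Measurable (f : α → ℂ) := (Lp.stronglyMeasurable f).measurable
  have hg : Measurable (g : α → ℂ) := (Lp.stronglyMeasurable g).measurable
  have hk : Measurable fun p : α × α => κ p.1 p.2 := h.measurable
  have hm : Measurable (fun p : α × α => g p.1 * (κ p.1 p.2 * f p.2)) := by fun_prop
  refine ⟨hm.aestronglyMeasurable, ?_⟩
  rw [hasFiniteIntegral_iff_enorm, lintegral_prod _ hm.enorm.aemeasurable]
  have hJ : Measurable fun x => ∫⁻ y, ‖κ x y‖ₑ * ‖f y‖ₑ ∂μ :=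
    Measurable.lintegral_prod_right' (f := fun p : α × α => ‖κ p.1 p.2‖ₑ * ‖f p.2‖ₑ) (by fun_prop)
  have e : ∀ x, ∫⁻ y, ‖g x * (κ x y * f y)‖ₑ ∂μ = ‖g x‖ₑ * ∫⁻ y, ‖κ x y‖ₑ * ‖f y‖ₑ ∂μ := by
    intro x
    rw [← lintegral_const_mul _ (by exact (h.measurable_left x).enorm.mul hf.enorm)]
    simp_rw [enorm_mul]
  simp_rw [e]
  refine (ENNReal.lintegral_mul_le_Lp_mul_Lq μ Real.HolderConjugate.two_two
    hg.enorm.aemeasurable hJ.aemeasurable).trans_lt ?_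
  have h1 := h.lintegral_sq_le hf.enorm
  rw [lintegral_sq_lp f, ← ENNReal.ofReal_pow h.nonneg, ← ENNReal.ofReal_mul (by positivity),
    ← mul_pow] at h1
  have h2 := lintegral_sq_lp g
  simp only [← ENNReal.rpow_natCast, Nat.cast_ofNat] at h1 h2
  refine ENNReal.mul_lt_top (ENNReal.rpow_lt_top_of_nonneg (by norm_num) ?_)
    (ENNReal.rpow_lt_top_of_nonneg (by norm_num) ?_)
  · rw [h2]; exact ENNReal.ofReal_ne_top
  · exact (h1.trans_lt ENNReal.ofReal_lt_top).ne

/-- The pairing is bilinear, without conjugation, to match the distributional definition of the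
Fourier transform. -/
theorem integral_mul_toCLM (f g : Lp ℂ 2 μ) :
    ∫ x, g x * h.toCLM f x ∂μ = ∫ y, (∫ x, κ x y * g x ∂μ) * f y ∂μ := by
  have e : ∫ x, g x * h.toCLM f x ∂μ = ∫ x, ∫ y, g x * (κ x y * f y) ∂μ ∂μ := by
    refine integral_congr_ae ?_
    filter_upwards [h.toCLM_apply f] with x hx
    rw [hx, integral_const_mul]
  rw [e, integral_integral_swap (h.integrable_prod f g)]
  congr 1
  ext y
  rw [← integral_mul_const]
  congr 1
  ext x
  ring

/-- Replacing `g` by its conjugate turns the transposition formula for the bilinear pairing into one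
for the inner product. -/
theorem isSelfAdjoint_toCLM (hc : ∀ x y, κ y x = starRingEnd ℂ (κ x y)) :
    IsSelfAdjoint h.toCLM := by
  rw [ContinuousLinearMap.isSelfAdjoint_iff_isSymmetric]
  intro f g
  simp only [ContinuousLinearMap.coe_coe]
  rw [L2.inner_def, L2.inner_def]
  simp only [RCLike.inner_apply]
  have e1 : ∫ x, g x * starRingEnd ℂ (h.toCLM f x) ∂μ =
      starRingEnd ℂ (∫ x, (star g : Lp ℂ 2 μ) x * h.toCLM f x ∂μ) := by
    rw [← integral_conj]
    refine integral_congr_ae ?_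
    filter_upwards [Lp.coeFn_star g] with x hx
    rw [hx]
    simp
  rw [e1, h.integral_mul_toCLM, ← integral_conj]
  refine integral_congr_ae ?_
  filter_upwards [h.toCLM_apply g] with y hy
  rw [hy, map_mul, ← integral_conj]
  congr 1
  refine integral_congr_ae ?_
  filter_upwards [Lp.coeFn_star g] with x hx
  rw [hx, map_mul, ← hc]
  simp

end IsSchurKernel

end Schur

/-! ### Spaces of test functions and the Fourier transform on `L²` -/

section TestSpace

set_option linter.unusedSectionVars false

variable {F : Type*} [NontriviallyNormedField F] [ProperSpace F] [MeasurableSpace F] [BorelSpace F]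

/-- The properties of Schwartz-Bruhat functions on which the harmonic analysis of the commutator
depends. -/
structure IsTestSpace (ψ : AddChar F Circle) (μ : Measure F) (S : Set (F → ℂ)) : Prop where
  continuous_char : Continuous ψ
  add_mem : ∀ φ ∈ S, ∀ θ ∈ S, (fun x => φ x + θ x) ∈ S
  smul_mem : ∀ (c : ℂ), ∀ φ ∈ S, (fun x => c * φ x) ∈ S
  mul_mem : ∀ φ ∈ S, ∀ θ ∈ S, (fun x => φ x * θ x) ∈ S
  translate_mem : ∀ φ ∈ S, ∀ a, (fun x => φ (a + x)) ∈ S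
  fourier_mem : ∀ φ ∈ S, fourier ψ μ φ ∈ S
  logMul_mem : ∀ φ ∈ S, φ =ᶠ[𝓝 0] 0 → logMul φ ∈ S
  continuous : ∀ φ ∈ S, Continuous φ
  -- Boundedness together with decay `O(|x|⁻²)` allows every weight `|x|^(-σ)` with `-1 < σ < 1`;
  -- this contains the exponents needed on both sides of the functional equation in the critical
  -- strip.
  decay : ∀ φ ∈ S, ∃ C, ∀ x, ‖φ x‖ ≤ C ∧ ‖φ x‖ * modulus x ^ 2 ≤ C
  -- Any positive exponent makes `φ / |y|` integrable at the origin. It depends on the field, since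
  -- the modulus may be a power of the norm.
  vanish : ∀ φ ∈ S, φ 0 = 0 → ∃ δ > 0, ∃ C, ∀ x, ‖φ x‖ ≤ C * modulus x ^ (δ : ℝ)
  selfDual : IsSelfDual ψ μ S
  separating : ∀ f : Lp ℂ 2 μ, (∀ φ ∈ S, ∫ x, f x * φ x ∂μ = 0) → f = 0
  bump : ∀ (a : F), ∀ U ∈ 𝓝 a, ∃ φ ∈ S, (∀ x, ∃ r : ℝ, 0 ≤ r ∧ r ≤ 1 ∧ φ x = r) ∧
    φ =ᶠ[𝓝 a] 1 ∧ Function.support φ ⊆ U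

namespace IsTestSpace

variable {ψ : AddChar F Circle} {μ : Measure F} [μ.IsAddHaarMeasure] {S : Set (F → ℂ)}
  (h : IsTestSpace ψ μ S)
include h

theorem sub_mem {φ θ : F → ℂ} (hφ : φ ∈ S) (hθ : θ ∈ S) : (fun x => φ x - θ x) ∈ S := by
  have := h.add_mem φ hφ _ (h.smul_mem (-1) θ hθ)
  simpa [sub_eq_add_neg] using this

theorem measurable {φ : F → ℂ} (hφ : φ ∈ S) : Measurable φ := (h.continuous φ hφ).measurable

theorem weight {φ : F → ℂ} (hφ : φ ∈ S) : WeightIntegrable μ (-1) 1 φ := by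
  obtain ⟨C, hC⟩ := h.decay φ hφ
  have := weightIntegrable_of_bound (μ := μ) (h.measurable hφ) (C := C) (p := 0) (q := 2)
    (fun x _ _ => by simpa using (hC x).1) (fun x hx => by
      have hx0 : x ≠ 0 := norm_pos_iff.1 (by linarith)
      rw [Real.rpow_neg (modulus_nonneg _), ← div_eq_mul_inv,
        le_div_iff₀ (Real.rpow_pos_of_pos (modulus_pos hx0) _)]
      simpa using (hC x).2)
  exact this.mono (by norm_num) (by norm_num)

theorem weight_of_zero {φ : F → ℂ} (hφ : φ ∈ S) (h0 : φ 0 = 0) :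
    ∃ δ > 0, WeightIntegrable μ (-1) (1 + δ) φ := by
  obtain ⟨C, hC⟩ := h.decay φ hφ
  obtain ⟨δ, hδ, C', hC'⟩ := h.vanish φ hφ h0
  refine ⟨δ, hδ, ?_⟩
  have := weightIntegrable_of_bound (μ := μ) (h.measurable hφ) (C := max C C') (p := δ) (q := 2)
    (fun x _ _ => (hC' x).trans (by
      have := Real.rpow_nonneg (modulus_nonneg x) δ
      gcongr
      exact le_max_right _ _)) (fun x hx => by
      have hx0 : x ≠ 0 := norm_pos_iff.1 (by linarith)
      rw [Real.rpow_neg (modulus_nonneg _), ← div_eq_mul_inv,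
        le_div_iff₀ (Real.rpow_pos_of_pos (modulus_pos hx0) _)]
      refine le_trans ?_ (le_max_left C C')
      simpa using (hC x).2)
  exact this.mono (by norm_num) le_rfl

theorem integrable {φ : F → ℂ} (hφ : φ ∈ S) : Integrable φ μ :=
  (h.weight hφ).integrable (by norm_num) (by norm_num)

theorem memLp {φ : F → ℂ} (hφ : φ ∈ S) : MemLp φ 2 μ := by
  rw [memLp_two_iff_integrable_sq_norm (h.measurable hφ).aestronglyMeasurable]
  obtain ⟨C, hC⟩ := h.decay φ hφ
  refine ((h.integrable hφ).norm.const_mul C).mono'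
    ((h.measurable hφ).norm.pow_const 2).aestronglyMeasurable (.of_forall fun x => ?_)
  rw [Real.norm_of_nonneg (by positivity), sq]
  exact mul_le_mul_of_nonneg_right (hC x).1 (norm_nonneg _)

theorem inversion {φ : F → ℂ} (hφ : φ ∈ S) (y : F) :
    φ y = fourier ψ μ (fourier ψ μ φ) (-y) := by
  rw [h.selfDual φ hφ, neg_neg]

theorem neg_mem {φ : F → ℂ} (hφ : φ ∈ S) : (fun x => φ (-x)) ∈ S := by
  have := h.fourier_mem _ (h.fourier_mem φ hφ)
  rwa [show fourier ψ μ (fourier ψ μ φ) = fun x => φ (-x) from funext (h.selfDual φ hφ)] at this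

theorem integral_fourier {φ : F → ℂ} (hφ : φ ∈ S) : ∫ x, fourier ψ μ φ x ∂μ = φ 0 := by
  have := h.selfDual φ hφ 0
  rw [fourier_apply] at this
  simpa using this

/-- Plancherel on test functions: apply the multiplication formula with the conjugate of the
transform, whose own transform is the conjugate of `φ` by inversion. -/
theorem integral_fourier_mul_conj {φ : F → ℂ} (hφ : φ ∈ S) :
    ∫ x, fourier ψ μ φ x * starRingEnd ℂ (fourier ψ μ φ x) ∂μ =
      ∫ y, φ y * starRingEnd ℂ (φ y) ∂μ := by
  have hi := h.integrable (h.fourier_mem φ hφ)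
  have hi' : Integrable (fun x => starRingEnd ℂ (fourier ψ μ φ x)) μ :=
    ⟨Complex.continuous_conj.comp_aestronglyMeasurable hi.1,
      by simpa [HasFiniteIntegral] using hi.2⟩
  rw [integral_fourier_mul h.continuous_char (h.integrable hφ) hi']
  congr 1
  ext y
  rw [fourier_conj, ← h.inversion hφ]

theorem norm_toLp_fourier {φ : F → ℂ} (hφ : φ ∈ S) :
    ‖(h.memLp (h.fourier_mem φ hφ)).toLp _‖ = ‖(h.memLp hφ).toLp _‖ := by
  have key : ∀ {θ : F → ℂ} (hθ : MemLp θ 2 μ), ((‖hθ.toLp θ‖ ^ 2 : ℝ) : ℂ) =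
      ∫ y, θ y * starRingEnd ℂ (θ y) ∂μ := by
    intro θ hθ
    have := inner_self_eq_norm_sq_to_K (𝕜 := ℂ) (hθ.toLp θ)
    rw [L2.inner_def] at this
    rw [Complex.ofReal_pow]
    refine this.symm.trans (integral_congr_ae ?_)
    filter_upwards [hθ.coeFn_toLp] with x hx
    rw [RCLike.inner_apply, hx]
  have h1 := h.integral_fourier_mul_conj hφ
  rw [← key (h.memLp (h.fourier_mem φ hφ)), ← key (h.memLp hφ)] at h1
  have h2 := Complex.ofReal_injective h1
  exact (pow_left_inj₀ (norm_nonneg _) (norm_nonneg _) two_ne_zero).1 h2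

theorem tendsto_integral_mul {u : ℕ → Lp ℂ 2 μ} {f : Lp ℂ 2 μ} (hu : Tendsto u atTop (𝓝 f))
    (g : Lp ℂ 2 μ) :
    Tendsto (fun n => ∫ x, u n x * g x ∂μ) atTop (𝓝 (∫ x, f x * g x ∂μ)) := by
  have e : ∀ f : Lp ℂ 2 μ, ∫ x, f x * g x ∂μ = inner ℂ (star g) f := by
    intro f
    rw [L2.inner_def]
    refine integral_congr_ae ?_
    filter_upwards [Lp.coeFn_star g] with x hx
    rw [RCLike.inner_apply, hx]
    simp
  simp_rw [e]
  exact tendsto_const_nhds.inner hu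

theorem integral_mul_toLp {φ : F → ℂ} (hφ : MemLp φ 2 μ) (f : Lp ℂ 2 μ) :
    ∫ x, f x * hφ.toLp φ x ∂μ = ∫ x, f x * φ x ∂μ := by
  refine integral_congr_ae ?_
  filter_upwards [hφ.coeFn_toLp] with x hx
  rw [hx]

theorem integrable_mul_memLp {φ : F → ℂ} (hφ : MemLp φ 2 μ) (f : Lp ℂ 2 μ) :
    Integrable (fun x => f x * φ x) μ :=
  (Lp.memLp f).integrable_mul hφ

theorem ext_of_integral {f g : Lp ℂ 2 μ}
    (hfg : ∀ φ ∈ S, ∫ x, f x * φ x ∂μ = ∫ x, g x * φ x ∂μ) : f = g := by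
  rw [← sub_eq_zero]
  refine h.separating _ fun φ hφ => ?_
  have e : ∫ x, (f - g : Lp ℂ 2 μ) x * φ x ∂μ = ∫ x, (f x * φ x - g x * φ x) ∂μ := by
    refine integral_congr_ae ?_
    filter_upwards [Lp.coeFn_sub f g] with x hx
    rw [hx, Pi.sub_apply, sub_mul]
  rw [e, integral_sub (h.integrable_mul_memLp (h.memLp hφ) f)
    (h.integrable_mul_memLp (h.memLp hφ) g), hfg φ hφ, sub_self]

/-- A linear subspace of functions which is separating in `L²` is dense. -/
theorem exists_seq_of_separating {T : Set (F → ℂ)} (hT0 : T.Nonempty)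
    (hT : ∀ φ ∈ T, MemLp φ 2 μ)
    (hadd : ∀ φ ∈ T, ∀ θ ∈ T, (fun x => φ x + θ x) ∈ T)
    (hsmul : ∀ c : ℂ, ∀ φ ∈ T, (fun x => c * φ x) ∈ T)
    (hsep : ∀ f : Lp ℂ 2 μ, (∀ φ ∈ T, ∫ x, f x * φ x ∂μ = 0) → f = 0) (f : Lp ℂ 2 μ) :
    ∃ u : ℕ → Lp ℂ 2 μ, (∀ n, ∃ φ ∈ T, u n =ᵐ[μ] φ) ∧ Tendsto u atTop (𝓝 f) := by
  let V : Submodule ℂ (Lp ℂ 2 μ) :=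
    { carrier := {f | ∃ φ ∈ T, f =ᵐ[μ] φ}
      add_mem' := by
        rintro f g ⟨φ, hφ, h1⟩ ⟨θ, hθ, h2⟩
        refine ⟨_, hadd φ hφ θ hθ, ?_⟩
        filter_upwards [Lp.coeFn_add f g, h1, h2] with x hx h1 h2
        rw [hx, Pi.add_apply, h1, h2]
      zero_mem' := by
        obtain ⟨φ, hφ⟩ := hT0
        refine ⟨_, hsmul 0 φ hφ, ?_⟩
        filter_upwards [Lp.coeFn_zero ℂ 2 μ] with x hx
        rw [hx]; simp
      smul_mem' := by
        rintro c f ⟨φ, hφ, h1⟩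
        refine ⟨_, hsmul c φ hφ, ?_⟩
        filter_upwards [Lp.coeFn_smul c f, h1] with x hx h1
        rw [hx, Pi.smul_apply, h1, smul_eq_mul] }
  have hV : V.topologicalClosure = ⊤ := by
    rw [Submodule.topologicalClosure_eq_top_iff, Submodule.eq_bot_iff]
    intro g hg
    have h1 : star g = 0 := by
      refine hsep _ fun φ hφ => ?_
      have h2 : inner ℂ ((hT φ hφ).toLp φ) g = 0 :=
        (Submodule.mem_orthogonal V g).1 hg _ ⟨φ, hφ, (hT φ hφ).coeFn_toLp⟩
      rw [L2.inner_def] at h2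
      have h3 := congrArg (starRingEnd ℂ) h2
      rw [← integral_conj, map_zero] at h3
      rw [← h3]
      refine integral_congr_ae ?_
      filter_upwards [Lp.coeFn_star g, (hT φ hφ).coeFn_toLp] with x hx h4
      rw [hx, RCLike.inner_apply, h4]
      simp
    refine (Lp.eq_zero_iff_ae_eq_zero).2 ?_
    have h5 := Lp.coeFn_star g
    rw [h1] at h5
    filter_upwards [h5, Lp.coeFn_zero ℂ 2 μ] with x h6 h7
    rw [h7, Pi.zero_apply, Pi.star_apply] at h6
    exact star_eq_zero.1 h6.symm
  have hf : f ∈ closure (V : Set (Lp ℂ 2 μ)) := by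
    rw [← Submodule.topologicalClosure_coe, hV]; trivial
  obtain ⟨u, hu, ht⟩ := mem_closure_iff_seq_limit.1 hf
  exact ⟨u, hu, ht⟩

theorem zero_mem : (fun _ => 0 : F → ℂ) ∈ S := by
  obtain ⟨φ, hφ, -⟩ := h.bump 0 Set.univ univ_mem
  simpa using h.smul_mem 0 φ hφ

theorem exists_seq (f : Lp ℂ 2 μ) : ∃ u : ℕ → F → ℂ, ∃ hu : ∀ n, u n ∈ S,
    Tendsto (fun n => (h.memLp (hu n)).toLp (u n)) atTop (𝓝 f) := by
  obtain ⟨v, hv, ht⟩ := h.exists_seq_of_separating ⟨_, h.zero_mem⟩ (fun φ hφ => h.memLp hφ)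
    h.add_mem h.smul_mem h.separating f
  choose u hu huv using hv
  refine ⟨u, hu, ?_⟩
  convert ht using 2 with n
  exact Lp.ext ((h.memLp (hu n)).coeFn_toLp.trans (huv n).symm)

/-! ### Extension of the Fourier transform to `L²`. -/

theorem isFourierTransform_of_mem {φ : F → ℂ} (hφ : φ ∈ S) {f g : Lp ℂ 2 μ} (hf : f =ᵐ[μ] φ)
    (hg : g =ᵐ[μ] fourier ψ μ φ) : IsFourierTransform ψ μ S f g := by
  intro θ hθ
  have e1 : ∫ x, g x * θ x ∂μ = ∫ x, fourier ψ μ φ x * θ x ∂μ := by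
    refine integral_congr_ae ?_
    filter_upwards [hg] with x hx; rw [hx]
  have e2 : ∫ x, f x * fourier ψ μ θ x ∂μ = ∫ x, φ x * fourier ψ μ θ x ∂μ := by
    refine integral_congr_ae ?_
    filter_upwards [hf] with x hx; rw [hx]
  rw [e1, e2, integral_fourier_mul h.continuous_char (h.integrable hφ) (h.integrable hθ)]

theorem fourier_sub {φ θ : F → ℂ} (hφ : φ ∈ S) (hθ : θ ∈ S) :
    fourier ψ μ (fun x => φ x - θ x) = fun x => fourier ψ μ φ x - fourier ψ μ θ x := by
  have hc : ∀ {φ : F → ℂ}, φ ∈ S → ∀ x,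
      Integrable (fun y => (ψ (-(y * x)) : ℂ) * φ y) μ := by
    intro φ hφ x
    refine (h.integrable hφ).bdd_mul (c := 1) ?_ (.of_forall fun y => (Circle.norm_coe _).le)
    exact (continuous_subtype_val.comp (h.continuous_char.comp (by fun_prop))).aestronglyMeasurable
  ext x
  rw [fourier_apply, fourier_apply, fourier_apply, ← integral_sub (hc hφ x) (hc hθ x)]
  simp_rw [mul_sub]

/-- Plancherel makes the transforms of an approximating sequence Cauchy, and the distributional
identity passes to the limit. The sequence is kept because pairing two `L²` functions requires
approximating both the function and its transform. -/
theorem exists_fourierTransform_seq (f : Lp ℂ 2 μ) : ∃ g : Lp ℂ 2 μ, IsFourierTransform ψ μ S f g ∧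
    ∃ u : ℕ → F → ℂ, ∃ hu : ∀ n, u n ∈ S,
      Tendsto (fun n => (h.memLp (hu n)).toLp (u n)) atTop (𝓝 f) ∧
      Tendsto (fun n => (h.memLp (h.fourier_mem _ (hu n))).toLp (fourier ψ μ (u n))) atTop
        (𝓝 g) := by
  obtain ⟨u, hu, ht⟩ := h.exists_seq f
  have hdist : ∀ n m, dist ((h.memLp (h.fourier_mem _ (hu n))).toLp (fourier ψ μ (u n)))
      ((h.memLp (h.fourier_mem _ (hu m))).toLp (fourier ψ μ (u m))) =
      dist ((h.memLp (hu n)).toLp (u n)) ((h.memLp (hu m)).toLp (u m)) := by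
    intro n m
    rw [dist_eq_norm, dist_eq_norm, ← MemLp.toLp_sub, ← MemLp.toLp_sub]
    have := h.norm_toLp_fourier (h.sub_mem (hu n) (hu m))
    simp only [h.fourier_sub (hu n) (hu m)] at this
    exact this
  have hc : CauchySeq
      (fun n => (h.memLp (h.fourier_mem _ (hu n))).toLp (fourier ψ μ (u n))) := by
    have := ht.cauchySeq
    rw [Metric.cauchySeq_iff] at this ⊢
    simpa only [hdist] using this
  obtain ⟨g, hg⟩ := cauchySeq_tendsto_of_complete hc
  refine ⟨g, ?_, u, hu, ht, hg⟩
  intro φ hφ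
  have l1 := h.tendsto_integral_mul hg ((h.memLp hφ).toLp φ)
  have l2 := h.tendsto_integral_mul ht ((h.memLp (h.fourier_mem φ hφ)).toLp (fourier ψ μ φ))
  simp only [h.integral_mul_toLp] at l1 l2
  refine tendsto_nhds_unique l1 (l2.congr fun n => ?_)
  exact (h.isFourierTransform_of_mem (hu n) (MemLp.coeFn_toLp _) (MemLp.coeFn_toLp _) φ hφ).symm

theorem isFourierTransform_unique {f g g' : Lp ℂ 2 μ} (h1 : IsFourierTransform ψ μ S f g)
    (h2 : IsFourierTransform ψ μ S f g') : g = g' :=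
  h.ext_of_integral fun φ hφ => (h1 φ hφ).trans (h2 φ hφ).symm

/-- The definition tests only against `S`; approximating `g` by test functions whose transforms
converge to `g'` extends the multiplication formula to all of `L²`. -/
theorem integral_mul_of_isFourierTransform {f f' g g' : Lp ℂ 2 μ}
    (hf : IsFourierTransform ψ μ S f f') (hg : IsFourierTransform ψ μ S g g') :
    ∫ x, f' x * g x ∂μ = ∫ x, f x * g' x ∂μ := by
  obtain ⟨g'', hg'', u, hu, h1, h2⟩ := h.exists_fourierTransform_seq g
  rw [h.isFourierTransform_unique hg'' hg] at h2
  have l1 := h.tendsto_integral_mul h1 f'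
  have l2 := h.tendsto_integral_mul h2 f
  simp only [mul_comm _ (f' _), mul_comm _ (f _), h.integral_mul_toLp] at l1 l2
  refine tendsto_nhds_unique l1 (l2.congr fun n => ?_)
  exact (hf _ (hu n)).symm

/-- The integral transform of `η` is at first only known to be bounded. Multiplying it and `g` by a
test function `ρ` puts both in `L²`, where the multiplication formula identifies them; taking `ρ =
1` near each point removes the cutoff. -/
theorem isFourierTransform_ae_eq {η : F → ℂ} (hη : Integrable η μ) {f g : Lp ℂ 2 μ}
    (hf : f =ᵐ[μ] η) (hg : IsFourierTransform ψ μ S f g) : g =ᵐ[μ] fourier ψ μ η := by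
  have hcont := continuous_fourier h.continuous_char hη
  have key : ∀ ρ ∈ S, ∀ᵐ x ∂μ, (g x - fourier ψ μ η x) * ρ x = 0 := by
    intro ρ hρ
    obtain ⟨C, hC⟩ := h.decay ρ hρ
    have m1 : MemLp (fun x => g x * ρ x) 2 μ := by
      refine ((Lp.memLp g).norm.const_mul C).mono' ?_ (.of_forall fun x => ?_)
      · exact (Lp.aestronglyMeasurable g).mul (h.measurable hρ).aestronglyMeasurable
      · rw [norm_mul, mul_comm]
        exact mul_le_mul_of_nonneg_right (hC x).1 (norm_nonneg _)
    have m2 : MemLp (fun x => fourier ψ μ η x * ρ x) 2 μ := by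
      refine ((h.memLp hρ).norm.const_mul (∫ y, ‖η y‖ ∂μ)).mono' ?_ (.of_forall fun x => ?_)
      · exact (hcont.mul (h.continuous ρ hρ)).aestronglyMeasurable
      · rw [norm_mul]
        exact mul_le_mul_of_nonneg_right (norm_fourier_le _ _) (norm_nonneg _)
    have e : m1.toLp _ = m2.toLp _ := by
      refine h.ext_of_integral fun φ hφ => ?_
      have e1 : ∫ x, m1.toLp _ x * φ x ∂μ = ∫ x, g x * (ρ x * φ x) ∂μ := by
        refine integral_congr_ae ?_
        filter_upwards [m1.coeFn_toLp] with x hx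
        rw [hx, mul_assoc]
      have e2 : ∫ x, m2.toLp _ x * φ x ∂μ = ∫ x, fourier ψ μ η x * (ρ x * φ x) ∂μ := by
        refine integral_congr_ae ?_
        filter_upwards [m2.coeFn_toLp] with x hx
        rw [hx, mul_assoc]
      have e3 : ∫ x, f x * fourier ψ μ (fun x => ρ x * φ x) x ∂μ =
          ∫ x, η x * fourier ψ μ (fun x => ρ x * φ x) x ∂μ := by
        refine integral_congr_ae ?_
        filter_upwards [hf] with x hx
        rw [hx]
      have hρφ := h.mul_mem ρ hρ φ hφ
      rw [e1, e2, integral_fourier_mul h.continuous_char hη (h.integrable hρφ), ← e3]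
      exact hg _ hρφ
    filter_upwards [m1.coeFn_toLp, m2.coeFn_toLp] with x h1 h2
    rw [e, h2] at h1
    rw [sub_mul, ← h1, sub_self]
  have hnull : μ {x | g x ≠ fourier ψ μ η x} = 0 := by
    refine measure_null_of_locally_null _ fun a _ => ?_
    obtain ⟨ρ, hρ, -, h1, -⟩ := h.bump a Set.univ univ_mem
    refine ⟨{x | ρ x = 1} ∩ {x | g x ≠ fourier ψ μ η x},
      inter_mem (mem_nhdsWithin_of_mem_nhds h1) self_mem_nhdsWithin, ?_⟩
    refine measure_mono_null ?_ (ae_iff.1 (key ρ hρ))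
    rintro x ⟨hx1, hx2⟩
    have hx1' : ρ x = 1 := hx1
    simpa [hx1', sub_eq_zero] using hx2
  exact ae_iff.2 hnull

theorem memLp_fourier {η : F → ℂ} (hη : Integrable η μ) (hη2 : MemLp η 2 μ) :
    MemLp (fourier ψ μ η) 2 μ := by
  obtain ⟨g, hg, -⟩ := h.exists_fourierTransform_seq (hη2.toLp η)
  exact (memLp_congr_ae (h.isFourierTransform_ae_eq hη hη2.coeFn_toLp hg)).1 (Lp.memLp g)

theorem isFourierTransform_toLp {η : F → ℂ} (hη : Integrable η μ)
    {f g : Lp ℂ 2 μ} (hf : f =ᵐ[μ] η) (hg : g =ᵐ[μ] fourier ψ μ η) :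
    IsFourierTransform ψ μ S f g := by
  obtain ⟨g', hg', -⟩ := h.exists_fourierTransform_seq f
  have := h.isFourierTransform_ae_eq hη hf hg'
  rwa [Lp.ext (hg.trans this.symm)]

/-- The Fourier transform of the inverse Fourier transform of `η ∈ L¹ ∩ L²` is `η`. -/
theorem isFourierTransform_inverse {η : F → ℂ} (hη : Integrable η μ) (hη2 : MemLp η 2 μ)
    {f g : Lp ℂ 2 μ} (hf : f =ᵐ[μ] fun x => fourier ψ μ η (-x)) (hg : g =ᵐ[μ] η) :
    IsFourierTransform ψ μ S f g := by
  intro φ hφ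
  have h1 := h.isFourierTransform_toLp hη hg (h.memLp_fourier hη hη2).coeFn_toLp
    _ (h.neg_mem (h.fourier_mem φ hφ))
  have e1 : fourier ψ μ (fun x => fourier ψ μ φ (-x)) = φ := by
    ext x
    rw [fourier_comp_neg, ← h.inversion hφ]
  rw [e1] at h1
  rw [← h1]
  have e2 : ∫ x, (h.memLp_fourier hη hη2).toLp _ x * fourier ψ μ φ (-x) ∂μ =
      ∫ x, fourier ψ μ η x * fourier ψ μ φ (-x) ∂μ := by
    refine integral_congr_ae ?_
    filter_upwards [(h.memLp_fourier hη hη2).coeFn_toLp] with x hx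
    rw [hx]
  have e3 : ∫ x, f x * fourier ψ μ φ x ∂μ =
      ∫ x, fourier ψ μ η (-x) * fourier ψ μ φ x ∂μ := by
    refine integral_congr_ae ?_
    filter_upwards [hf] with x hx
    rw [hx]
  rw [e2, e3, ← integral_neg_eq_self]
  simp

end IsTestSpace

end TestSpace

/-! ### The Fourier transform of `log |x|` and the commutator kernel -/

section LogKernel

set_option linter.unusedSectionVars false

variable {F : Type*} [NontriviallyNormedField F] [ProperSpace F] [MeasurableSpace F] [BorelSpace F]

theorem exists_modulus_le (R : ℝ) : ∃ C > 0, ∀ x : F, ‖x‖ ≤ R → modulus x ≤ C := by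
  obtain ⟨a, ha⟩ := NormedField.exists_lt_norm F (max R 0)
  have ha0 : a ≠ 0 := norm_pos_iff.1 ((le_max_right _ _).trans_lt ha)
  refine ⟨modulus a, modulus_pos ha0, fun x hx => ?_⟩
  have h1 : modulus (x / a) ≤ 1 := by
    apply modulus_le_one
    rw [norm_div]
    exact div_le_one_of_le₀ (hx.trans ((le_max_left _ _).trans ha.le)) (norm_nonneg _)
  rw [modulus_div] at h1
  exact (div_le_one (modulus_pos ha0)).1 h1

/-- A substitute for the triangle inequality, which the modulus fails to satisfy on `ℂ`: both `u /
(u - 1)` and `1 / (u - 1)` have norm at most `1 + ε⁻¹`, hence bounded modulus. -/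
theorem exists_le_modulus_sub_one {ε : ℝ} (hε : 0 < ε) : ∃ C > 0, ∀ u : F, ε ≤ ‖u - 1‖ →
    modulus u ≤ C * modulus (u - 1) ∧ 1 ≤ C * modulus (u - 1) := by
  obtain ⟨C, hC, h⟩ := exists_modulus_le (F := F) (1 + ε⁻¹)
  refine ⟨C, hC, fun u hu => ?_⟩
  have h0 : u - 1 ≠ 0 := norm_pos_iff.1 (hε.trans_le hu)
  have hp := modulus_pos h0
  have hinv : ‖u - 1‖⁻¹ ≤ ε⁻¹ := inv_anti₀ hε hu
  have h1 := h (u / (u - 1)) (by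
    rw [show u / (u - 1) = 1 + (u - 1)⁻¹ by field_simp; ring]
    refine (norm_add_le _ _).trans ?_
    rw [norm_one, norm_inv]
    linarith)
  have h2 := h (1 / (u - 1)) (by
    rw [one_div, norm_inv]; linarith)
  rw [modulus_div, div_le_iff₀ hp] at h1 h2
  exact ⟨h1, by simpa using h2⟩

variable {ψ : AddChar F Circle} {μ : Measure F} [μ.IsAddHaarMeasure] {S : Set (F → ℂ)}

/-- The functional `φ ↦ ∫ log |x| φ^(x) dx`. -/
def logFourier (ψ : AddChar F Circle) (μ : Measure F) (φ : F → ℂ) : ℂ :=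
  ∫ x, logMul (fourier ψ μ φ) x ∂μ

theorem quasiChar_one_neg_one (y : F) : quasiChar 1 (-1) y = ((modulus y)⁻¹ : ℝ) := by
  by_cases hy : y = 0
  · simp [hy]
  · have := quasiChar_one_ofReal (-1) hy
    rw [Real.rpow_neg_one] at this
    rw [← this]
    simp

theorem logMul_neg (f : F → ℂ) (x : F) : logMul f (-x) = logMul (fun y => f (-y)) x := by
  simp [logMul]

namespace IsTestSpace

variable (h : IsTestSpace ψ μ S)
include h

/-- A nonnegative test function supported near `1` with nonzero Mellin transform. -/
theorem exists_bump (χ : Fˣ →ₜ* Circle) (s : ℂ) {U : Set F} (hU : U ∈ 𝓝 (1 : F)) :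
    ∃ ρ ∈ S, (∀ x, ∃ r : ℝ, 0 ≤ r ∧ r ≤ 1 ∧ ρ x = r) ∧ Function.support ρ ⊆ U ∧
      ∫ y, ρ y * quasiChar χ s y ∂μ ≠ 0 := by
  have hq : ContinuousAt (quasiChar χ s) (1 : F) :=
    (continuousOn_quasiChar χ s).continuousAt (isOpen_ne.mem_nhds one_ne_zero)
  have hq1 : quasiChar χ s (1 : F) = 1 := by
    rw [quasiChar_of_ne _ _ one_ne_zero]
    simp
  have hV : ∀ᶠ x in 𝓝 (1 : F), ‖quasiChar χ s x - 1‖ < 1 / 2 := by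
    have h1 : Tendsto (fun x => ‖quasiChar χ s x - 1‖) (𝓝 (1 : F)) (𝓝 0) := by
      have := (hq.sub (continuousAt_const (y := (1 : ℂ)))).norm
      simpa [ContinuousAt, hq1] using this
    exact h1.eventually_lt_const (by norm_num)
  obtain ⟨ρ, hρ, hr, h1, hs⟩ := h.bump 1 _ (inter_mem (inter_mem hU hV) (isOpen_ne.mem_nhds
    (one_ne_zero : (1 : F) ≠ 0)))
  refine ⟨ρ, hρ, hr, fun x hx => (hs hx).1.1, fun h0 => ?_⟩
  choose r hr0 hr1 hrρ using hr
  have hre : ∀ y, r y / 2 ≤ (ρ y * quasiChar χ s y).re := by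
    intro y
    by_cases hy : ρ y = 0
    · have : r y = 0 := by rw [hrρ] at hy; exact_mod_cast hy
      simp [hy, this]
    · have h2 : ‖quasiChar χ s y - 1‖ < 1 / 2 := (hs hy).1.2
      have h3 := (Complex.abs_re_le_norm _).trans_lt h2
      rw [abs_lt, Complex.sub_re, Complex.one_re] at h3
      rw [hrρ, Complex.re_ofReal_mul]
      nlinarith [hr0 y]
  have hi : Integrable (fun y => ρ y * quasiChar χ s y) μ := by
    by_contra hni
    have hd : ∀ y, ‖ρ y * quasiChar χ s y‖ ≤ 2 * ‖ρ y‖ := by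
      intro y
      by_cases hy : ρ y = 0
      · simp [hy]
      · have h2 : ‖quasiChar χ s y - 1‖ < 1 / 2 := (hs hy).1.2
        have h3 : ‖quasiChar χ s y‖ ≤ 2 := by
          calc _ = ‖(quasiChar χ s y - 1) + 1‖ := by ring_nf
            _ ≤ _ := norm_add_le _ _
            _ ≤ 2 := by rw [norm_one]; linarith
        rw [norm_mul, mul_comm]
        gcongr
    exact hni (((h.integrable hρ).norm.const_mul 2).mono'
      ((h.measurable hρ).mul (measurable_quasiChar _ _)).aestronglyMeasurable (.of_forall hd))
  have hrr : r = fun y => (ρ y).re := by ext y; rw [hrρ]; simp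
  have hri : Integrable r μ := by rw [hrr]; exact (h.integrable hρ).re
  have hrc : Continuous r := by rw [hrr]; exact Complex.continuous_re.comp (h.continuous ρ hρ)
  have hr1 : r 1 ≠ 0 := by
    have : ρ 1 = 1 := h1.eq_of_nhds
    rw [hrρ] at this
    intro h2
    rw [h2] at this
    simp at this
  have h4 : 0 < ∫ y, r y ∂μ :=
    integral_pos_of_integrable_nonneg_nonzero hrc hri hr0 hr1
  have h5 : ∫ y, r y / 2 ∂μ ≤ ∫ y, (ρ y * quasiChar χ s y).re ∂μ :=
    integral_mono (hri.div_const 2) hi.re hre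
  have h6 : ∫ y, (ρ y * quasiChar χ s y).re ∂μ = (∫ y, ρ y * quasiChar χ s y ∂μ).re :=
    integral_re hi
  rw [h6, h0, integral_div, Complex.zero_re] at h5
  linarith

theorem integrable_mul_inv {φ : F → ℂ} (hφ : φ ∈ S) (h0 : φ 0 = 0) :
    Integrable (fun y => φ y * ((modulus y)⁻¹ : ℝ)) μ ∧
      Integrable (fun y => logMul φ y * ((modulus y)⁻¹ : ℝ)) μ := by
  obtain ⟨δ, hδ, hw⟩ := h.weight_of_zero hφ h0
  have h1 := hw.integrable_mul_quasiChar 1 (s := -1) (by norm_num) (by simpa using hδ)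
  have h2 := hw.logMul.integrable_mul_quasiChar 1 (s := -1) (by norm_num) (by simpa using hδ)
  simp only [quasiChar_one_neg_one] at h1 h2
  exact ⟨h1, h2⟩

theorem integrable_logMul_fourier {φ : F → ℂ} (hφ : φ ∈ S) :
    Integrable (logMul (fourier ψ μ φ)) μ :=
  (h.weight (h.fourier_mem φ hφ)).logMul.integrable (by norm_num) (by norm_num)

/-- Away from the origin, the Fourier transform of `log |x|` is a multiple of `|y|⁻¹`. -/
theorem exists_logFourier_eq : ∃ c : ℝ, ∀ φ ∈ S, φ 0 = 0 →
    logFourier ψ μ φ = -c * ∫ y, φ y * ((modulus y)⁻¹ : ℝ) ∂μ := by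
  obtain ⟨ρ, hρ, hr, hs, hI⟩ := h.exists_bump 1 (-1) (isOpen_ne.mem_nhds
    (one_ne_zero : (1 : F) ≠ 0))
  simp only [quasiChar_one_neg_one] at hI
  set I := ∫ y, ρ y * ((modulus y)⁻¹ : ℝ) ∂μ with hIdef
  have hρ0 : ρ 0 = 0 := by
    by_contra h0
    exact hs h0 rfl
  have hconj : ∀ x, starRingEnd ℂ (ρ x) = ρ x := by
    intro x
    obtain ⟨r, -, -, hx⟩ := hr x
    rw [hx, Complex.conj_ofReal]
  -- For real `ρ`, conjugating its transform is the same as reflecting it, and `log |x|` is real and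
  -- even. This makes the constant real, and hence the kernel hermitian.
  have hTc : starRingEnd ℂ (logFourier ψ μ ρ) = logFourier ψ μ ρ := by
    rw [logFourier, ← integral_conj, ← integral_neg_eq_self]
    congr 1
    ext x
    have := fourier_conj (ψ := ψ) (μ := μ) ρ x
    simp only [hconj] at this
    simp only [logMul, map_mul, Complex.conj_ofReal, modulus_neg]
    rw [← this]
  have hIc : starRingEnd ℂ I = I := by
    rw [hIdef, ← integral_conj]
    simp [hconj]
  obtain ⟨c, hc⟩ : ∃ c : ℝ, (c : ℂ) = -(logFourier ψ μ ρ / I) := by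
    refine ⟨(-(logFourier ψ μ ρ / I)).re, ?_⟩
    rw [← Complex.conj_eq_iff_re, map_neg, map_div₀, hTc, hIc]
  refine ⟨c, fun φ hφ h0 => ?_⟩
  -- Exchanging `φ` with the fixed `ρ` shows that the ratio of the two functionals is the same for
  -- every `φ` vanishing at `0`.
  have key := log_exchange h.continuous_char (h.integrable (h.fourier_mem φ hφ))
    (h.integrable (h.fourier_mem ρ hρ)) (h.measurable (h.fourier_mem φ hφ))
    (h.measurable (h.fourier_mem ρ hρ)) (h.inversion hφ) (h.inversion hρ)
    (h.integrable_logMul_fourier hφ) (h.integrable_logMul_fourier hρ)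
    (by rw [h.integral_fourier hφ, h0]) (by rw [h.integral_fourier hρ, hρ0])
    (h.integrable_mul_inv hφ h0).1 (h.integrable_mul_inv hφ h0).2
    (h.integrable_mul_inv hρ hρ0).1 (h.integrable_mul_inv hρ hρ0).2
  rw [← hIdef] at key
  rw [hc, neg_neg, div_mul_eq_mul_div, eq_div_iff hI]
  unfold logFourier
  linear_combination -key

/-- The constant `c` such that `log |x|` has Fourier transform `-c |y|⁻¹` away from the origin. -/
def logConst : ℝ := h.exists_logFourier_eq.choose

theorem logFourier_eq {φ : F → ℂ} (hφ : φ ∈ S) (h0 : φ 0 = 0) :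
    logFourier ψ μ φ = -h.logConst * ∫ y, φ y * ((modulus y)⁻¹ : ℝ) ∂μ :=
  h.exists_logFourier_eq.choose_spec φ hφ h0

theorem logFourier_sub {φ θ : F → ℂ} (hφ : φ ∈ S) (hθ : θ ∈ S) :
    logFourier ψ μ (fun x => φ x - θ x) = logFourier ψ μ φ - logFourier ψ μ θ := by
  rw [logFourier, logFourier, logFourier, h.fourier_sub hφ hθ,
    ← integral_sub (h.integrable_logMul_fourier hφ) (h.integrable_logMul_fourier hθ)]
  congr 1
  ext x
  simp only [logMul, mul_sub]

omit h [ProperSpace F] [BorelSpace F] [μ.IsAddHaarMeasure] in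
theorem _root_.LocalCommutator.fourier_const_mul (c : ℂ) (φ : F → ℂ) (x : F) :
    fourier ψ μ (fun y => c * φ y) x = c * fourier ψ μ φ x := by
  rw [fourier, fourier]
  exact congrFun (VectorFourier.fourierIntegral_const_smul ψ μ (LinearMap.mul F F) φ c) x

omit h in
theorem _root_.LocalCommutator.logFourier_const_mul (c : ℂ) (φ : F → ℂ) :
    logFourier ψ μ (fun x => c * φ x) = c * logFourier ψ μ φ := by
  rw [logFourier, logFourier, ← integral_const_mul]
  congr 1
  ext x
  simp only [logMul, fourier_const_mul]
  ring

end IsTestSpace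

/-- The operator `B` on test functions: the inverse Fourier transform of `log |x| φ^(x)`. -/
def logConv (ψ : AddChar F Circle) (μ : Measure F) (φ : F → ℂ) (x : F) : ℂ :=
  fourier ψ μ (logMul (fourier ψ μ φ)) (-x)

/-- Translation by `x` becomes the factor `ψ(x w)` on the transform side, so `B φ` at `x` is one
fixed functional evaluated on a translate of `φ`. -/
theorem logConv_eq_logFourier (φ : F → ℂ) (x : F) :
    logConv ψ μ φ x = logFourier ψ μ (fun y => φ (x + y)) := by
  rw [logConv, logFourier, fourier_apply]
  congr 1
  ext w
  simp only [logMul, fourier_comp_add]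
  rw [show -(w * -x) = x * w by ring]
  ring

/-- The kernel `i c log (|x| / |y|) / |x - y|` of the commutator `i [B, A]`. -/
def commutatorKernel (c : ℝ) (x y : F) : ℂ :=
  Complex.I * ((c * ((Real.log (modulus x) - Real.log (modulus y)) * (modulus (x - y))⁻¹) : ℝ) : ℂ)

namespace IsTestSpace

variable (h : IsTestSpace ψ μ S)
include h

/-- The expression is the functional `logFourier` evaluated at `y ↦ (log |x| - log |x + y|) α(x +
y)`, up to the factor `-i`. This test function vanishes at `y = 0`, so the formula `-c |y|⁻¹`
applies and no regularisation is needed. -/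
theorem commutator_apply {α : F → ℂ} (hα : α ∈ S) (h0 : α =ᶠ[𝓝 0] 0) (x : F) :
    Complex.I * (logConv ψ μ (logMul α) x - logMul (logConv ψ μ α) x) =
      ∫ y, commutatorKernel h.logConst x y * α y ∂μ := by
  have hl := h.logMul_mem α hα h0
  have h1 := h.smul_mem (Real.log (modulus x)) _ (h.translate_mem α hα x)
  have h2 := h.translate_mem _ hl x
  have key := h.logFourier_eq (h.sub_mem h1 h2) (by simp [logMul])
  rw [h.logFourier_sub h1 h2, logFourier_const_mul, ← logConv_eq_logFourier,
    ← logConv_eq_logFourier] at key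
  have e : Complex.I * (logConv ψ μ (logMul α) x - logMul (logConv ψ μ α) x) =
      -Complex.I * ((Real.log (modulus x) : ℂ) * logConv ψ μ α x - logConv ψ μ (logMul α) x) := by
    rw [logMul]; ring
  rw [e, key, ← integral_add_left_eq_self (fun y => commutatorKernel h.logConst x y * α y) x,
    ← mul_assoc, ← integral_const_mul]
  congr 1
  ext y
  simp only [logMul, commutatorKernel]
  rw [show x - (x + y) = -y by ring, modulus_neg]
  push_cast
  ring

/-- The Mellin-type integral of the commutator kernel converges on the critical line. -/
theorem integrable_kernel : Integrable (fun u : F =>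
    Real.log (modulus u) * (modulus (1 - u))⁻¹ * modulus u ^ (-(1 / 2) : ℝ)) μ := by
  have hU : Metric.ball (1 : F) (1 / 2) ∈ 𝓝 (1 : F) := Metric.ball_mem_nhds _ (by norm_num)
  obtain ⟨ρ, hρ, hr, h1, hs⟩ := h.bump 1 _ hU
  have hρm := h.measurable hρ
  have hfar : ∀ u : F, u ∈ Metric.ball (1 : F) (1 / 2) → 1 / 2 < ‖u‖ := by
    intro u hu
    rw [mem_ball_iff_norm] at hu
    have := norm_sub_norm_le (1 : F) u
    rw [norm_one, norm_sub_rev] at this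
    linarith
  have hρ0 : ρ =ᶠ[𝓝 0] 0 := by
    filter_upwards [Metric.ball_mem_nhds (0 : F) (ε := 1 / 2) (by norm_num)] with u hu
    by_contra hu0
    have := hfar u (hs hu0)
    rw [mem_ball_zero_iff] at hu
    linarith
  -- near `1`
  have hθ := h.translate_mem _ (h.logMul_mem ρ hρ hρ0) 1
  -- Since `log |1| = 0`, the translate of `ρ log |·|` vanishes at the origin, which makes division
  -- by the modulus harmless.
  have i1 := (h.integrable_mul_inv hθ (by simp [logMul])).1
  have i2 : Integrable (fun u => logMul ρ u * ((modulus (u - 1))⁻¹ : ℝ)) μ := by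
    have := i1.comp_sub_right 1
    simpa using this
  -- On the support of `ρ` one has `‖u⁻¹‖ < 2`, so `C` bounds `|u|⁻¹` there.
  obtain ⟨C, hC, hC2⟩ := exists_modulus_le (F := F) 2
  have i3 : Integrable (fun u => ‖logMul ρ u * ((modulus (u - 1))⁻¹ : ℝ)‖ * C ^ (1 / 2 : ℝ)) μ :=
    i2.norm.mul_const _
  -- away from `1`
  obtain ⟨ε, hε, hε1⟩ := Metric.eventually_nhds_iff.1 h1
  obtain ⟨D, hD, hD2⟩ := exists_le_modulus_sub_one (F := F) hε
  let g : F → ℂ := fun u => (1 - ρ u) * ((modulus (u - 1))⁻¹ : ℝ)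
  have hgm : Measurable g := by
    have : Measurable fun u : F => modulus (u - 1) := by fun_prop
    fun_prop
  have hg : ∀ u, ‖g u‖ ≤ D ∧ ‖g u‖ * modulus u ≤ D := by
    intro u
    by_cases hu : ε ≤ ‖u - 1‖
    · obtain ⟨d1, d2⟩ := hD2 u hu
      have hp : 0 < modulus (u - 1) := modulus_pos (norm_pos_iff.1 (hε.trans_le hu))
      obtain ⟨r, hr0, hr1, hru⟩ := hr u
      have n1 : ‖1 - ρ u‖ ≤ 1 := by
        rw [hru, ← Complex.ofReal_one, ← Complex.ofReal_sub, Complex.norm_real, Real.norm_eq_abs,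
          abs_le]
        constructor <;> linarith
      have n2 : ‖g u‖ ≤ (modulus (u - 1))⁻¹ := by
        simp only [g, norm_mul, Complex.norm_real]
        rw [Real.norm_of_nonneg (inv_nonneg.2 hp.le)]
        exact mul_le_of_le_one_left (inv_nonneg.2 hp.le) n1
      constructor
      · exact n2.trans ((inv_le_iff_one_le_mul₀ hp).2 d2)
      · calc _ ≤ (modulus (u - 1))⁻¹ * modulus u := by
              gcongr; exact modulus_nonneg _
          _ ≤ (modulus (u - 1))⁻¹ * (D * modulus (u - 1)) := by gcongr
          _ = D := by field_simp
    · have : ρ u = 1 := hε1 (by rw [dist_eq_norm]; exact not_le.1 hu)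
      simp [g, this, hD.le]
  -- Being bounded and `O(|u|⁻¹)`, `g` admits the weights `0 < σ < 1`, and `σ = 1/2` lies inside
  -- even with the logarithm.
  have hgw := (weightIntegrable_of_bound (μ := μ) hgm (C := D) (p := 0) (q := 1)
    (fun x _ _ => by simpa using (hg x).1) (fun x hx => by
      have hx0 : x ≠ 0 := norm_pos_iff.1 (by linarith)
      rw [Real.rpow_neg (modulus_nonneg _), ← div_eq_mul_inv, Real.rpow_one,
        le_div_iff₀ (modulus_pos hx0)]
      exact (hg x).2)).logMul.2 (1 / 2) (by norm_num) (by norm_num)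
  refine (i3.add hgw).mono' ?_ ?_
  · have : Measurable fun u : F => modulus (1 - u) := by fun_prop
    exact Measurable.aestronglyMeasurable (by fun_prop)
  · filter_upwards [ae_ne_zero μ] with u hu
    have hp := modulus_pos hu
    have hq : 0 ≤ (modulus (u - 1))⁻¹ := inv_nonneg.2 (modulus_nonneg _)
    have hw : 0 ≤ modulus u ^ (-(1 / 2) : ℝ) := Real.rpow_nonneg hp.le _
    obtain ⟨r, hr0, hr1, hru⟩ := hr u
    have hCr : 0 ≤ C ^ (1 / 2 : ℝ) := Real.rpow_nonneg hC.le _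
    have t1 : r * modulus u ^ (-(1 / 2) : ℝ) ≤ r * C ^ (1 / 2 : ℝ) := by
      by_cases hu0 : ρ u = 0
      · have : r = 0 := by rw [hru] at hu0; exact_mod_cast hu0
        simp [this]
      · have h2 := hfar u (hs hu0)
        have h3 := hC2 u⁻¹ (by
          rw [norm_inv]
          rw [inv_le_comm₀ (by linarith) (by norm_num)]
          linarith)
        rw [modulus_inv] at h3
        have h4 : modulus u ^ (-(1 / 2) : ℝ) = (modulus u)⁻¹ ^ (1 / 2 : ℝ) := by
          rw [Real.rpow_neg hp.le, Real.inv_rpow hp.le]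
        rw [h4]
        gcongr
    have e1 : ‖logMul ρ u * ((modulus (u - 1))⁻¹ : ℝ)‖ =
        |Real.log (modulus u)| * r * (modulus (u - 1))⁻¹ := by
      simp only [logMul, norm_mul, Complex.norm_real, hru, Real.norm_eq_abs]
      rw [abs_of_nonneg hr0, abs_of_nonneg hq]
    have e2 : ‖logMul g u‖ = |Real.log (modulus u)| * ((1 - r) * (modulus (u - 1))⁻¹) := by
      simp only [logMul, g, norm_mul, Complex.norm_real, hru, Real.norm_eq_abs]
      rw [abs_of_nonneg hq, ← Complex.ofReal_one, ← Complex.ofReal_sub, Complex.norm_real,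
        Real.norm_of_nonneg (by linarith)]
    rw [Pi.add_apply, e1, e2, norm_mul, norm_mul, modulus_sub_comm 1 u, Real.norm_of_nonneg hq,
      Real.norm_of_nonneg hw, Real.norm_eq_abs]
    have t2 := mul_le_mul_of_nonneg_left t1
      (mul_nonneg (abs_nonneg (Real.log (modulus u))) hq)
    nlinarith [t2]

end IsTestSpace

/-! ### Homogeneity of the commutator kernel and the Schur bound. -/

theorem measurable_commutatorKernel (c : ℝ) :
    Measurable (Function.uncurry (commutatorKernel (F := F) c)) := by
  unfold commutatorKernel Function.uncurry
  have h1 : Measurable fun p : F × F => modulus (p.1 - p.2) := by fun_prop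
  have h2 : Measurable fun p : F × F => modulus p.1 := by fun_prop
  have h3 : Measurable fun p : F × F => modulus p.2 := by fun_prop
  fun_prop

theorem commutatorKernel_conj (c : ℝ) (x y : F) :
    commutatorKernel c y x = starRingEnd ℂ (commutatorKernel c x y) := by
  simp only [commutatorKernel, map_mul, Complex.conj_I, Complex.conj_ofReal]
  rw [modulus_sub_comm y x]
  push_cast
  ring

/-- Homogeneity of degree `-1`: every integral over a row of the kernel reduces to one integral in
the ratio `u`. -/
theorem commutatorKernel_mul (c : ℝ) {x : F} (hx : x ≠ 0) {u : F} (hu : u ≠ 0) :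
    commutatorKernel c x (x * u) =
      -Complex.I * c * ((Real.log (modulus u) * (modulus (1 - u))⁻¹ : ℝ) : ℂ) *
        ((modulus x)⁻¹ : ℝ) := by
  have h1 : x - x * u = x * (1 - u) := by ring
  rw [commutatorKernel, h1, modulus_mul, modulus_mul,
    Real.log_mul (modulus_ne_zero hx) (modulus_ne_zero hu), mul_inv]
  push_cast
  ring

/-- The commutator kernel satisfies the Schur test. -/
theorem IsTestSpace.exists_isSchurKernel (h : IsTestSpace ψ μ S) :
    ∃ M, IsSchurKernel μ (commutatorKernel h.logConst)
      (fun x => ENNReal.ofReal (modulus x ^ (-(1 / 2) : ℝ))) M := by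
  set k : F → ℝ := fun u => Real.log (modulus u) * (modulus (1 - u))⁻¹ *
    modulus u ^ (-(1 / 2) : ℝ) with hk
  have hki : Integrable k μ := h.integrable_kernel
  refine ⟨|h.logConst| * ∫ u, ‖k u‖ ∂μ, measurable_commutatorKernel _, by fun_prop, ?_,
    .of_forall fun _ => ENNReal.ofReal_ne_top, by positivity, ?_, ?_⟩
  · filter_upwards [ae_ne_zero μ] with x hx
    simpa using Real.rpow_pos_of_pos (modulus_pos hx) _
  · intro x y
    rw [commutatorKernel_conj _ x y, RCLike.norm_conj]
  · filter_upwards [ae_ne_zero μ] with x hx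
    have hp := modulus_pos hx
    set G : F → ℝ≥0∞ := fun y => ‖commutatorKernel h.logConst x y‖ₑ *
      ENNReal.ofReal (modulus y ^ (-(1 / 2) : ℝ)) with hG
    -- Substituting `y = x u`, the Jacobian cancels the degree `-1` of the kernel and the weight
    -- leaves `|x|^(-1/2)`; the Schur bound is in fact an equality.
    have e1 : ∫⁻ y, G y ∂μ = ENNReal.ofReal (modulus x) * ∫⁻ u, G (x * u) ∂μ := by
      rw [lintegral_comp_mul μ hx, ← mul_assoc, ← ENNReal.ofReal_mul hp.le,
        mul_inv_cancel₀ hp.ne', ENNReal.ofReal_one, one_mul]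
    have e2 : ∫⁻ u, G (x * u) ∂μ = ∫⁻ u, ENNReal.ofReal (|h.logConst| * (modulus x)⁻¹ *
        modulus x ^ (-(1 / 2) : ℝ)) * ENNReal.ofReal ‖k u‖ ∂μ := by
      refine lintegral_congr_ae ?_
      filter_upwards [ae_ne_zero μ] with u hu
      have hu' := modulus_pos hu
      rw [hG, hk]
      simp only
      rw [commutatorKernel_mul _ hx hu, ← ofReal_norm, ← ENNReal.ofReal_mul (norm_nonneg _),
        ← ENNReal.ofReal_mul (by positivity), modulus_mul, Real.mul_rpow hp.le hu'.le]
      congr 1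
      simp only [norm_mul, norm_neg, Complex.norm_I, Complex.norm_real, one_mul]
      rw [Real.norm_of_nonneg (inv_nonneg.2 hp.le),
        Real.norm_of_nonneg (Real.rpow_nonneg hu'.le _), Real.norm_eq_abs h.logConst]
      ring
    rw [e1, e2, lintegral_const_mul' _ _ ENNReal.ofReal_ne_top,
      ← ofReal_integral_eq_lintegral_ofReal hki.norm (.of_forall fun _ => norm_nonneg _),
      ← ENNReal.ofReal_mul (by positivity), ← ENNReal.ofReal_mul hp.le,
      ← ENNReal.ofReal_mul (by positivity)]
    refine le_of_eq ?_
    congr 1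
    field_simp

end LogKernel

/-! ### The commutator as a bounded operator -/

section Commutator

set_option linter.unusedSectionVars false

variable {F : Type*} [NontriviallyNormedField F] [ProperSpace F] [MeasurableSpace F] [BorelSpace F]
  {ψ : AddChar F Circle} {μ : Measure F} [μ.IsAddHaarMeasure] {S : Set (F → ℂ)}

namespace IsTestSpace

variable (h : IsTestSpace ψ μ S)
include h

theorem memLp_logMul {φ : F → ℂ} (hφ : φ ∈ S) : MemLp (logMul φ) 2 μ := by
  have hm := (h.weight hφ).logMul.1
  rw [memLp_two_iff_integrable_sq_norm hm.aestronglyMeasurable]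
  obtain ⟨C, hC⟩ := h.decay φ hφ
  have hi := (h.weight hφ).logMul.logMul.integrable (by norm_num) (by norm_num)
  refine (hi.norm.const_mul C).mono' (hm.norm.pow_const 2).aestronglyMeasurable
    (.of_forall fun x => ?_)
  rw [Real.norm_of_nonneg (by positivity)]
  simp only [logMul, norm_mul]
  have := mul_le_mul_of_nonneg_right (hC x).1
    (mul_nonneg (sq_nonneg ‖(Real.log (modulus x) : ℂ)‖) (norm_nonneg (φ x)))
  nlinarith [this]

theorem memLp_logConv {φ : F → ℂ} (hφ : φ ∈ S) : MemLp (logConv ψ μ φ) 2 μ := by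
  have h1 := h.memLp_fourier (h.integrable_logMul_fourier hφ) (h.memLp_logMul (h.fourier_mem φ hφ))
  exact h1.comp_measurePreserving (Measure.measurePreserving_neg μ)

theorem graphB_of_mem {φ : F → ℂ} (hφ : φ ∈ S) {f b : Lp ℂ 2 μ} (hf : f =ᵐ[μ] φ)
    (hb : b =ᵐ[μ] logConv ψ μ φ) : GraphB ψ μ S f b := by
  have hφ' := h.fourier_mem φ hφ
  refine ⟨(h.memLp hφ').toLp _, (h.memLp_logMul hφ').toLp _,
    h.isFourierTransform_of_mem hφ hf (MemLp.coeFn_toLp _),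
    h.isFourierTransform_inverse (h.integrable_logMul_fourier hφ) (h.memLp_logMul hφ') hb
      (MemLp.coeFn_toLp _), ?_⟩
  filter_upwards [(h.memLp hφ').coeFn_toLp, (h.memLp_logMul hφ').coeFn_toLp] with x h1 h2
  rw [h1, h2, logMul]

/-- `B` is symmetric for the bilinear pairing. -/
theorem integral_graphB_mul {f b : Lp ℂ 2 μ} (hb : GraphB ψ μ S f b) {φ : F → ℂ} (hφ : φ ∈ S) :
    ∫ x, b x * φ x ∂μ = ∫ x, f x * logConv ψ μ φ x ∂μ := by
  obtain ⟨f', b', hf', hb', hA⟩ := hb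
  have hφ' := h.fourier_mem φ hφ
  have hθ := h.neg_mem hφ'
  have e1 : fourier ψ μ (fun x => fourier ψ μ φ (-x)) = φ := by
    ext x
    rw [fourier_comp_neg, ← h.inversion hφ]
  have h1 := hb' _ hθ
  rw [e1] at h1
  have hi : Integrable (logMul fun x => fourier ψ μ φ (-x)) μ :=
    (h.weight hθ).logMul.integrable (by norm_num) (by norm_num)
  -- The logarithm is moved from `f'` onto the transform of the test function; its transform `g` is
  -- then `B φ`, and the `L²` pairing formula moves everything back to `f`.
  obtain ⟨g, hg, -⟩ := h.exists_fourierTransform_seq ((h.memLp_logMul hθ).toLp _)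
  have hg' := h.isFourierTransform_ae_eq hi (MemLp.coeFn_toLp _) hg
  have h2 := h.integral_mul_of_isFourierTransform hf' hg
  have e2 : ∫ x, f' x * (h.memLp_logMul hθ).toLp _ x ∂μ =
      ∫ x, b' x * fourier ψ μ φ (-x) ∂μ := by
    refine integral_congr_ae ?_
    filter_upwards [hA, (h.memLp_logMul hθ).coeFn_toLp] with x h3 h4
    rw [h3, h4, logMul]
    ring
  rw [← h1, ← e2, h2]
  refine integral_congr_ae ?_
  filter_upwards [hg'] with x hx
  have e3 : (logMul fun x => fourier ψ μ φ (-x)) = fun y => logMul (fourier ψ μ φ) (-y) := by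
    ext y; rw [logMul_neg]
  rw [hx, logConv, e3, fourier_comp_neg]

theorem exists_bump_zero (U : Set F) (hU : U ∈ 𝓝 (0 : F)) :
    ∃ ρ : F → ℂ, Continuous ρ ∧ (∀ x, ‖ρ x‖ ≤ 1) ∧ (∀ x, x ∉ U → ρ x = 1) ∧
      ∀ φ ∈ S, (fun x => ρ x * φ x) ∈ S ∧ (fun x => ρ x * φ x) =ᶠ[𝓝 0] 0 := by
  obtain ⟨c, hc, hr, h1, hs⟩ := h.bump 0 U hU
  refine ⟨fun x => 1 - c x, continuous_const.sub (h.continuous c hc), fun x => ?_, fun x hx => ?_,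
    fun φ hφ => ⟨?_, ?_⟩⟩
  · obtain ⟨r, hr0, hr1, hx⟩ := hr x
    show ‖1 - c x‖ ≤ 1
    rw [hx, ← Complex.ofReal_one, ← Complex.ofReal_sub, Complex.norm_real, Real.norm_eq_abs, abs_le]
    constructor <;> linarith
  · have : c x = 0 := by
      by_contra h0
      exact hx (hs h0)
    simp [this]
  · have := h.sub_mem hφ (h.mul_mem c hc φ hφ)
    simpa [sub_mul] using this
  · filter_upwards [h1] with x hx
    simp [hx]

/-- Test functions vanishing near the origin separate `L²`. -/
theorem separating_punctured (f : Lp ℂ 2 μ)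
    (hf : ∀ φ ∈ {φ ∈ S | φ =ᶠ[𝓝 0] 0}, ∫ x, f x * φ x ∂μ = 0) : f = 0 := by
  have key : ∀ n : ℕ, ∀ᵐ x ∂μ, x ∉ Metric.ball (0 : F) (1 / ((n : ℝ) + 1)) → f x = 0 := by
    intro n
    obtain ⟨ρ, hρc, hρ1, hρ2, hρ⟩ := h.exists_bump_zero _
      (Metric.ball_mem_nhds (0 : F) (Nat.one_div_pos_of_nat (n := n) (α := ℝ)))
    have m1 : MemLp (fun x => f x * ρ x) 2 μ := by
      refine (Lp.memLp f).norm.mono' ?_ (.of_forall fun x => ?_)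
      · exact (Lp.aestronglyMeasurable f).mul hρc.aestronglyMeasurable
      · rw [norm_mul]
        exact mul_le_of_le_one_right (norm_nonneg _) (hρ1 x)
    have e : m1.toLp _ = 0 := by
      refine h.separating _ fun φ hφ => ?_
      rw [← hf _ (hρ φ hφ)]
      refine integral_congr_ae ?_
      filter_upwards [m1.coeFn_toLp] with x hx
      rw [hx, mul_assoc]
    have h1 := m1.coeFn_toLp
    rw [e] at h1
    filter_upwards [h1, Lp.coeFn_zero ℂ 2 μ] with x h2 h3 hx
    rw [h3, hρ2 x hx, mul_one] at h2
    exact h2.symm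
  refine Lp.eq_zero_iff_ae_eq_zero.2 ?_
  filter_upwards [ae_all_iff.2 key, ae_ne_zero μ] with x hx hx0
  obtain ⟨n, hn⟩ := exists_nat_one_div_lt (norm_pos_iff.2 hx0)
  exact hx n (by simpa using hn.le)

/-- The bounded operator extending `i [B, A]`. -/
def commutatorCLM : Lp ℂ 2 μ →L[ℂ] Lp ℂ 2 μ := h.exists_isSchurKernel.choose_spec.toCLM

theorem commutatorCLM_apply (f : Lp ℂ 2 μ) :
    h.commutatorCLM f =ᵐ[μ] fun x => ∫ y, commutatorKernel h.logConst x y * f y ∂μ :=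
  h.exists_isSchurKernel.choose_spec.toCLM_apply f

theorem commutatorCLM_ae_eq {f : Lp ℂ 2 μ} {α : F → ℂ} (hf : f =ᵐ[μ] α) :
    h.commutatorCLM f =ᵐ[μ] fun x => ∫ y, commutatorKernel h.logConst x y * α y ∂μ := by
  filter_upwards [h.commutatorCLM_apply f] with x hx
  rw [hx]
  refine integral_congr_ae ?_
  filter_upwards [hf] with y hy
  rw [hy]

/-- The one condition in doubt is that `A B α` lies in `L²`. The kernel formula gives `A B α = B A α
+ i K α`, with both terms on the right in `L²`. -/
theorem mem_commutatorDomain {α : F → ℂ} (hα : α ∈ S) (h0 : α =ᶠ[𝓝 0] 0) {f : Lp ℂ 2 μ}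
    (hf : f =ᵐ[μ] α) : f ∈ commutatorDomain ψ μ S := by
  have hl := h.logMul_mem α hα h0
  have m1 : MemLp (logMul (logConv ψ μ α)) 2 μ := by
    have m2 := (h.memLp_logConv hl).add ((Lp.memLp (h.commutatorCLM f)).const_mul Complex.I)
    refine (memLp_congr_ae ?_).1 m2
    filter_upwards [h.commutatorCLM_ae_eq hf] with x hx
    rw [Pi.add_apply, hx, ← h.commutator_apply hα h0 x, ← mul_assoc, Complex.I_mul_I]
    ring
  refine ⟨_, (h.memLp hl).toLp _, (h.memLp_logConv hα).toLp _, (h.memLp_logConv hl).toLp _,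
    m1.toLp _, ?_, h.graphB_of_mem hl (MemLp.coeFn_toLp _) (MemLp.coeFn_toLp _),
    h.graphB_of_mem hα hf (MemLp.coeFn_toLp _), ?_, rfl⟩
  · filter_upwards [(h.memLp hl).coeFn_toLp, hf] with x h1 h2
    rw [h1, h2, logMul]
  · filter_upwards [m1.coeFn_toLp, (h.memLp_logConv hα).coeFn_toLp] with x h1 h2
    rw [h1, h2, logMul]

/-- Pair with test functions vanishing near the origin, which separate `L²`, and move `A` and `B`
onto the test function, where the kernel formula applies. Transposition reverses the order of `A`
and `B`, and this matches the antisymmetry of the kernel. -/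
theorem eq_commutatorCLM {f g : Lp ℂ 2 μ} (hg : GraphCommutator ψ μ S f g) :
    g = h.commutatorCLM f := by
  obtain ⟨a, b, ba, ab, ha, hba, hb, hab, rfl⟩ := hg
  rw [← sub_eq_zero]
  refine h.separating_punctured _ fun φ hφS => ?_
  obtain ⟨hφ, h0⟩ := hφS
  have hl := h.logMul_mem φ hφ h0
  have i1 := integrable_mul_memLp h (h.memLp hφ) ba
  have i2 := integrable_mul_memLp h (h.memLp hφ) ab
  have i3 := integrable_mul_memLp h (h.memLp hφ) (h.commutatorCLM f)
  have e1 : ∫ x, (Complex.I • (ba - ab) - h.commutatorCLM f : Lp ℂ 2 μ) x * φ x ∂μ =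
      Complex.I * (∫ x, ba x * φ x ∂μ - ∫ x, ab x * φ x ∂μ) -
        ∫ x, h.commutatorCLM f x * φ x ∂μ := by
    have i12 : Integrable (fun x => ba x * φ x - ab x * φ x) μ := i1.sub i2
    rw [← integral_sub i1 i2, ← integral_const_mul, ← integral_sub (i12.const_mul _) i3]
    refine integral_congr_ae ?_
    filter_upwards [Lp.coeFn_sub (Complex.I • (ba - ab)) (h.commutatorCLM f),
      Lp.coeFn_smul Complex.I (ba - ab), Lp.coeFn_sub ba ab] with x h1 h2 h3
    rw [h1, Pi.sub_apply, h2, Pi.smul_apply, h3, Pi.sub_apply, smul_eq_mul]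
    ring
  have e2 : ∫ x, ab x * φ x ∂μ = ∫ x, f x * logConv ψ μ (logMul φ) x ∂μ := by
    rw [← h.integral_graphB_mul hb hl]
    refine integral_congr_ae ?_
    filter_upwards [hab] with x hx
    rw [hx, logMul]
    ring
  have e3 : ∫ x, h.commutatorCLM f x * φ x ∂μ =
      -∫ x, (∫ y, commutatorKernel h.logConst x y * φ y ∂μ) * f x ∂μ := by
    have := h.exists_isSchurKernel.choose_spec.integral_mul_toCLM f ((h.memLp hφ).toLp φ)
    rw [← integral_neg]
    calc _ = ∫ x, (h.memLp hφ).toLp φ x * h.commutatorCLM f x ∂μ := by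
          refine integral_congr_ae ?_
          filter_upwards [(h.memLp hφ).coeFn_toLp] with x hx
          rw [hx, mul_comm]
      _ = _ := this
      _ = _ := by
          congr 1
          ext y
          rw [← neg_mul, ← integral_neg]
          congr 1
          refine integral_congr_ae ?_
          filter_upwards [(h.memLp hφ).coeFn_toLp] with x hx
          rw [hx, commutatorKernel, commutatorKernel, modulus_sub_comm]
          push_cast
          ring
  have hm := h.memLp_logConv hl
  have i4 := integrable_mul_memLp h (h.memLp_logConv hφ) a
  have i5 := integrable_mul_memLp h hm f
  rw [e1, e2, e3, h.integral_graphB_mul hba hφ, ← integral_sub i4 i5, ← integral_const_mul,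
    sub_neg_eq_add]
  have hK := h.exists_isSchurKernel.choose_spec.memLp_integral ((h.memLp hφ).toLp φ)
  have i6 : Integrable (fun x => (∫ y, commutatorKernel h.logConst x y * φ y ∂μ) * f x) μ := by
    refine (integrable_mul_memLp h hK f).congr (.of_forall fun x => ?_)
    simp only
    rw [mul_comm]
    congr 1
    refine integral_congr_ae ?_
    filter_upwards [(h.memLp hφ).coeFn_toLp] with y hy
    rw [hy]
  have i45 : Integrable (fun x => a x * logConv ψ μ φ x - f x * logConv ψ μ (logMul φ) x) μ :=
    i4.sub i5
  rw [← integral_add (i45.const_mul _) i6, ← integral_zero F ℂ (μ := μ)]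
  refine integral_congr_ae ?_
  filter_upwards [ha] with x hx
  rw [← h.commutator_apply hφ h0 x, hx, logMul]
  ring

theorem dense_commutatorDomain : Dense (commutatorDomain ψ μ S) := by
  intro f
  obtain ⟨u, hu, ht⟩ := h.exists_seq_of_separating (T := {φ ∈ S | φ =ᶠ[𝓝 0] 0})
    ⟨_, h.zero_mem, .rfl⟩ (fun φ hφ => h.memLp hφ.1)
    (fun φ hφ θ hθ => ⟨h.add_mem φ hφ.1 θ hθ.1, by
      filter_upwards [hφ.2, hθ.2] with x h1 h2
      simp [h1, h2]⟩)
    (fun c φ hφ => ⟨h.smul_mem c φ hφ.1, by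
      filter_upwards [hφ.2] with x h1
      simp [h1]⟩) h.separating_punctured f
  refine mem_closure_of_tendsto ht (.of_forall fun n => ?_)
  obtain ⟨φ, hφ, h1⟩ := hu n
  exact h.mem_commutatorDomain hφ.1 hφ.2 h1

/-! ### The Gamma factor -/

theorem integrable_dual (χ : Fˣ →ₜ* Circle) {s : ℂ} (h0 : 0 < s.re) (h1 : s.re < 1) {φ : F → ℂ}
    (hφ : φ ∈ S) : Integrable (fun x => φ x * quasiChar χ (s - 1) x) μ :=
  (h.weight hφ).integrable_mul_quasiChar χ (by simp; linarith) (by simp; linarith)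

theorem integrable_primal (χ : Fˣ →ₜ* Circle) {s : ℂ} (h0 : 0 < s.re) (h1 : s.re < 1) {φ : F → ℂ}
    (hφ : φ ∈ S) : Integrable (fun x => φ x * quasiChar χ⁻¹ (-s) x) μ :=
  (h.weight hφ).integrable_mul_quasiChar χ⁻¹ (by simp; linarith) (by simp; linarith)

theorem functional_equation (χ : Fˣ →ₜ* Circle) {s : ℂ} (h0 : 0 < s.re) (h1 : s.re < 1)
    {φ ρ : F → ℂ} (hφ : φ ∈ S) (hρ : ρ ∈ S) :
    (∫ y, φ y * quasiChar χ⁻¹ (-s) y ∂μ) * ∫ x, fourier ψ μ ρ x * quasiChar χ (s - 1) x ∂μ =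
      (∫ y, ρ y * quasiChar χ⁻¹ (-s) y ∂μ) * ∫ x, fourier ψ μ φ x * quasiChar χ (s - 1) x ∂μ :=
  tate_exchange h.continuous_char (h.integrable (h.fourier_mem φ hφ))
    (h.integrable (h.fourier_mem ρ hρ)) (h.measurable (h.fourier_mem φ hφ))
    (h.measurable (h.fourier_mem ρ hρ)) (h.inversion hφ) (h.inversion hρ) χ s
    (h.integrable_primal χ h0 h1 hφ) (h.integrable_dual χ h0 h1 (h.fourier_mem ρ hρ))
    (h.integrable_primal χ h0 h1 hρ) (h.integrable_dual χ h0 h1 (h.fourier_mem φ hφ))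

/-- By the functional equation the quotient of the two integrals does not depend on the test
function, so any one with nonvanishing denominator determines the value. -/
theorem isGammaValue_iff (χ : Fˣ →ₜ* Circle) {s : ℂ} (h0 : 0 < s.re) (h1 : s.re < 1)
    {ρ : F → ℂ} (hρ : ρ ∈ S) (hZ : ∫ y, ρ y * quasiChar χ⁻¹ (-s) y ∂μ ≠ 0) (c : ℂ) :
    IsGammaValue ψ μ S χ s c ↔ c = (∫ x, fourier ψ μ ρ x * quasiChar χ (s - 1) x ∂μ) /
      ∫ y, ρ y * quasiChar χ⁻¹ (-s) y ∂μ := by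
  constructor
  · intro hc
    rw [(hc ρ hρ).2.2]
    field_simp
  · rintro rfl φ hφ
    refine ⟨h.integrable_dual χ h0 h1 (h.fourier_mem φ hφ), h.integrable_primal χ h0 h1 hφ, ?_⟩
    rw [div_mul_eq_mul_div, eq_div_iff hZ]
    linear_combination -h.functional_equation χ h0 h1 hφ hρ

theorem gammaFactor_eq (χ : Fˣ →ₜ* Circle) {s : ℂ} (h0 : 0 < s.re) (h1 : s.re < 1)
    {ρ : F → ℂ} (hρ : ρ ∈ S) (hZ : ∫ y, ρ y * quasiChar χ⁻¹ (-s) y ∂μ ≠ 0) :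
    gammaFactor ψ μ S χ s = (∫ x, fourier ψ μ ρ x * quasiChar χ (s - 1) x ∂μ) /
      ∫ y, ρ y * quasiChar χ⁻¹ (-s) y ∂μ :=
  (h.isGammaValue_iff χ h0 h1 hρ hZ _).1
    (Classical.epsilon_spec ⟨_, (h.isGammaValue_iff χ h0 h1 hρ hZ _).2 rfl⟩)

theorem isGammaValue_gammaFactor (χ : Fˣ →ₜ* Circle) {s : ℂ} (h0 : 0 < s.re) (h1 : s.re < 1) :
    IsGammaValue ψ μ S χ s (gammaFactor ψ μ S χ s) := by
  obtain ⟨ρ, hρ, -, -, hZ⟩ := h.exists_bump χ⁻¹ (-s) univ_mem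
  exact (h.isGammaValue_iff χ h0 h1 hρ hZ _).2 (h.gammaFactor_eq χ h0 h1 hρ hZ)

/-- Test the identity on the function whose transform is a bump with nonzero integral against `χ
|x|^(s-1)`. -/
theorem gammaFactor_ne_zero (χ : Fˣ →ₜ* Circle) {s : ℂ} (h0 : 0 < s.re) (h1 : s.re < 1) :
    gammaFactor ψ μ S χ s ≠ 0 := by
  obtain ⟨ρ, hρ, -, -, hZ⟩ := h.exists_bump χ (s - 1) univ_mem
  intro hc
  have h2 := (h.isGammaValue_gammaFactor χ h0 h1 _ (h.neg_mem (h.fourier_mem ρ hρ))).2.2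
  rw [hc, zero_mul] at h2
  have e1 : fourier ψ μ (fun x => fourier ψ μ ρ (-x)) = ρ := by
    ext x
    rw [fourier_comp_neg, ← h.inversion hρ]
  rw [e1] at h2
  exact hZ h2

theorem hasDerivAt_dual (χ : Fˣ →ₜ* Circle) {f : F → ℂ} (hf : WeightIntegrable μ 0 1 f) {s : ℂ}
    (h0 : 0 < s.re) (h1 : s.re < 1) :
    HasDerivAt (fun s => ∫ x, f x * quasiChar χ (s - 1) x ∂μ)
      (∫ x, logMul f x * quasiChar χ (s - 1) x ∂μ) s := by
  have := hf.hasDerivAt χ (s := s - 1) (by simp; linarith) (by simp; linarith)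
  exact this.comp_sub_const s 1

theorem hasDerivAt_primal (χ : Fˣ →ₜ* Circle) {f : F → ℂ} (hf : WeightIntegrable μ 0 1 f) {s : ℂ}
    (h0 : 0 < s.re) (h1 : s.re < 1) :
    HasDerivAt (fun s => ∫ x, f x * quasiChar χ⁻¹ (-s) x ∂μ)
      (-∫ x, logMul f x * quasiChar χ⁻¹ (-s) x ∂μ) s := by
  have := hf.hasDerivAt χ⁻¹ (s := -s) (by simp; linarith) (by simp; linarith)
  exact (this.scomp s (hasDerivAt_neg s)).congr_deriv (by simp)

omit h in
theorem _root_.LocalCommutator.isOpen_strip : IsOpen {s : ℂ | 0 < s.re ∧ s.re < 1} :=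
  (isOpen_lt continuous_const Complex.continuous_re).inter
    (isOpen_lt Complex.continuous_re continuous_const)

theorem weight_strip {φ : F → ℂ} (hφ : φ ∈ S) : WeightIntegrable μ 0 1 φ :=
  (h.weight hφ).mono (by norm_num) le_rfl

theorem differentiableOn_gammaFactor (χ : Fˣ →ₜ* Circle) :
    DifferentiableOn ℂ (gammaFactor ψ μ S χ) {s | 0 < s.re ∧ s.re < 1} := by
  rintro s ⟨h0, h1⟩
  obtain ⟨ρ, hρ, -, -, hZ⟩ := h.exists_bump χ⁻¹ (-s) univ_mem
  have d1 := h.hasDerivAt_dual χ (h.weight_strip (h.fourier_mem ρ hρ)) h0 h1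
  have d2 := h.hasDerivAt_primal χ (h.weight_strip hρ) h0 h1
  refine DifferentiableAt.differentiableWithinAt ?_
  refine (d1.differentiableAt.div d2.differentiableAt hZ).congr_of_eventuallyEq ?_
  filter_upwards [isOpen_strip.mem_nhds ⟨h0, h1⟩, d2.continuousAt.eventually_ne hZ] with t ht hZt
  exact h.gammaFactor_eq χ ht.1 ht.2 hρ hZt

theorem hasGammaFactor : HasGammaFactor ψ μ S := by
  refine fun χ => ⟨fun s h0 h1 => ⟨h.isGammaValue_gammaFactor χ h0 h1, fun c hc => ?_,
    h.gammaFactor_ne_zero χ h0 h1⟩, h.differentiableOn_gammaFactor χ⟩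
  obtain ⟨ρ, hρ, -, -, hZ⟩ := h.exists_bump χ⁻¹ (-s) univ_mem
  rw [(h.isGammaValue_iff χ h0 h1 hρ hZ c).1 hc, h.gammaFactor_eq χ h0 h1 hρ hZ]

end IsTestSpace

end Commutator

/-! ### The spectral function -/

section Spectral

set_option linter.unusedSectionVars false

variable {F : Type*} [NontriviallyNormedField F] [ProperSpace F] [MeasurableSpace F] [BorelSpace F]
  {ψ : AddChar F Circle} {μ : Measure F} [μ.IsAddHaarMeasure] {S : Set (F → ℂ)}

namespace IsTestSpace

variable (h : IsTestSpace ψ μ S)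
include h

/-- `B α` need not be a test function, so the defining identity of `Γ` does not apply to it
directly. The exchange argument asks only for integrability, and it is run with `log |x| α^` against
a bump. -/
theorem dual_logMul_fourier (χ : Fˣ →ₜ* Circle) {s : ℂ} (h0 : 0 < s.re) (h1 : s.re < 1)
    {α : F → ℂ} (hα : α ∈ S) (hB : WeightIntegrable μ 0 1 (logConv ψ μ α)) :
    ∫ x, logMul (fourier ψ μ α) x * quasiChar χ (s - 1) x ∂μ =
      gammaFactor ψ μ S χ s * ∫ y, logConv ψ μ α y * quasiChar χ⁻¹ (-s) y ∂μ := by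
  obtain ⟨ρ, hρ, -, -, hZ⟩ := h.exists_bump χ⁻¹ (-s) univ_mem
  have hα' := h.fourier_mem α hα
  have key := tate_exchange (f := logConv ψ μ α) h.continuous_char (h.integrable_logMul_fourier hα)
    (h.integrable (h.fourier_mem ρ hρ)) (h.weight hα').logMul.1
    (h.measurable (h.fourier_mem ρ hρ)) (fun _ => rfl) (h.inversion hρ) χ s
    (hB.integrable_mul_quasiChar _ (by simpa using h0) (by simpa using h1))
    (h.integrable_dual χ h0 h1 (h.fourier_mem ρ hρ)) (h.integrable_primal χ h0 h1 hρ)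
    ((h.weight hα').logMul.integrable_mul_quasiChar χ (by simp; linarith) (by simp; linarith))
  rw [h.gammaFactor_eq χ h0 h1 hρ hZ, div_mul_eq_mul_div, eq_div_iff hZ]
  linear_combination -key

/-- The conductor operator `A + B` has eigenvalue `Γ' / Γ`. -/
theorem conductor_eigenvalue (χ : Fˣ →ₜ* Circle) {s : ℂ} (h0 : 0 < s.re) (h1 : s.re < 1)
    {α : F → ℂ} (hα : α ∈ S) (hB : WeightIntegrable μ 0 1 (logConv ψ μ α)) :
    ∫ y, logConv ψ μ α y * quasiChar χ⁻¹ (-s) y ∂μ =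
      logDeriv (gammaFactor ψ μ S χ) s * (∫ y, α y * quasiChar χ⁻¹ (-s) y ∂μ) -
        ∫ y, logMul α y * quasiChar χ⁻¹ (-s) y ∂μ := by
  have hΓ := h.gammaFactor_ne_zero χ h0 h1
  have d1 := h.hasDerivAt_dual χ (h.weight_strip (h.fourier_mem α hα)) h0 h1
  have d2 := h.hasDerivAt_primal χ (h.weight_strip hα) h0 h1
  have d3 := ((h.differentiableOn_gammaFactor χ).differentiableAt
    (isOpen_strip.mem_nhds ⟨h0, h1⟩)).hasDerivAt
  have e : (fun s => ∫ x, fourier ψ μ α x * quasiChar χ (s - 1) x ∂μ) =ᶠ[𝓝 s]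
      fun s => gammaFactor ψ μ S χ s * ∫ y, α y * quasiChar χ⁻¹ (-s) y ∂μ := by
    filter_upwards [isOpen_strip.mem_nhds ⟨h0, h1⟩] with t ht
    exact (h.isGammaValue_gammaFactor χ ht.1 ht.2 α hα).2.2
  -- Differentiate the defining identity of `Γ` in `s`: the left side yields the integral of `log
  -- |x| α^`, which is `Γ` times the integral of `B α`.
  have key := (d1.congr_of_eventuallyEq e.symm).unique (d3.mul d2)
  rw [h.dual_logMul_fourier χ h0 h1 hα hB] at key
  rw [logDeriv_apply]
  field_simp
  linear_combination key

/-- Differentiating the relation `B = Γ'/Γ - A` on `α` produces the integral of `A B α`; subtracting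
the same relation for `A α` cancels every term except the one with `(Γ'/Γ)'`. -/
theorem commutator_eigenvalue (χ : Fˣ →ₜ* Circle) {s : ℂ} (h0 : 0 < s.re) (h1 : s.re < 1)
    {α : F → ℂ} (hα : α ∈ S) (hl : logMul α ∈ S) (hB : WeightIntegrable μ 0 1 (logConv ψ μ α))
    (hB' : WeightIntegrable μ 0 1 (logConv ψ μ (logMul α))) :
    (∫ y, logConv ψ μ (logMul α) y * quasiChar χ⁻¹ (-s) y ∂μ) -
      (∫ y, logMul (logConv ψ μ α) y * quasiChar χ⁻¹ (-s) y ∂μ) =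
      deriv (logDeriv (gammaFactor ψ μ S χ)) s * ∫ y, α y * quasiChar χ⁻¹ (-s) y ∂μ := by
  have hopen := isOpen_strip.mem_nhds (show s ∈ {s : ℂ | 0 < s.re ∧ s.re < 1} from ⟨h0, h1⟩)
  have d1 := h.hasDerivAt_primal χ hB h0 h1
  have d2 := h.hasDerivAt_primal χ (h.weight_strip hα) h0 h1
  have d3 := h.hasDerivAt_primal χ (h.weight_strip hl) h0 h1
  have d4 : HasDerivAt (logDeriv (gammaFactor ψ μ S χ))
      (deriv (logDeriv (gammaFactor ψ μ S χ)) s) s := by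
    refine DifferentiableAt.hasDerivAt ?_
    have a1 : DifferentiableAt ℂ (gammaFactor ψ μ S χ) s :=
      (h.differentiableOn_gammaFactor χ).differentiableAt hopen
    have a2 : DifferentiableAt ℂ (deriv (gammaFactor ψ μ S χ)) s :=
      ((h.differentiableOn_gammaFactor χ).deriv isOpen_strip).differentiableAt hopen
    exact a2.div a1 (h.gammaFactor_ne_zero χ h0 h1)
  have e : (fun s => ∫ y, logConv ψ μ α y * quasiChar χ⁻¹ (-s) y ∂μ) =ᶠ[𝓝 s]
      fun s => logDeriv (gammaFactor ψ μ S χ) s * (∫ y, α y * quasiChar χ⁻¹ (-s) y ∂μ) -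
        ∫ y, logMul α y * quasiChar χ⁻¹ (-s) y ∂μ := by
    filter_upwards [hopen] with t ht
    exact h.conductor_eigenvalue χ ht.1 ht.2 hα hB
  have key := (d1.congr_of_eventuallyEq e.symm).unique ((d4.mul d2).sub d3)
  rw [h.conductor_eigenvalue χ h0 h1 hl hB']
  linear_combination key

/-- If `α` is supported near `1`, then its image under `B` is bounded and `O(|y|⁻¹)`. -/
theorem weight_logConv {α : F → ℂ} (hα : α ∈ S)
    (hs : Function.support α ⊆ Metric.ball 1 (1 / 2)) :
    WeightIntegrable μ 0 1 (logConv ψ μ α) := by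
  have hi := h.integrable_logMul_fourier hα
  have hm : Measurable (logConv ψ μ α) :=
    ((continuous_fourier h.continuous_char hi).comp continuous_neg).measurable
  obtain ⟨D, hD, hD2⟩ := exists_le_modulus_sub_one (F := F) one_pos
  obtain ⟨C3, hC3, hC3'⟩ := exists_modulus_le (F := F) 3
  set C := ∫ x, ‖logMul (fourier ψ μ α) x‖ ∂μ with hC
  have hC0 : 0 ≤ C := integral_nonneg fun _ => norm_nonneg _
  have hbd : ∀ x, ‖logConv ψ μ α x‖ ≤ C := fun x => norm_fourier_le _ _
  set C' := |h.logConst| * (D * ∫ x, ‖α x‖ ∂μ) with hC'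
  have hC'0 : 0 ≤ C' := by positivity
  have hsupp : ∀ w, α w ≠ 0 → w ≠ 0 ∧ ‖w‖ < 3 / 2 := by
    intro w hw
    have := hs hw
    rw [mem_ball_iff_norm] at this
    constructor
    · rintro rfl
      rw [zero_sub, norm_neg, norm_one] at this
      norm_num at this
    · calc ‖w‖ = ‖(w - 1) + 1‖ := by ring_nf
        _ ≤ ‖w - 1‖ + ‖(1 : F)‖ := norm_add_le _ _
        _ < 3 / 2 := by rw [norm_one]; linarith
  have := weightIntegrable_of_bound (μ := μ) hm (C := C + C * C3 + C') (p := 0) (q := 1)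
    (fun x _ _ => by
      have := hbd x
      rw [Real.rpow_zero, mul_one]
      nlinarith) (fun y hy => by
      have hy0 : y ≠ 0 := norm_pos_iff.1 (by linarith)
      have hp := modulus_pos hy0
      rw [Real.rpow_neg hp.le, ← div_eq_mul_inv, Real.rpow_one, le_div_iff₀ hp]
      rcases le_or_gt ‖y‖ 3 with h3 | h3
      -- For `‖y‖ ≤ 3` boundedness is enough. Beyond that, `y` is outside the support of `α`, the
      -- translate by `y` vanishes at `0`, and `B α` is an honest integral against `|w - y|⁻¹`.
      · have := mul_le_mul (hbd y) (hC3' y h3) hp.le hC0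
        linarith
      · have hαy : α (y + 0) = 0 := by
          by_contra hc
          have := (hsupp _ hc).2
          rw [add_zero] at this
          linarith
        have e1 : ‖logConv ψ μ α y‖ ≤ |h.logConst| * ∫ w, ‖α w‖ * (modulus (w - y))⁻¹ ∂μ := by
          rw [logConv_eq_logFourier, h.logFourier_eq (h.translate_mem α hα y) hαy,
            ← integral_add_left_eq_self (fun w => ‖α w‖ * (modulus (w - y))⁻¹) y]
          rw [norm_mul, norm_neg, Complex.norm_real, Real.norm_eq_abs]
          refine mul_le_mul_of_nonneg_left ((norm_integral_le_integral_norm _).trans (le_of_eq ?_))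
            (abs_nonneg _)
          congr 1
          ext w
          rw [norm_mul, Complex.norm_real, Real.norm_of_nonneg (inv_nonneg.2 (modulus_nonneg _)),
            add_sub_cancel_left]
        have e2 : ∫ w, ‖α w‖ * (modulus (w - y))⁻¹ ∂μ ≤ ∫ w, ‖α w‖ * (D * (modulus y)⁻¹) ∂μ := by
          refine integral_mono_of_nonneg (.of_forall fun w =>
            mul_nonneg (norm_nonneg _) (inv_nonneg.2 (modulus_nonneg _)))
            ((h.integrable hα).norm.mul_const _) (.of_forall fun w => ?_)
          by_cases hw : α w = 0
          · simp [hw]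
          obtain ⟨hw0, hw1⟩ := hsupp w hw
          refine mul_le_mul_of_nonneg_left ?_ (norm_nonneg _)
          have hw' := modulus_pos hw0
          have hwn := norm_pos_iff.2 hw0
          -- As `‖y‖ > 3` and `‖w‖ < 3/2`, the ratio satisfies `‖y / w - 1‖ ≥ 1`, which is the
          -- separation for which `D` was chosen.
          have h4 := (hD2 (y / w) (by
            have := norm_sub_norm_le (y / w) 1
            rw [norm_div, norm_one] at this
            have h5 : 2 ≤ ‖y‖ / ‖w‖ := by rw [le_div_iff₀ hwn]; linarith
            linarith)).1
          rw [show y / w - 1 = (y - w) / w by field_simp, modulus_div, modulus_div,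
            ← mul_div_assoc, div_le_div_iff_of_pos_right hw', modulus_sub_comm] at h4
          have h5 : 0 < modulus (w - y) := by
            by_contra h6
            nlinarith
          rw [← div_eq_mul_inv, inv_le_comm₀ h5 (by positivity), inv_div, div_le_iff₀ hD]
          linarith
        rw [integral_mul_const] at e2
        have h6 : ‖logConv ψ μ α y‖ ≤ C' * (modulus y)⁻¹ := by
          refine e1.trans ((mul_le_mul_of_nonneg_left e2 (abs_nonneg _)).trans (le_of_eq ?_))
          rw [hC']; ring
        have h7 : ‖logConv ψ μ α y‖ * modulus y ≤ C' := by
          rwa [← le_div_iff₀ hp, div_eq_mul_inv]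
        have : 0 ≤ C * C3 := by positivity
        linarith)
  exact this.mono (by norm_num) (by norm_num)

/-- The eigenvalue of the kernel operator on the quasi-character `χ⁻¹(y) |y| ^ (-1/2 - it)`. -/
def kernelEigenvalue (χ : Fˣ →ₜ* Circle) (t : ℝ) : ℂ :=
  Complex.I * h.logConst * ∫ u, ((Real.log (modulus u) * (modulus (1 - u))⁻¹ : ℝ) : ℂ) *
    quasiChar χ⁻¹ (-(1 / 2 + t * Complex.I)) u ∂μ

omit h in
theorem _root_.LocalCommutator.norm_quasiChar_critical (χ : Fˣ →ₜ* Circle) (t : ℝ) {u : F}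
    (hu : u ≠ 0) :
    ‖quasiChar χ⁻¹ (-(1 / 2 + t * Complex.I)) u‖ = modulus u ^ (-(1 / 2) : ℝ) := by
  rw [norm_quasiChar _ _ hu]
  congr 1
  simp

theorem norm_kernelEigenvalue_le (χ : Fˣ →ₜ* Circle) (t : ℝ) :
    ‖h.kernelEigenvalue χ t‖ ≤ |h.logConst| * ∫ u : F, ‖Real.log (modulus u) *
      (modulus (1 - u))⁻¹ * modulus u ^ (-(1 / 2) : ℝ)‖ ∂μ := by
  rw [kernelEigenvalue, norm_mul, norm_mul, Complex.norm_I, one_mul, Complex.norm_real,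
    Real.norm_eq_abs]
  refine mul_le_mul_of_nonneg_left ((norm_integral_le_integral_norm _).trans (le_of_eq ?_))
    (abs_nonneg _)
  refine integral_congr_ae ?_
  filter_upwards [ae_ne_zero μ] with u hu
  rw [norm_mul, norm_quasiChar_critical χ t hu, Complex.norm_real, norm_mul (_ * _),
    Real.norm_of_nonneg (Real.rpow_nonneg (modulus_nonneg u) _)]

/-- Substitute `x = y u`: the Jacobian cancels the degree `-1` of the kernel, and the
quasi-character is multiplicative. -/
theorem integral_kernel_quasiChar (χ : Fˣ →ₜ* Circle) (t : ℝ) {y : F} (hy : y ≠ 0) :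
    ∫ x, commutatorKernel h.logConst x y * quasiChar χ⁻¹ (-(1 / 2 + t * Complex.I)) x ∂μ =
      h.kernelEigenvalue χ t * quasiChar χ⁻¹ (-(1 / 2 + t * Complex.I)) y := by
  rw [integral_eq_comp_mul μ hy, kernelEigenvalue, mul_assoc, mul_assoc, ← integral_mul_const,
    ← integral_const_mul, ← integral_const_mul, ← integral_const_mul]
  refine integral_congr_ae ?_
  filter_upwards [ae_ne_zero μ] with u hu
  rw [quasiChar_mul, commutatorKernel_conj, commutatorKernel_mul _ hy hu]
  simp only [map_mul, map_neg, Complex.conj_I, Complex.conj_ofReal]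
  have : ((modulus y : ℝ) : ℂ) ≠ 0 := Complex.ofReal_ne_zero.2 (modulus_ne_zero hy)
  rw [Complex.ofReal_inv (modulus y)]
  field_simp

/-- On the critical line the quasi-character has absolute value `|x|^(-1/2)`, the weight of the
Schur test, so the Schur bound itself controls the integral in `x`. -/
theorem integrable_kernel_prod (χ : Fˣ →ₜ* Circle) (t : ℝ) {α : F → ℂ}
    (hα : WeightIntegrable μ 0 1 α) :
    Integrable (fun p : F × F => commutatorKernel h.logConst p.1 p.2 * α p.2 *
      quasiChar χ⁻¹ (-(1 / 2 + t * Complex.I)) p.1) (μ.prod μ) := by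
  obtain ⟨M, hM⟩ := h.exists_isSchurKernel
  have hk : Measurable fun p : F × F => commutatorKernel h.logConst p.1 p.2 :=
    measurable_commutatorKernel _
  have hαm := hα.1
  have hm : Measurable (fun p : F × F => commutatorKernel h.logConst p.1 p.2 * α p.2 *
      quasiChar χ⁻¹ (-(1 / 2 + t * Complex.I)) p.1) := by fun_prop
  refine ⟨hm.aestronglyMeasurable, ?_⟩
  rw [hasFiniteIntegral_iff_enorm, lintegral_prod_symm _ hm.enorm.aemeasurable]
  have hw := hα.2 (1 / 2) (by norm_num) (by norm_num)
  calc _ ≤ ∫⁻ y, ENNReal.ofReal M * ENNReal.ofReal (modulus y ^ (-(1 / 2) : ℝ) * ‖α y‖) ∂μ := by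
        refine lintegral_mono_ae ?_
        filter_upwards [hM.bound] with y hy
        have e : ∫⁻ x, ‖commutatorKernel h.logConst x y * α y *
            quasiChar χ⁻¹ (-(1 / 2 + t * Complex.I)) x‖ₑ ∂μ =
            ‖α y‖ₑ * ∫⁻ x, ‖commutatorKernel h.logConst y x‖ₑ *
              ENNReal.ofReal (modulus x ^ (-(1 / 2) : ℝ)) ∂μ := by
          rw [← lintegral_const_mul' _ _ enorm_ne_top]
          refine lintegral_congr_ae ?_
          filter_upwards [ae_ne_zero μ] with x hx
          rw [enorm_mul, enorm_mul, hM.enorm_symm, ← norm_quasiChar_critical χ t hx, ofReal_norm]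
          ring
        rw [e]
        calc _ ≤ ‖α y‖ₑ * (ENNReal.ofReal M * ENNReal.ofReal (modulus y ^ (-(1 / 2) : ℝ))) := by
              gcongr
          _ = _ := by
              rw [ENNReal.ofReal_mul (Real.rpow_nonneg (modulus_nonneg _) _), ofReal_norm]
              ring
    _ < ∞ := by
        rw [lintegral_const_mul' _ _ ENNReal.ofReal_ne_top]
        exact ENNReal.mul_lt_top ENNReal.ofReal_lt_top hw.lintegral_lt_top

theorem integral_kernel_mul_quasiChar (χ : Fˣ →ₜ* Circle) (t : ℝ) {α : F → ℂ}
    (hα : WeightIntegrable μ 0 1 α) :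
    ∫ x, (∫ y, commutatorKernel h.logConst x y * α y ∂μ) *
      quasiChar χ⁻¹ (-(1 / 2 + t * Complex.I)) x ∂μ =
    h.kernelEigenvalue χ t * ∫ y, α y * quasiChar χ⁻¹ (-(1 / 2 + t * Complex.I)) y ∂μ := by
  simp_rw [← integral_mul_const]
  rw [integral_integral_swap (h.integrable_kernel_prod χ t hα), ← integral_const_mul]
  refine integral_congr_ae ?_
  filter_upwards [ae_ne_zero μ] with y hy
  have := h.integral_kernel_quasiChar χ t hy
  calc _ = ∫ x, α y * (commutatorKernel h.logConst x y *
        quasiChar χ⁻¹ (-(1 / 2 + t * Complex.I)) x) ∂μ := by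
        congr 1; ext x; ring
    _ = _ := by rw [integral_const_mul, this]; ring

theorem integrable_integral_kernel_mul (χ : Fˣ →ₜ* Circle) (t : ℝ) {α : F → ℂ}
    (hα : WeightIntegrable μ 0 1 α) :
    Integrable (fun x => (∫ y, commutatorKernel h.logConst x y * α y ∂μ) *
      quasiChar χ⁻¹ (-(1 / 2 + t * Complex.I)) x) μ := by
  simp_rw [← integral_mul_const]
  exact (h.integrable_kernel_prod χ t hα).integral_prod_left

/-- The Mellin integral of the commutator of a single bump near `1` is computed twice, from the
kernel and from the derivative of `Γ'/Γ`; the nonzero Mellin integral of the bump cancels. -/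
theorem spectralK_eq (χ : Fˣ →ₜ* Circle) (t : ℝ) :
    spectralK ψ μ S χ (1 / 2 + t * Complex.I) = -h.kernelEigenvalue χ t := by
  obtain ⟨α, hα, -, hs, hZ⟩ := h.exists_bump χ⁻¹ (-(1 / 2 + t * Complex.I))
    (Metric.ball_mem_nhds (1 : F) (ε := 1 / 2) (by norm_num))
  have h0 : α =ᶠ[𝓝 0] 0 := by
    filter_upwards [Metric.ball_mem_nhds (0 : F) (ε := 1 / 2) (by norm_num)] with u hu
    by_contra hu0
    have h1 := hs hu0
    rw [mem_ball_iff_norm'] at h1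
    rw [mem_ball_zero_iff] at hu
    have := norm_sub_norm_le (1 : F) u
    rw [norm_one] at this
    linarith
  have hl := h.logMul_mem α hα h0
  -- Support near `1` gives `B α` and `B A α` the weights that let the two halves of the commutator
  -- be integrated separately.
  have hB := h.weight_logConv hα hs
  have hB' := h.weight_logConv hl (by
    refine subset_trans (fun x hx => ?_) hs
    intro h2
    exact hx (by simp [logMul, h2]))
  have r0 : 0 < (1 / 2 + t * Complex.I : ℂ).re := by simp
  have r1 : (1 / 2 + t * Complex.I : ℂ).re < 1 := by simp; norm_num
  have key := h.commutator_eigenvalue χ r0 r1 hα hl hB hB'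
  have i1 := hB.logMul.integrable_mul_quasiChar χ⁻¹ (s := -(1 / 2 + t * Complex.I))
    (by simp) (by simp; norm_num)
  have i2 := hB'.integrable_mul_quasiChar χ⁻¹ (s := -(1 / 2 + t * Complex.I))
    (by simp) (by simp; norm_num)
  have e := h.integral_kernel_mul_quasiChar χ t (h.weight_strip hα)
  have e2 : ∫ x, (∫ y, commutatorKernel h.logConst x y * α y ∂μ) *
      quasiChar χ⁻¹ (-(1 / 2 + t * Complex.I)) x ∂μ = Complex.I *
      ((∫ y, logConv ψ μ (logMul α) y * quasiChar χ⁻¹ (-(1 / 2 + t * Complex.I)) y ∂μ) -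
      (∫ y, logMul (logConv ψ μ α) y * quasiChar χ⁻¹ (-(1 / 2 + t * Complex.I)) y ∂μ)) := by
    rw [← integral_sub i2 i1, ← integral_const_mul]
    congr 1
    ext x
    rw [← h.commutator_apply hα h0 x]
    ring
  rw [e2, key, ← mul_assoc] at e
  have := mul_right_cancel₀ hZ e
  rw [spectralK, ← this]
  ring

theorem exists_norm_spectralK_le : ∃ C : ℝ, ∀ (χ : Fˣ →ₜ* Circle) (t : ℝ),
    ‖spectralK ψ μ S χ (1 / 2 + t * Complex.I)‖ ≤ C :=
  ⟨_, fun χ t => by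
    rw [h.spectralK_eq, norm_neg]
    exact h.norm_kernelEigenvalue_le χ t⟩

theorem commutatorIsBoundedHermitian : CommutatorIsBoundedHermitian ψ μ S := by
  refine ⟨h.dense_commutatorDomain, h.commutatorCLM,
    h.exists_isSchurKernel.choose_spec.isSelfAdjoint_toCLM (commutatorKernel_conj _),
    fun f g hg => h.eq_commutatorCLM hg, fun α hα h0 f hf =>
    ⟨h.mem_commutatorDomain hα h0 hf, fun χ t => ?_⟩⟩
  have hK := h.commutatorCLM_ae_eq hf
  have hw := h.weight_strip hα
  constructor
  · refine (h.integrable_integral_kernel_mul χ t hw).congr ?_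
    filter_upwards [hK] with x hx
    rw [hx]
  · rw [h.spectralK_eq, neg_mul, ← h.integral_kernel_mul_quasiChar χ t hw]
    congr 1
    refine integral_congr_ae ?_
    filter_upwards [hK] with x hx
    rw [hx]

end IsTestSpace

end Spectral

/-! ### Finite places -/

section Finite

set_option linter.unusedSectionVars false

variable {F : Type*} [NontriviallyNormedField F] [IsUltrametricDist F] [ProperSpace F]

theorem modulus_eq_of_norm_eq {x y : F} (hxy : ‖x‖ = ‖y‖) : modulus x = modulus y := by
  by_cases hy : y = 0
  · have : x = 0 := by rw [hy, norm_zero] at hxy; exact norm_eq_zero.1 hxy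
    rw [this, hy]
  have h1 : ‖x / y‖ = 1 := by rw [norm_div, hxy, div_self (norm_ne_zero_iff.2 hy)]
  have h2 := modulus_le_one h1.le
  have h3 := one_le_modulus h1.ge
  rw [modulus_div] at h2 h3
  exact (div_eq_one_iff_eq (modulus_ne_zero hy)).1 (le_antisymm h2 h3)

/-- The circle has no small subgroups, so a continuous character is trivial on a ball. -/
theorem exists_char_trivial {ψ : AddChar F Circle} (hψ : Continuous ψ) :
    ∃ r > 0, ∀ x : F, ‖x‖ < r → ψ x = 1 := by
  have h1 : ∀ᶠ x in 𝓝 (0 : F), ‖(ψ x : ℂ) - 1‖ < 1 / 2 := by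
    have hc : Continuous fun x => ‖(ψ x : ℂ) - 1‖ :=
      ((continuous_subtype_val.comp hψ).sub continuous_const).norm
    have := hc.tendsto 0
    simp only [AddChar.map_zero_eq_one, Circle.coe_one, sub_self, norm_zero] at this
    exact this.eventually_lt_const (by norm_num)
  obtain ⟨r, hr, hr1⟩ := Metric.eventually_nhds_iff_ball.1 h1
  refine ⟨r, hr, fun x hx => ?_⟩
  -- All multiples `2 ^ n • x` stay in the ball, so `z = ψ(2 ^ n • x)` stays within `1/2` of `1` and
  -- `‖z² - 1‖ ≥ (3/2) ‖z - 1‖`. Unless `ψ x = 1`, this growth contradicts the bound `2` on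
  -- distances in the circle.
  have h2 : ∀ n : ℕ, (3 / 2 : ℝ) ^ n * ‖(ψ x : ℂ) - 1‖ ≤ ‖(ψ ((2 ^ n : ℕ) • x) : ℂ) - 1‖ := by
    intro n
    induction n with
    | zero => simp
    | succ n ih =>
      set z : ℂ := (ψ ((2 ^ n : ℕ) • x) : ℂ) with hz
      have e : (ψ ((2 ^ (n + 1) : ℕ) • x) : ℂ) = z ^ 2 := by
        rw [hz, pow_succ, mul_comm, mul_smul, AddChar.map_nsmul_eq_pow]
        simp
      have hz1 : ‖z - 1‖ < 1 / 2 := by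
        refine hr1 _ ?_
        rw [mem_ball_zero_iff, nsmul_eq_mul, norm_mul]
        have : ‖((2 ^ n : ℕ) : F)‖ ≤ 1 := IsUltrametricDist.norm_natCast_le_one F _
        exact (mul_le_of_le_one_left (norm_nonneg _) this).trans_lt hx
      have hz2 : 3 / 2 ≤ ‖z + 1‖ := by
        have : ‖(2 : ℂ)‖ ≤ ‖z + 1‖ + ‖z - 1‖ := by
          calc ‖(2 : ℂ)‖ = ‖(z + 1) - (z - 1)‖ := by ring_nf
            _ ≤ _ := norm_sub_le _ _
        norm_num at this
        linarith
      rw [e, show z ^ 2 - 1 = (z + 1) * (z - 1) by ring, norm_mul, pow_succ]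
      calc _ = (3 / 2 : ℝ) * ((3 / 2) ^ n * ‖(ψ x : ℂ) - 1‖) := by ring
        _ ≤ _ := by gcongr
  by_contra hne
  have h3 : 0 < ‖(ψ x : ℂ) - 1‖ := by
    rw [norm_pos_iff, sub_ne_zero]
    intro h4
    exact hne (Circle.ext (by simpa using h4))
  obtain ⟨n, hn⟩ := pow_unbounded_of_one_lt (2 / ‖(ψ x : ℂ) - 1‖ + 1) (by norm_num : (1 : ℝ) < 3 / 2)
  have h4 := h2 n
  have h5 : ‖(ψ ((2 ^ n : ℕ) • x) : ℂ) - 1‖ ≤ 2 := by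
    refine (norm_sub_le _ _).trans ?_
    rw [Circle.norm_coe, norm_one]
    norm_num
  have h6 : 2 / ‖(ψ x : ℂ) - 1‖ < (3 / 2) ^ n := by linarith
  rw [div_lt_iff₀ h3] at h6
  linarith

omit [IsUltrametricDist F] in
/-- A Bruhat function is invariant under small translations. -/
theorem exists_invariant {φ : F → ℂ} (hφ : φ ∈ bruhat F) :
    ∃ δ > 0, ∀ x h : F, ‖h‖ < δ → φ (x + h) = φ x := by
  obtain ⟨δ, hδ, h1⟩ := lebesgue_number_lemma_of_metric (s := tsupport φ) (c := fun v => φ ⁻¹' {v})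
    hφ.2 (fun v => hφ.1.isOpen_fiber v) (fun x _ => Set.mem_iUnion.2 ⟨φ x, rfl⟩)
  have key : ∀ x ∈ tsupport φ, ∀ y, ‖y - x‖ < δ → φ y = φ x := by
    intro x hx y hy
    obtain ⟨v, hv⟩ := h1 x hx
    have h2 : φ x = v := hv (Metric.mem_ball_self hδ)
    have h3 : φ y = v := hv (mem_ball_iff_norm.2 hy)
    rw [h2, h3]
  refine ⟨δ, hδ, fun x h hh => ?_⟩
  by_cases hx : x ∈ tsupport φ
  · exact key x hx _ (by simpa using hh)
  by_cases hy : x + h ∈ tsupport φ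
  · exact (key _ hy x (by simpa using hh)).symm
  · rw [image_eq_zero_of_notMem_tsupport hx, image_eq_zero_of_notMem_tsupport hy]

theorem isLocallyConstant_indicator_of_ball {s : Set F} {r : ℝ} (hr : 0 < r)
    (hs : ∀ x y, ‖y - x‖ < r → (y ∈ s ↔ x ∈ s)) :
    IsLocallyConstant (s.indicator fun _ => (1 : ℂ)) := by
  rw [IsLocallyConstant.iff_eventually_eq]
  intro x
  filter_upwards [Metric.ball_mem_nhds x hr] with y hy
  have := hs x y (mem_ball_iff_norm.1 hy)
  by_cases hx : x ∈ s
  · rw [Set.indicator_of_mem hx, Set.indicator_of_mem (this.2 hx)]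
  · rw [Set.indicator_of_notMem hx, Set.indicator_of_notMem fun h => hx (this.1 h)]

theorem indicator_mem_bruhat {s : Set F} {r : ℝ} (hr : 0 < r) (hb : Bornology.IsBounded s)
    (hs : ∀ x y, ‖y - x‖ < r → (y ∈ s ↔ x ∈ s)) :
    (s.indicator fun _ => (1 : ℂ)) ∈ bruhat F := by
  refine ⟨isLocallyConstant_indicator_of_ball hr hs, ?_⟩
  refine HasCompactSupport.of_support_subset_isCompact hb.isCompact_closure ?_
  exact (Set.support_indicator_subset).trans subset_closure

theorem ball_iff {a : F} {r : ℝ} (x y : F) (hxy : ‖y - x‖ < r) :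
    y ∈ Metric.ball a r ↔ x ∈ Metric.ball a r := by
  rw [mem_ball_iff_norm, mem_ball_iff_norm]
  constructor
  · intro h
    have := IsUltrametricDist.norm_add_le_max (x - y) (y - a)
    rw [sub_add_sub_cancel, norm_sub_rev x y] at this
    exact this.trans_lt (max_lt hxy h)
  · intro h
    have := IsUltrametricDist.norm_add_le_max (y - x) (x - a)
    rw [sub_add_sub_cancel] at this
    exact this.trans_lt (max_lt hxy h)

theorem thickening_iff {K : Set F} {r : ℝ} (x y : F) (hxy : ‖y - x‖ < r) :
    y ∈ Metric.thickening r K ↔ x ∈ Metric.thickening r K := by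
  simp only [Metric.thickening_eq_biUnion_ball, Set.mem_iUnion, ball_iff x y hxy]

variable [MeasurableSpace F] [BorelSpace F] {ψ : AddChar F Circle} {μ : Measure F}
  [μ.IsAddHaarMeasure]

/-- Compact support of `φ` and triviality of `ψ` near `0` make the transform locally constant;
invariance of `φ` under small translations and nontriviality of `ψ` make it compactly supported. -/
theorem fourier_mem_bruhat (hψ : Continuous ψ) (hψ1 : ψ ≠ 1) {φ : F → ℂ} (hφ : φ ∈ bruhat F) :
    fourier ψ μ φ ∈ bruhat F := by
  constructor
  · obtain ⟨r, hr, hr1⟩ := exists_char_trivial hψ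
    obtain ⟨R, hR, hR1⟩ := (Metric.isBounded_iff_subset_ball (0 : F)).1 hφ.2.isBounded |>.imp
      fun R h => (⟨h, h⟩ : _ ∧ _)
    rw [IsLocallyConstant.iff_eventually_eq]
    intro x
    have hR0 : 0 < max R 1 := lt_max_of_lt_right one_pos
    filter_upwards [Metric.ball_mem_nhds x (div_pos hr hR0)] with y hy
    rw [fourier_apply, fourier_apply]
    congr 1
    ext w
    by_cases hw : φ w = 0
    · simp [hw]
    have h1 : ‖w‖ < max R 1 := by
      have := hR1 (subset_tsupport φ hw)
      rw [mem_ball_zero_iff] at this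
      exact lt_max_of_lt_left this
    have h2 : ψ (-(w * (y - x))) = 1 := by
      apply hr1
      rw [norm_neg, norm_mul]
      rw [mem_ball_iff_norm, lt_div_iff₀ hR0] at hy
      nlinarith [norm_nonneg w, norm_nonneg (y - x)]
    have h3 : -(w * y) = -(w * (y - x)) + -(w * x) := by ring
    rw [h3, AddChar.map_add_eq_mul, h2, one_mul]
  · obtain ⟨δ, hδ, hδ1⟩ := exists_invariant hφ
    obtain ⟨a, ha⟩ : ∃ a, ψ a ≠ 1 := by
      by_contra! hc
      exact hψ1 (DFunLike.ext _ _ fun x => by simpa using hc x)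
    refine HasCompactSupport.of_support_subset_isCompact
      (isCompact_closedBall (0 : F) (‖a‖ / δ)) fun x hx => ?_
    by_contra hx2
    rw [mem_closedBall_zero_iff, not_le, div_lt_iff₀ hδ] at hx2
    have hx0 : x ≠ 0 := by
      rintro rfl
      simp at hx2
      linarith [norm_nonneg a]
    have h1 : ‖a / x‖ < δ := by
      rw [norm_div, div_lt_iff₀ (norm_pos_iff.2 hx0)]
      linarith
    -- Translating by the small element `a / x` leaves `φ` unchanged but multiplies its transform at
    -- `x` by `ψ a ≠ 1`.
    have h2 := fourier_comp_add (ψ := ψ) (μ := μ) φ (a / x) x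
    have h3 : (fun y => φ (a / x + y)) = φ := by
      ext y
      rw [add_comm, hδ1 _ _ h1]
    rw [h3, div_mul_cancel₀ _ hx0] at h2
    have h4 : (ψ a : ℂ) = 1 := by
      have h5 : fourier ψ μ φ x ≠ 0 := hx
      exact mul_right_cancel₀ h5 (by rw [← h2, one_mul])
    exact ha (Circle.ext (by simpa using h4))

/-- In an ultrametric space, indicators of thickenings of a compact set are test functions.
Shrinking the thickening gives zero integral over every compact set. -/
theorem bruhat_separating (f : Lp ℂ 2 μ) (hf : ∀ φ ∈ bruhat F, ∫ x, f x * φ x ∂μ = 0) : f = 0 := by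
  have hloc : LocallyIntegrable f μ := (Lp.memLp f).locallyIntegrable (by norm_num)
  refine Lp.eq_zero_iff_ae_eq_zero.2
    (ae_eq_zero_of_forall_setIntegral_isCompact_eq_zero' hloc fun K hK => ?_)
  have hr : ∀ n : ℕ, (0 : ℝ) < 1 / ((n : ℝ) + 1) := fun n => Nat.one_div_pos_of_nat
  have hb : ∀ n : ℕ, Bornology.IsBounded (Metric.thickening (1 / ((n : ℝ) + 1)) K) :=
    fun n => hK.isBounded.thickening
  have h1 : ∀ n : ℕ, ∫ x in Metric.thickening (1 / ((n : ℝ) + 1)) K, f x ∂μ = 0 := by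
    intro n
    rw [← integral_indicator Metric.isOpen_thickening.measurableSet,
      ← hf _ (indicator_mem_bruhat (hr n) (hb n) thickening_iff)]
    congr 1
    ext x
    by_cases hx : x ∈ Metric.thickening (1 / ((n : ℝ) + 1)) K
    · rw [Set.indicator_of_mem hx, Set.indicator_of_mem hx, mul_one]
    · rw [Set.indicator_of_notMem hx, Set.indicator_of_notMem hx, mul_zero]
  have h2 : Tendsto (fun n : ℕ => ∫ x in Metric.thickening (1 / ((n : ℝ) + 1)) K, f x ∂μ) atTop
      (𝓝 (∫ x in ⋂ n : ℕ, Metric.thickening (1 / ((n : ℝ) + 1)) K, f x ∂μ)) := by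
    refine tendsto_setIntegral_of_antitone
      (fun n => Metric.isOpen_thickening.measurableSet) (fun m n hmn => ?_) ⟨0, ?_⟩
    · exact Metric.thickening_mono (one_div_le_one_div_of_le (by positivity) (by gcongr)) K
    · exact (hloc.integrableOn_isCompact (hb 0).isCompact_closure).mono_set subset_closure
  have h3 : ⋂ n : ℕ, Metric.thickening (1 / ((n : ℝ) + 1)) K = K := by
    refine subset_antisymm (fun x hx => ?_) (Set.subset_iInter fun n =>
      Metric.self_subset_thickening (hr n) K)
    rw [← hK.isClosed.closure_eq, Metric.mem_closure_iff]
    intro ε hε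
    obtain ⟨n, hn⟩ := exists_nat_one_div_lt hε
    obtain ⟨z, hz, hxz⟩ := Metric.mem_thickening_iff.1 (Set.mem_iInter.1 hx n)
    exact ⟨z, hz, hxz.trans hn⟩
  simp only [h1] at h2
  rw [h3] at h2
  exact tendsto_nhds_unique h2 tendsto_const_nhds

theorem isTestSpace_bruhat (hψ : Continuous ψ) (hψ1 : ψ ≠ 1) (hdual : IsSelfDual ψ μ (bruhat F)) :
    IsTestSpace ψ μ (bruhat F) where
  continuous_char := hψ
  add_mem φ hφ θ hθ := ⟨hφ.1.add hθ.1, hφ.2.add hθ.2⟩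
  smul_mem c φ hφ := ⟨hφ.1.comp (fun z => c * z), hφ.2.mul_left⟩
  mul_mem φ hφ θ hθ := ⟨hφ.1.mul hθ.1, hφ.2.mul_right⟩
  translate_mem φ hφ a := ⟨hφ.1.comp_continuous (continuous_const.add continuous_id),
    hφ.2.comp_homeomorph (Homeomorph.addLeft a)⟩
  fourier_mem φ hφ := fourier_mem_bruhat hψ hψ1 hφ
  logMul_mem φ hφ h0 := by
    refine ⟨?_, hφ.2.mul_left⟩
    rw [IsLocallyConstant.iff_eventually_eq]
    intro x
    by_cases hx : x = 0
    · subst hx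
      filter_upwards [h0] with y hy
      have h1 : φ 0 = 0 := h0.eq_of_nhds
      have h2 : φ y = 0 := hy
      simp [logMul, h1, h2]
    · filter_upwards [Metric.ball_mem_nhds x (norm_pos_iff.2 hx),
        (IsLocallyConstant.iff_eventually_eq φ).1 hφ.1 x] with y hy hy2
      -- The norm, hence the logarithm of the modulus, is constant on the open ball of radius `‖x‖`
      -- around `x ≠ 0`.
      have h1 : ‖y‖ = ‖x‖ := by
        rw [mem_ball_iff_norm] at hy
        have := IsUltrametricDist.norm_add_eq_max_of_norm_ne_norm (x := y - x) (y := x) hy.ne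
        rwa [sub_add_cancel, max_eq_right hy.le] at this
      rw [logMul, logMul, hy2, modulus_eq_of_norm_eq h1]
  continuous φ hφ := hφ.1.continuous
  decay φ hφ := by
    obtain ⟨C1, h1⟩ := hφ.1.continuous.bounded_above_of_compact_support hφ.2
    have hc : Continuous fun x => φ x * ((modulus x ^ 2 : ℝ) : ℂ) :=
      hφ.1.continuous.mul (Complex.continuous_ofReal.comp (continuous_modulus.pow 2))
    obtain ⟨C2, h2⟩ := hc.bounded_above_of_compact_support hφ.2.mul_right
    refine ⟨max C1 C2, fun x => ⟨(h1 x).trans (le_max_left _ _), le_trans ?_ (le_max_right C1 C2)⟩⟩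
    have := h2 x
    rwa [norm_mul, Complex.norm_real, Real.norm_of_nonneg (sq_nonneg _)] at this
  vanish φ hφ h0 := by
    obtain ⟨C, hC⟩ := hφ.1.continuous.bounded_above_of_compact_support hφ.2
    obtain ⟨r, hr, hr1⟩ := Metric.eventually_nhds_iff_ball.1
      ((IsLocallyConstant.iff_eventually_eq φ).1 hφ.1 0)
    obtain ⟨a, ha0, ha⟩ := NormedField.exists_norm_lt F hr
    have hC0 : 0 ≤ C := (norm_nonneg _).trans (hC 0)
    have hpa := modulus_pos (norm_pos_iff.1 ha0)
    refine ⟨1, one_pos, C / modulus a, fun x => ?_⟩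
    rw [Real.rpow_one]
    by_cases hx : ‖x‖ < r
    · rw [hr1 x (mem_ball_zero_iff.2 hx), h0, norm_zero]
      exact mul_nonneg (div_nonneg hC0 hpa.le) (modulus_nonneg _)
    · have h1 : 1 ≤ modulus (x / a) := one_le_modulus (by
        rw [norm_div, le_div_iff₀ ha0]
        linarith)
      rw [modulus_div] at h1
      refine (hC x).trans ?_
      rw [div_mul_eq_mul_div, mul_div_assoc]
      exact le_mul_of_one_le_right hC0 h1
  selfDual := hdual
  separating := bruhat_separating
  bump a U hU := by
    obtain ⟨r, hr, hrU⟩ := Metric.mem_nhds_iff.1 hU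
    refine ⟨_, indicator_mem_bruhat hr Metric.isBounded_ball (ball_iff (a := a)), fun x => ?_, ?_,
      Set.support_indicator_subset.trans hrU⟩
    · by_cases hx : x ∈ Metric.ball a r
      · exact ⟨1, zero_le_one, le_rfl, by simp [hx]⟩
      · exact ⟨0, le_rfl, zero_le_one, by simp [hx]⟩
    · filter_upwards [Metric.ball_mem_nhds a hr] with x hx
      simp [Set.indicator_of_mem hx]

end Finite

/-! ### Schwartz functions on a real inner product space -/

section SchwartzSpace

open scoped ContDiff

variable {E : Type*} [NormedAddCommGroup E] [NormedSpace ℝ E]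

theorem iteratedDeriv_succ_log (n : ℕ) (x : ℝ) :
    iteratedDeriv (n + 1) Real.log x = (-1) ^ n * n.factorial * x ^ (-1 - n : ℤ) := by
  rw [iteratedDeriv_succ', Real.deriv_log', iteratedDeriv_eq_iterate]
  exact iter_deriv_inv n x

/-- On a half-line bounded away from `0`, the derivatives of `log` of order `n + 1` are bounded by
`n! c^(-1-n)`; only order `0` needs a linear bound. -/
theorem hasTemperateGrowth_log_comp {u : E → ℝ} (hu : u.HasTemperateGrowth) {c : ℝ} (hc : 0 < c)
    (h : ∀ x, c < u x) : (fun x => Real.log (u x)).HasTemperateGrowth := by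
  have hopen : IsOpen (Set.Ioi c) := isOpen_Ioi
  have hne : ∀ x ∈ Set.Ioi c, x ≠ 0 := fun x hx => (hc.trans hx).ne'
  refine Function.HasTemperateGrowth.comp' (g := Real.log) (t := Set.Ioi c) ?_
    hopen.uniqueDiffOn (contDiffOn_fun_id.log hne) (fun N => ?_) hu
  · rintro _ ⟨x, rfl⟩
    exact h x
  have hb : ∀ n : ℕ, ∃ C, 0 ≤ C ∧ ∀ x ∈ Set.Ioi c,
      ‖iteratedFDerivWithin ℝ n Real.log (Set.Ioi c) x‖ ≤ C * (1 + ‖x‖) ^ 1 := by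
    intro n
    have key : ∀ x ∈ Set.Ioi c, ‖iteratedFDerivWithin ℝ n Real.log (Set.Ioi c) x‖ =
        ‖iteratedDeriv n Real.log x‖ := fun x hx => by
      rw [norm_iteratedFDerivWithin_eq_norm_iteratedDerivWithin,
        iteratedDerivWithin_eq_iteratedDeriv hopen.uniqueDiffOn
          (Real.contDiffAt_log.2 (hne x hx)) hx]
    rcases n with - | n
    · refine ⟨1 + |Real.log c|, by positivity, fun x hx => ?_⟩
      rw [key x hx, iteratedDeriv_zero, Real.norm_eq_abs]
      have hx0 : 0 < x := hc.trans hx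
      have h1 : Real.log x ≤ x := (Real.log_le_sub_one_of_pos hx0).trans (by linarith)
      have h2 : Real.log c ≤ Real.log x := Real.log_le_log hc (le_of_lt hx)
      have h3 : ‖x‖ = x := Real.norm_of_nonneg hx0.le
      rw [h3, pow_one]
      have h4 := neg_abs_le (Real.log c)
      have h5 := abs_nonneg (Real.log c)
      rw [abs_le]
      constructor <;> nlinarith [mul_nonneg h5 hx0.le]
    · refine ⟨n.factorial * c ^ (-1 - n : ℤ), by positivity, fun x hx => ?_⟩
      have hx0 : 0 < x := hc.trans hx
      rw [key x hx, iteratedDeriv_succ_log]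
      have h1 : x ^ (-1 - n : ℤ) ≤ c ^ (-1 - n : ℤ) := by
        have : (-1 - n : ℤ) = -((n + 1 : ℕ) : ℤ) := by push_cast; ring
        rw [this, zpow_neg, zpow_neg, zpow_natCast, zpow_natCast]
        have : c < x := hx
        gcongr
      have h2 : ‖(-1 : ℝ) ^ n * n.factorial * x ^ (-1 - n : ℤ)‖ = n.factorial * x ^ (-1 - n : ℤ) := by
        rw [norm_mul, norm_mul, norm_pow, norm_neg, norm_one, one_pow, one_mul,
          Real.norm_of_nonneg (by positivity : (0 : ℝ) ≤ x ^ (-1 - n : ℤ))]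
        simp
      rw [h2]
      calc _ ≤ n.factorial * c ^ (-1 - n : ℤ) * 1 := by rw [mul_one]; gcongr
        _ ≤ _ := by gcongr; simp
  choose C hC0 hC using hb
  refine ⟨1, ∑ n ∈ Finset.range (N + 1), C n, Finset.sum_nonneg fun n _ => hC0 n,
    fun n hn x hx => (hC n x hx).trans ?_⟩
  gcongr
  exact Finset.single_le_sum (fun i _ => hC0 i) (by simp; omega)

theorem smul_mem_schwartz {g : E → ℝ} (hg : g.HasTemperateGrowth) {φ : E → ℂ}
    (hφ : φ ∈ schwartz E) : (fun x => (g x : ℂ) * φ x) ∈ schwartz E := by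
  obtain ⟨φ, rfl⟩ := hφ
  refine ⟨SchwartzMap.smulLeftCLM ℂ g φ, ?_⟩
  ext x
  change SchwartzMap.smulLeftCLM ℂ g φ x = g x * φ x
  rw [SchwartzMap.smulLeftCLM_apply_apply hg, Complex.real_smul]

theorem mem_schwartz_of_hasCompactSupport {φ : E → ℂ} (h1 : HasCompactSupport φ)
    (h2 : ContDiff ℝ ∞ φ) : φ ∈ schwartz E :=
  ⟨h1.toSchwartzMap h2, rfl⟩

theorem norm_le_of_mem_schwartz {φ : E → ℂ} (hφ : φ ∈ schwartz E) (h0 : φ 0 = 0) :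
    ∃ C, ∀ x, ‖φ x‖ ≤ C * ‖x‖ := by
  obtain ⟨φ, rfl⟩ := hφ
  obtain ⟨C, -, hC⟩ := φ.decay 0 1
  refine ⟨C, fun x => ?_⟩
  have := convex_univ.norm_image_sub_le_of_norm_fderiv_le (f := φ) (𝕜 := ℝ) (C := C)
    (fun y _ => φ.differentiableAt) (fun y _ => ?_) (Set.mem_univ (0 : E)) (Set.mem_univ x)
  · simpa [h0] using this
  · have := hC y
    rwa [pow_zero, one_mul, norm_iteratedFDeriv_one] at this

/-- Adding to `‖x‖²` a bump supported where `φ` vanishes does not change the product, and keeps the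
argument of the logarithm away from `0`. -/
theorem log_norm_mul_mem_schwartz {E : Type*} [NormedAddCommGroup E] [InnerProductSpace ℝ E]
    [FiniteDimensional ℝ E] {φ : E → ℂ} (hφ : φ ∈ schwartz E) (h0 : φ =ᶠ[𝓝 0] 0) :
    (fun x => (Real.log (‖x‖ ^ 2) : ℂ) * φ x) ∈ schwartz E := by
  obtain ⟨r, hr, hr0⟩ := Metric.eventually_nhds_iff.1 h0
  let η : ContDiffBump (0 : E) := ⟨r / 4, r / 2, by positivity, by linarith⟩
  have hη : (fun x => η x).HasTemperateGrowth :=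
    η.hasCompactSupport.hasTemperateGrowth η.contDiff
  have hu : (fun x : E => ‖x‖ ^ 2 + η x).HasTemperateGrowth :=
    (Function.hasTemperateGrowth_norm_sq E).add hη
  -- The argument is at least `1` where the bump equals `1`, and exceeds `(r / 4) ^ 2` elsewhere;
  -- halving the minimum makes the bound strict.
  have hc : 0 < min 1 ((r / 4) ^ 2) / 2 := by positivity
  have h := hasTemperateGrowth_log_comp hu hc fun x => by
    rcases le_or_gt ‖x‖ (r / 4) with hx | hx
    · have h1 : η x = 1 := η.one_of_mem_closedBall (by simpa using hx)
      rw [h1]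
      have := min_le_left 1 ((r / 4) ^ 2)
      nlinarith [sq_nonneg ‖x‖]
    · have h1 : (r / 4) ^ 2 < ‖x‖ ^ 2 := by gcongr
      have := min_le_right 1 ((r / 4) ^ 2)
      nlinarith [η.nonneg (x := x), sq_nonneg (r / 4)]
  convert smul_mem_schwartz h hφ using 2 with x
  rcases lt_or_ge ‖x‖ r with hx | hx
  · rw [hr0 (by simpa using hx)]
    simp
  · have h1 : η x = 0 := η.zero_of_le_dist (by
      rw [dist_zero_right]
      change r / 2 ≤ _
      linarith)
    rw [h1, add_zero]

variable {F : Type*} [NontriviallyNormedField F] [ProperSpace F] [InnerProductSpace ℝ F]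
  [FiniteDimensional ℝ F] [MeasurableSpace F] [BorelSpace F] {ψ : AddChar F Circle}
  {μ : Measure F} [μ.IsAddHaarMeasure]

theorem isTestSpace_schwartz {d : ℕ} (hd : d ≠ 0) (hm : ∀ x : F, modulus x = ‖x‖ ^ d)
    (hψ : Continuous ψ) (hf : ∀ φ ∈ schwartz F, fourier ψ μ φ ∈ schwartz F)
    (hs : IsSelfDual ψ μ (schwartz F)) : IsTestSpace ψ μ (schwartz F) where
  continuous_char := hψ
  add_mem := by
    rintro _ ⟨φ, rfl⟩ _ ⟨θ, rfl⟩
    exact ⟨φ + θ, rfl⟩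
  smul_mem := by
    rintro c _ ⟨φ, rfl⟩
    exact ⟨c • φ, rfl⟩
  mul_mem := by
    rintro _ ⟨φ, rfl⟩ _ ⟨θ, rfl⟩
    exact ⟨SchwartzMap.pairing (ContinuousLinearMap.mul ℂ ℂ) φ θ, rfl⟩
  translate_mem := by
    rintro _ ⟨φ, rfl⟩ a
    refine ⟨SchwartzMap.compSubConstCLM ℂ (-a) φ, ?_⟩
    ext x
    change SchwartzMap.compSubConstCLM ℂ (-a) φ x = φ (a + x)
    rw [SchwartzMap.compSubConstCLM_apply, sub_neg_eq_add, add_comm]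
  fourier_mem := hf
  logMul_mem := fun φ hφ h0 => by
    have h1 := log_norm_mul_mem_schwartz hφ h0
    -- The factor `d / 2` appears because `log |x| = d log ‖x‖ = (d / 2) log ‖x‖²`.
    have h2 := smul_mem_schwartz (Function.HasTemperateGrowth.const ((d : ℝ) / 2)) h1
    convert h2 using 2 with x
    rw [logMul, hm, ← mul_assoc]
    congr 1
    rw [Real.log_pow, Real.log_pow]
    push_cast
    ring
  continuous := by
    rintro _ ⟨φ, rfl⟩
    exact φ.continuous
  decay := by
    rintro _ ⟨φ, rfl⟩
    obtain ⟨C, -, hC⟩ := φ.decay 0 0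
    obtain ⟨C', -, hC'⟩ := φ.decay (d * 2) 0
    refine ⟨max C C', fun x => ⟨le_max_of_le_left ?_, le_max_of_le_right ?_⟩⟩
    · simpa using hC x
    · rw [hm, ← pow_mul, mul_comm]
      simpa using hC' x
  vanish := fun φ hφ h0 => by
    obtain ⟨C, hC⟩ := norm_le_of_mem_schwartz hφ h0
    -- The Lipschitz bound `C ‖x‖` reads `C |x|^(1/d)` in terms of the modulus.
    refine ⟨(d : ℝ)⁻¹, by positivity, C, fun x => ?_⟩
    rw [hm, Real.pow_rpow_inv_natCast (norm_nonneg x) hd]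
    exact hC x
  selfDual := hs
  separating := fun f hf => by
    refine Lp.eq_zero_iff_ae_eq_zero.2 (ae_eq_zero_of_integral_contDiff_smul_eq_zero
      ((Lp.memLp f).locallyIntegrable (by norm_num)) fun g hg hg' => ?_)
    have h1 := hf (fun x => (g x : ℂ)) (mem_schwartz_of_hasCompactSupport
      (hg'.comp_left Complex.ofReal_zero) (Complex.ofRealCLM.contDiff.comp hg))
    rw [← h1]
    congr 1
    ext x
    rw [Complex.real_smul, mul_comm]
  bump := fun a U hU => by
    obtain ⟨r, hr, hrU⟩ := Metric.mem_nhds_iff.1 hU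
    let η : ContDiffBump a := ⟨r / 2, r, by positivity, by linarith⟩
    refine ⟨fun x => (η x : ℂ), mem_schwartz_of_hasCompactSupport
      (η.hasCompactSupport.comp_left Complex.ofReal_zero)
      (Complex.ofRealCLM.contDiff.comp η.contDiff),
      fun x => ⟨η x, η.nonneg, η.le_one, rfl⟩, ?_, ?_⟩
    · filter_upwards [η.eventuallyEq_one] with x hx
      rw [hx]
      simp
    · intro x hx
      refine hrU ?_
      rw [← show Function.support η = Metric.ball a r from η.support_eq]
      exact fun h => hx (by simp [h])

end SchwartzSpace

/-! ### The archimedean places -/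

section Archimedean

open FourierTransform
open scoped Pointwise

instance isAddHaarMeasure_complexMeasure : complexMeasure.IsAddHaarMeasure :=
  Measure.IsAddHaarMeasure.smul _ (by norm_num) (by norm_num)

/-- Multiplication by `x` and real scaling by `‖x‖` carry the unit ball to the same ball; compare
volumes. -/
theorem modulus_eq_norm_pow_finrank {F : Type*} [NontriviallyNormedField F] [ProperSpace F]
    [NormedSpace ℝ F] [FiniteDimensional ℝ F] [MeasurableSpace F] [BorelSpace F] (x : F) :
    modulus x = ‖x‖ ^ Module.finrank ℝ F := by
  rcases eq_or_ne x 0 with rfl | hx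
  · rw [modulus_zero, norm_zero, zero_pow Module.finrank_pos.ne']
  have h1 := measure_smul_set (Measure.addHaar : Measure F) hx (Metric.ball 0 1)
  have h2 : x • Metric.ball (0 : F) 1 = ‖x‖ • Metric.ball (0 : F) 1 := by
    rw [smul_unitBall hx, smul_unitBall (norm_ne_zero_iff.2 hx), norm_norm]
  rw [h2, Measure.addHaar_smul, ENNReal.mul_left_inj
    (Metric.measure_ball_pos _ _ one_pos).ne' measure_ball_lt_top.ne,
    abs_of_nonneg (by positivity), ENNReal.ofReal_eq_ofReal_iff (by positivity)
    (modulus_nonneg x)] at h1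
  exact h1.symm

theorem modulus_real (x : ℝ) : modulus x = |x| := by
  rw [modulus_eq_norm_pow_finrank, Module.finrank_self, pow_one, Real.norm_eq_abs]

theorem modulus_complex (x : ℂ) : modulus x = ‖x‖ ^ 2 := by
  rw [modulus_eq_norm_pow_finrank, Complex.finrank_real_complex]

theorem archChar_apply (F : Type*) [NormedField F] [NormedAlgebra ℝ F] (x : F) :
    archChar F x = Real.fourierChar (-(Algebra.trace ℝ F x)) := by
  change (Real.fourierChar⁻¹) _ = _
  rw [AddChar.inv_apply]
  rfl

theorem continuous_archChar (F : Type*) [NormedField F] [NormedAlgebra ℝ F]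
    [FiniteDimensional ℝ F] : Continuous (archChar F) := by
  have : (archChar F : F → Circle) = fun x => Real.fourierChar (-(Algebra.trace ℝ F x)) :=
    funext (archChar_apply F)
  rw [this]
  exact Real.continuous_fourierChar.comp
    (LinearMap.continuous_of_finiteDimensional (Algebra.trace ℝ F)).neg

theorem archChar_real_neg_mul (y x : ℝ) :
    archChar ℝ (-(y * x)) = Real.fourierChar (inner ℝ y x) := by
  rw [archChar_apply, Algebra.trace_self_apply, neg_neg]
  congr 1
  simp [mul_comm]

theorem archChar_complex_neg_mul (y x : ℂ) :
    archChar ℂ (-(y * x)) = Real.fourierChar (2 * (y * x).re) := by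
  rw [archChar_apply, Algebra.trace_complex_apply]
  congr 1
  simp
  ring

/-- The minus sign in the character and the one in the definition of the transform cancel, which
leaves the inverse Fourier transform. -/
theorem fourier_real_eq (φ : ℝ → ℂ) : fourier (archChar ℝ) volume φ = 𝓕⁻ φ := by
  ext x
  rw [fourier_apply, Real.fourierInv_eq]
  simp_rw [archChar_real_neg_mul]
  rfl

/-- The real-linear automorphism `x ↦ 2 x̄` of `ℂ`. -/
def twoConj : ℂ ≃L[ℝ] ℂ :=
  Complex.conjCLE.trans (ContinuousLinearEquiv.smulLeft (Units.mk0 (2 : ℝ) two_ne_zero))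

theorem twoConj_apply (x : ℂ) : twoConj x = 2 * (starRingEnd ℂ) x := by
  change (2 : ℝ) • (starRingEnd ℂ) x = _
  simp

/-- `Tr(y x) = 2 Re(y x)` is the real inner product of `y` with `2 x̄`; the outer factor `2` is the
normalisation of the measure. -/
theorem fourier_complex_eq (φ : ℂ → ℂ) (x : ℂ) :
    fourier (archChar ℂ) complexMeasure φ x = 2 * (𝓕⁻ φ) (twoConj x) := by
  rw [fourier_apply, Real.fourierInv_eq, integral_smul_measure]
  have h : ∀ y, archChar ℂ (-(y * x)) = Real.fourierChar (inner ℝ y (twoConj x)) := fun y => by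
    rw [archChar_complex_neg_mul, twoConj_apply, Complex.inner]
    congr 1
    simp
    ring
  simp_rw [h]
  simp
  rfl

theorem fourierInv_fourierInv {V : Type*} [NormedAddCommGroup V] [InnerProductSpace ℝ V]
    [FiniteDimensional ℝ V] [MeasurableSpace V] [BorelSpace V] (φ : 𝓢(V, ℂ)) (x : V) :
    (𝓕⁻ (𝓕⁻ (φ : V → ℂ))) x = φ (-x) := by
  rw [Real.fourierInv_eq_fourier_neg, ← SchwartzMap.fourierInv_coe, ← SchwartzMap.fourier_coe,
    fourier_fourierInv_eq]

theorem fourier_mem_schwartz_real {φ : ℝ → ℂ} (hφ : φ ∈ schwartz ℝ) :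
    fourier (archChar ℝ) volume φ ∈ schwartz ℝ := by
  obtain ⟨φ, rfl⟩ := hφ
  exact ⟨𝓕⁻ φ, by rw [fourier_real_eq]; exact SchwartzMap.fourierInv_coe φ⟩

theorem fourier_mem_schwartz_complex {φ : ℂ → ℂ} (hφ : φ ∈ schwartz ℂ) :
    fourier (archChar ℂ) complexMeasure φ ∈ schwartz ℂ := by
  obtain ⟨φ, rfl⟩ := hφ
  refine ⟨(2 : ℂ) • SchwartzMap.compCLMOfContinuousLinearEquiv ℂ twoConj (𝓕⁻ φ), ?_⟩
  ext x
  rw [fourier_complex_eq, ← SchwartzMap.fourierInv_coe]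
  rfl

theorem isSelfDual_real : IsSelfDual (archChar ℝ) volume (schwartz ℝ) := by
  rintro _ ⟨φ, rfl⟩ x
  rw [fourier_real_eq, fourier_real_eq]
  exact fourierInv_fourierInv φ x

theorem integral_comp_twoConj (g : ℂ → ℂ) : ∫ y, g (twoConj y) = 4⁻¹ * ∫ w, g w := by
  have h1 := Complex.conjLIE.measurePreserving.integral_comp'
    (f := Complex.conjLIE.toHomeomorph.toMeasurableEquiv) (fun w => g ((2 : ℝ) • w))
  have h2 := Measure.integral_comp_smul volume g (2 : ℝ)
  rw [h2, Complex.finrank_real_complex] at h1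
  refine Eq.trans ?_ (h1.trans ?_)
  · rfl
  · rw [Complex.real_smul]
    congr 1
    rw [abs_of_pos (by norm_num)]
    norm_num

/-- The measure contributes a factor `2` for each of the two transforms, and their product cancels
the Jacobian `1/4` of `x ↦ 2 x̄`. -/
theorem isSelfDual_complex : IsSelfDual (archChar ℂ) complexMeasure (schwartz ℂ) := by
  rintro _ ⟨φ, rfl⟩ x
  change _ = φ (-x)
  rw [← fourierInv_fourierInv φ x, Real.fourierInv_eq, fourier_apply, integral_smul_measure]
  have h := integral_comp_twoConj
    (fun w => Real.fourierChar (inner ℝ w x) • (𝓕⁻ (φ : ℂ → ℂ)) w)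
  have h2 : ∀ y, (archChar ℂ (-(y * x)) : ℂ) * fourier (archChar ℂ) complexMeasure φ y =
      2 * Real.fourierChar (inner ℝ (twoConj y) x) • (𝓕⁻ (φ : ℂ → ℂ)) (twoConj y) := fun y => by
    have h3 : inner ℝ (twoConj y) x = 2 * (y * x).re := by
      rw [twoConj_apply, Complex.inner]
      simp
      ring
    rw [archChar_complex_neg_mul, fourier_complex_eq, h3, Circle.smul_def, smul_eq_mul]
    ring
  simp_rw [h2, integral_const_mul, h]
  simp
  ring

theorem isTestSpace_real : IsTestSpace (archChar ℝ) volume (schwartz ℝ) :=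
  isTestSpace_schwartz one_ne_zero (fun x => by rw [modulus_real, pow_one, Real.norm_eq_abs])
    (continuous_archChar ℝ) (fun _ => fourier_mem_schwartz_real) isSelfDual_real

theorem isTestSpace_complex : IsTestSpace (archChar ℂ) complexMeasure (schwartz ℂ) :=
  isTestSpace_schwartz two_ne_zero modulus_complex
    (continuous_archChar ℂ) (fun _ => fourier_mem_schwartz_complex) isSelfDual_complex

end Archimedean

/-! ### Gamma factors computed with Gaussians -/

section Gaussian

/-- Polar coordinates, then `u = r²`, lead to Euler's integral. -/
theorem integral_norm_cpow_mul_exp {E : Type*} [NormedAddCommGroup E] [NormedSpace ℝ E]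
    [FiniteDimensional ℝ E] [Nontrivial E] [MeasurableSpace E] [BorelSpace E] (μ : Measure E)
    [μ.IsAddHaarMeasure] {b : ℝ} (hb : 0 < b) {w : ℂ} (hw : 0 < (w + Module.finrank ℝ E).re) :
    ∫ x, (‖x‖ : ℂ) ^ w * Complex.exp (-(b * ‖x‖ ^ 2)) ∂μ =
      (Module.finrank ℝ E * μ.real (Metric.ball 0 1) / 2 : ℝ) *
        ((1 / b : ℂ) ^ ((w + Module.finrank ℝ E) / 2) *
          Complex.Gamma ((w + Module.finrank ℝ E) / 2)) := by
  have hd : 0 < Module.finrank ℝ E := Module.finrank_pos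
  set d := Module.finrank ℝ E
  rw [integral_fun_norm_addHaar μ (fun r : ℝ => (r : ℂ) ^ w * Complex.exp (-(b * (r : ℂ) ^ 2)))]
  have h1 : ∫ y in Set.Ioi (0 : ℝ), y ^ (d - 1) •
        ((y : ℂ) ^ w * Complex.exp (-(b * (y : ℂ) ^ 2))) =
      mellin (fun t : ℝ => (fun u : ℝ => Complex.exp (-(b * (u : ℂ)))) (t ^ (2 : ℝ))) (w + d) := by
    refine setIntegral_congr_fun measurableSet_Ioi fun y hy => ?_
    have hy0 : (y : ℂ) ≠ 0 := Complex.ofReal_ne_zero.2 (ne_of_gt hy)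
    have h2 : (y : ℂ) ^ (w + d - 1) = (y : ℂ) ^ w * (y : ℂ) ^ (d - 1) := by
      rw [← Complex.cpow_natCast, ← Complex.cpow_add _ _ hy0]
      congr 1
      push_cast [hd]
      ring
    simp only [Complex.real_smul, smul_eq_mul, Complex.ofReal_pow, h2, Real.rpow_two]
    ring
  rw [h1, mellin_comp_rpow (fun u : ℝ => Complex.exp (-(b * (u : ℂ)))) (w + d) 2]
  have h3 := Complex.integral_cpow_mul_exp_neg_mul_Ioi (a := (w + d) / 2) (r := b)
    (by
      have : ((w + d) / 2).re = (w + d).re / 2 := by simp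
      rw [this]
      positivity) (by simpa using hb)
  have h4 : mellin (fun u : ℝ => Complex.exp (-(b * (u : ℂ)))) ((w + d) / (2 : ℝ)) =
      (1 / b : ℂ) ^ ((w + d) / 2) * Complex.Gamma ((w + d) / 2) := by
    rw [← h3]
    simp only [mellin, smul_eq_mul, Complex.ofReal_ofNat]
  rw [h4]
  simp only [nsmul_eq_mul, Complex.real_smul, abs_two]
  push_cast
  ring

variable {F : Type*} [NontriviallyNormedField F] [ProperSpace F] [InnerProductSpace ℝ F]
  [FiniteDimensional ℝ F] [MeasurableSpace F] [BorelSpace F] {ψ : AddChar F Circle}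
  {μ : Measure F} [μ.IsAddHaarMeasure] {S : Set (F → ℂ)}

theorem integral_quasiChar_mul_gaussian {b : ℝ} (hb : 0 < b) (m : ℕ) (χ : Fˣ →ₜ* Circle) {z : ℂ}
    (hz : 0 < z.re) {ρ : F → ℂ} (c : ℂ) (hρ : ∀ x, x ≠ 0 → ρ x = c * (quasiChar χ⁻¹ 0 x *
      (‖x‖ ^ m * Complex.exp (-(b * ‖x‖ ^ 2))))) :
    ∫ x, ρ x * quasiChar χ (z - 1) x ∂μ = c *
      ((Module.finrank ℝ F * μ.real (Metric.ball 0 1) / 2 : ℝ) *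
        ((1 / b : ℂ) ^ ((m + Module.finrank ℝ F * z) / 2) *
          Complex.Gamma ((m + Module.finrank ℝ F * z) / 2))) := by
  have hd : (0 : ℝ) < Module.finrank ℝ F := by exact_mod_cast Module.finrank_pos (R := ℝ) (M := F)
  have h1 := integral_norm_cpow_mul_exp μ hb
    (w := m + Module.finrank ℝ F * (z - 1)) (by
      have : (m + Module.finrank ℝ F * (z - 1) + Module.finrank ℝ F : ℂ) =
        m + Module.finrank ℝ F * z := by ring
      rw [this]
      simp
      positivity)
  have h2 : (m + Module.finrank ℝ F * (z - 1) + Module.finrank ℝ F : ℂ) =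
    m + Module.finrank ℝ F * z := by ring
  rw [h2] at h1
  rw [← h1, ← integral_const_mul]
  refine integral_congr_ae ((ae_ne_zero μ).mono fun x hx => ?_)
  have hx0 : (‖x‖ : ℂ) ≠ 0 := Complex.ofReal_ne_zero.2 (norm_ne_zero_iff.2 hx)
  have h3 : quasiChar χ (z - 1) x =
      quasiChar χ 0 x * (‖x‖ : ℂ) ^ (Module.finrank ℝ F * (z - 1)) := by
    have := quasiChar_mul_cpow χ 0 (z - 1) hx
    rw [zero_add] at this
    have harg := Complex.arg_ofReal_of_nonneg (norm_nonneg x)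
    rw [← this, modulus_eq_norm_pow_finrank, Complex.cpow_nat_mul', Complex.ofReal_pow]
    · rw [harg, mul_zero]
      exact neg_lt_zero.2 Real.pi_pos
    · rw [harg, mul_zero]
      exact Real.pi_pos.le
  have h4 := quasiChar_mul_inv χ 0 hx
  rw [neg_zero] at h4
  simp only
  rw [hρ x hx, h3, Complex.cpow_add _ _ hx0, Complex.cpow_natCast]
  linear_combination (c * ‖x‖ ^ m * Complex.exp (-(b * ‖x‖ ^ 2)) *
    (‖x‖ : ℂ) ^ (Module.finrank ℝ F * (z - 1))) * h4

theorem differentiableAt_Gamma_of_re_pos {z : ℂ} (hz : 0 < z.re) :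
    DifferentiableAt ℂ Complex.Gamma z :=
  Complex.differentiableAt_Gamma z fun m hm => by
    rw [hm, Complex.neg_re, Complex.natCast_re] at hz
    linarith [Nat.cast_nonneg (α := ℝ) m]

theorem differentiableAt_digamma {z : ℂ} (hz : 0 < z.re) :
    DifferentiableAt ℂ Complex.digamma z := by
  have hopen : IsOpen {z : ℂ | 0 < z.re} := isOpen_lt continuous_const Complex.continuous_re
  have hG : DifferentiableOn ℂ Complex.Gamma {z : ℂ | 0 < z.re} := fun w hw =>
    (differentiableAt_Gamma_of_re_pos hw).differentiableWithinAt
  have := (hG.deriv hopen).div hG fun w hw => Complex.Gamma_ne_zero_of_re_pos hw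
  exact this.differentiableAt (hopen.mem_nhds hz)

namespace IsTestSpace

variable (h : IsTestSpace ψ μ S)
include h

/-- When the transform of a Gaussian with angular part `χ` is a multiple of the one with `χ⁻¹`, both
Mellin integrals become radial Euler integrals, and the volume of the unit ball cancels in the
quotient. -/
theorem gammaFactor_of_gaussian {χ : Fˣ →ₜ* Circle} {b : ℝ} (hb : 0 < b) (m : ℕ) {ρ : F → ℂ}
    (hρS : ρ ∈ S)
    (hρ : ∀ x, x ≠ 0 → ρ x = quasiChar χ 0 x * (‖x‖ ^ m * Complex.exp (-(b * ‖x‖ ^ 2)))) {k : ℂ}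
    (hf : ∀ x, x ≠ 0 → fourier ψ μ ρ x =
      k * (quasiChar χ⁻¹ 0 x * (‖x‖ ^ m * Complex.exp (-(b * ‖x‖ ^ 2)))))
    {s : ℂ} (h0 : 0 < s.re) (h1 : s.re < 1) :
    gammaFactor ψ μ S χ s = k * (1 / b : ℂ) ^ (Module.finrank ℝ F * s - Module.finrank ℝ F / 2) *
      (Complex.Gamma ((m + Module.finrank ℝ F * s) / 2) /
        Complex.Gamma ((m + Module.finrank ℝ F * (1 - s)) / 2)) := by
  have hb0 : (1 / b : ℂ) ≠ 0 := one_div_ne_zero (Complex.ofReal_ne_zero.2 hb.ne')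
  have hd : (0 : ℝ) < Module.finrank ℝ F := by exact_mod_cast Module.finrank_pos (R := ℝ) (M := F)
  have h1s : 0 < (1 - s).re := by simpa using h1
  have hnum := integral_quasiChar_mul_gaussian (μ := μ) hb m χ h0 k hf
  have hden := integral_quasiChar_mul_gaussian (μ := μ) hb m χ⁻¹ h1s (ρ := ρ) 1
    (fun x hx => by rw [inv_inv, one_mul, hρ x hx])
  have hs : 1 - s - 1 = -s := by ring
  rw [hs, one_mul] at hden
  set C : ℝ := Module.finrank ℝ F * μ.real (Metric.ball 0 1) / 2
  have hC : (C : ℂ) ≠ 0 := by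
    have : 0 < μ.real (Metric.ball (0 : F) 1) :=
      ENNReal.toReal_pos (Metric.measure_ball_pos _ _ one_pos).ne' measure_ball_lt_top.ne
    exact Complex.ofReal_ne_zero.2 (by positivity)
  have hre : 0 < ((m + Module.finrank ℝ F * (1 - s)) / 2 : ℂ).re := by
    have : ((m + Module.finrank ℝ F * (1 - s)) / 2 : ℂ).re =
      (m + Module.finrank ℝ F * (1 - s).re) / 2 := by simp
    rw [this]
    positivity
  have hG := Complex.Gamma_ne_zero_of_re_pos hre
  have hcp : ∀ z : ℂ, (1 / b : ℂ) ^ z ≠ 0 := fun z => by simp [Complex.cpow_eq_zero_iff, hb.ne']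
  rw [h.gammaFactor_eq χ h0 h1 hρS (by
    rw [hden]
    exact mul_ne_zero hC (mul_ne_zero (hcp _) hG)), hnum, hden]
  have he : (1 / b : ℂ) ^ ((m + Module.finrank ℝ F * s) / 2) =
      (1 / b : ℂ) ^ (Module.finrank ℝ F * s - Module.finrank ℝ F / 2) *
        (1 / b : ℂ) ^ ((m + Module.finrank ℝ F * (1 - s)) / 2) := by
    rw [← Complex.cpow_add _ _ hb0]
    congr 1
    ring
  rw [he]
  have := hcp ((m + Module.finrank ℝ F * (1 - s)) / 2)
  generalize (1 / b : ℂ) ^ ((m + Module.finrank ℝ F * (1 - s)) / 2) = u at *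
  field_simp

/-- The constant and the exponential factor of `Γ(χ, s)` add only a constant to its logarithmic
derivative. The factor `d² / 4` comes from applying the chain rule twice with slope `±d / 2`. -/
theorem spectralK_of_gaussian {χ : Fˣ →ₜ* Circle} {b : ℝ} (hb : 0 < b) (m : ℕ) {ρ : F → ℂ}
    (hρS : ρ ∈ S)
    (hρ : ∀ x, x ≠ 0 → ρ x = quasiChar χ 0 x * (‖x‖ ^ m * Complex.exp (-(b * ‖x‖ ^ 2)))) {k : ℂ}
    (hf : ∀ x, x ≠ 0 → fourier ψ μ ρ x =
      k * (quasiChar χ⁻¹ 0 x * (‖x‖ ^ m * Complex.exp (-(b * ‖x‖ ^ 2)))))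
    {s : ℂ} (h0 : 0 < s.re) (h1 : s.re < 1) :
    spectralK ψ μ S χ s = -Complex.I * ((Module.finrank ℝ F : ℂ) ^ 2 / 4 *
      (deriv Complex.digamma ((m + Module.finrank ℝ F * s) / 2) -
        deriv Complex.digamma ((m + Module.finrank ℝ F * (1 - s)) / 2))) := by
  have hd : (0 : ℝ) < Module.finrank ℝ F := by exact_mod_cast Module.finrank_pos (R := ℝ) (M := F)
  have hb0 : (1 / b : ℂ) ≠ 0 := one_div_ne_zero (Complex.ofReal_ne_zero.2 hb.ne')
  have hcp : ∀ z : ℂ, (1 / b : ℂ) ^ z ≠ 0 := fun z => by simp [Complex.cpow_eq_zero_iff, hb.ne']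
  have hG := fun (t : ℂ) (ht0 : 0 < t.re) (ht1 : t.re < 1) =>
    h.gammaFactor_of_gaussian hb m hρS hρ hf ht0 ht1
  have hk : k ≠ 0 := fun hk => h.gammaFactor_ne_zero χ h0 h1 (by rw [hG s h0 h1, hk]; simp)
  set d : ℂ := ((Module.finrank ℝ F : ℕ) : ℂ) with hd'
  have hre : ∀ z : ℂ, 0 < z.re → 0 < ((m + d * z) / 2).re := fun z hz => by
    have : ((m + d * z) / 2 : ℂ).re = (m + Module.finrank ℝ F * z.re) / 2 := by simp [hd']
    rw [this]
    positivity
  have hp : ∀ t : ℂ, HasDerivAt (fun t : ℂ => (m + d * t) / 2) (d / 2) t := fun t =>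
    ((((hasDerivAt_id t).const_mul d).const_add (m : ℂ)).div_const 2).congr_deriv (by ring)
  have hq : ∀ t : ℂ, HasDerivAt (fun t : ℂ => (m + d * (1 - t)) / 2) (-(d / 2)) t := fun t =>
    (((((hasDerivAt_id t).const_sub 1).const_mul d).const_add (m : ℂ)).div_const 2).congr_deriv
      (by ring)
  have he : ∀ t : ℂ, HasDerivAt (fun t : ℂ => k * (1 / b : ℂ) ^ (d * t - d / 2))
      (k * ((1 / b : ℂ) ^ (d * t - d / 2) * Complex.log (1 / b) * d)) t := fun t =>
    ((((((hasDerivAt_id t).const_mul d).sub_const (d / 2)).const_cpow (.inl hb0)).const_mul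
      k)).congr_deriv (by simp)
  have hlog : ∀ t : ℂ, 0 < t.re → t.re < 1 → logDeriv (gammaFactor ψ μ S χ) t =
      Complex.log (1 / b) * d + (d / 2 * Complex.digamma ((m + d * t) / 2) +
        d / 2 * Complex.digamma ((m + d * (1 - t)) / 2)) := by
    intro t ht0 ht1
    have ht1' : 0 < (1 - t).re := by simpa using ht1
    have hev : gammaFactor ψ μ S χ =ᶠ[𝓝 t] fun t => k * (1 / b : ℂ) ^ (d * t - d / 2) *
        (Complex.Gamma ((m + d * t) / 2) / Complex.Gamma ((m + d * (1 - t)) / 2)) := by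
      filter_upwards [isOpen_strip.mem_nhds ⟨ht0, ht1⟩] with z hz using hG z hz.1 hz.2
    have hA := differentiableAt_Gamma_of_re_pos (hre t ht0)
    have hB := differentiableAt_Gamma_of_re_pos (hre _ ht1')
    have hA0 := Complex.Gamma_ne_zero_of_re_pos (hre t ht0)
    have hB0 := Complex.Gamma_ne_zero_of_re_pos (hre _ ht1')
    have hAd := hA.hasDerivAt.comp t (hp t)
    have hBd := hB.hasDerivAt.comp t (hq t)
    have hder := (he t).mul (hAd.div hBd hB0)
    rw [logDeriv_apply, hev.deriv_eq, hev.eq_of_nhds, Complex.digamma_def, logDeriv_apply,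
      logDeriv_apply]
    have hder' : deriv (fun t => k * (1 / b : ℂ) ^ (d * t - d / 2) *
        (Complex.Gamma ((m + d * t) / 2) / Complex.Gamma ((m + d * (1 - t)) / 2))) t = _ :=
      hder.deriv
    rw [hder']
    simp only [Function.comp_apply, Pi.div_apply]
    have hE := hcp (d * t - d / 2)
    generalize (1 / b : ℂ) ^ (d * t - d / 2) = E at *
    generalize Complex.Gamma ((m + d * t) / 2) = A at *
    generalize Complex.Gamma ((m + d * (1 - t)) / 2) = B at *
    field_simp
    ring
  have hs1 : 0 < (1 - s).re := by simpa using h1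
  have hev : logDeriv (gammaFactor ψ μ S χ) =ᶠ[𝓝 s] fun t => Complex.log (1 / b) * d +
      (d / 2 * Complex.digamma ((m + d * t) / 2) +
        d / 2 * Complex.digamma ((m + d * (1 - t)) / 2)) := by
    filter_upwards [isOpen_strip.mem_nhds ⟨h0, h1⟩] with z hz using hlog z hz.1 hz.2
  have hA := (differentiableAt_digamma (hre s h0)).hasDerivAt.comp s (hp s)
  have hB := (differentiableAt_digamma (hre _ hs1)).hasDerivAt.comp s (hq s)
  have hder : deriv (fun t => Complex.log (1 / b) * d +
      (d / 2 * Complex.digamma ((m + d * t) / 2) +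
        d / 2 * Complex.digamma ((m + d * (1 - t)) / 2))) s = _ :=
    (((hA.const_mul (d / 2)).add (hB.const_mul (d / 2))).const_add _).deriv
  rw [spectralK, hev.deriv_eq, hder]
  ring

end IsTestSpace

end Gaussian

/-! ### The series of the trigamma function -/

section Trigamma

theorem differentiableAt_log_Gamma {x : ℝ} (hx : 0 < x) :
    DifferentiableAt ℝ (Real.log ∘ Real.Gamma) x :=
  (Real.differentiableOn_Gamma_Ioi.differentiableAt (Ioi_mem_nhds hx)).log
    (Real.Gamma_pos_of_pos hx).ne'

theorem digamma_ofReal {x : ℝ} (hx : 0 < x) :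
    Complex.digamma x = (deriv (Real.log ∘ Real.Gamma) x : ℝ) := by
  have h1 := Real.differentiableOn_Gamma_Ioi.differentiableAt (Ioi_mem_nhds hx)
  have hx' : 0 < (x : ℂ).re := by simpa using hx
  have h2 := (differentiableAt_Gamma_of_re_pos hx').hasDerivAt.comp_ofReal
  have h3 := h1.hasDerivAt.ofReal_comp
  simp_rw [Complex.Gamma_ofReal] at h2
  have h4 := h2.unique h3
  have h5 : deriv (Real.log ∘ Real.Gamma) x = deriv Real.Gamma x / Real.Gamma x :=
    deriv.log h1 (Real.Gamma_pos_of_pos hx).ne'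
  rw [h5, Complex.digamma_def, logDeriv_apply, Complex.Gamma_ofReal, h4]
  push_cast
  rfl

theorem digamma_add_nat {z : ℂ} (hz : 0 < z.re) (n : ℕ) :
    Complex.digamma (z + n) = Complex.digamma z + ∑ j ∈ Finset.range n, 1 / (z + j) := by
  induction n with
  | zero => simp
  | succ n ih =>
    rw [Finset.sum_range_succ, ← add_assoc, ← ih, Nat.cast_succ, ← add_assoc,
      Complex.digamma_apply_add_one _ fun m hm => ?_, one_div]
    have := congrArg Complex.re hm
    simp only [Complex.add_re, Complex.natCast_re, Complex.neg_re] at this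
    linarith [Nat.cast_nonneg (α := ℝ) m, Nat.cast_nonneg (α := ℝ) n]

/-- Log-convexity of `Γ` makes the digamma function monotone on the positive reals. Both terms lie
between its values at `n` and `n + M`, which differ by at most `M / n` by the recurrence. -/
theorem tendsto_digamma_sub_digamma {x : ℝ} (hx : 0 < x) :
    Tendsto (fun n : ℕ => Complex.digamma (1 + n) - Complex.digamma (x + n)) atTop (𝓝 0) := by
  obtain ⟨M, hM⟩ := exists_nat_ge (max x 1)
  have hmono := Real.convexOn_log_Gamma.monotoneOn_deriv fun y hy => differentiableAt_log_Gamma hy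
  set g := deriv (Real.log ∘ Real.Gamma)
  have hgn : ∀ n : ℕ, 1 ≤ n → g (n + M) ≤ g n + M * (1 / n) := by
    intro n hn
    have hn0 : (0 : ℝ) < n := by exact_mod_cast hn
    have h1 := digamma_add_nat (z := ((n : ℝ) : ℂ)) (by simpa using hn0) M
    rw [← Complex.ofReal_natCast M, ← Complex.ofReal_add, digamma_ofReal (by positivity),
      digamma_ofReal hn0] at h1
    have h2 : g (n + M) = g n + ∑ j ∈ Finset.range M, 1 / ((n : ℝ) + j) := by
      exact_mod_cast h1
    rw [h2]
    gcongr
    calc ∑ j ∈ Finset.range M, 1 / ((n : ℝ) + j) ≤ ∑ j ∈ Finset.range M, 1 / (n : ℝ) := by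
          gcongr
          simp
      _ = M * (1 / n) := by simp
  have hb : ∀ y : ℝ, 0 < y → y ≤ M → ∀ n : ℕ, 1 ≤ n →
      g n ≤ g (y + n) ∧ g (y + n) ≤ g n + M * (1 / n) := by
    intro y hy hyM n hn
    have hn0 : (0 : ℝ) < n := by exact_mod_cast hn
    have hyn : 0 < y + n := by positivity
    refine ⟨hmono hn0 hyn (by linarith), (hmono hyn ?_ (by linarith)).trans (hgn n hn)⟩
    exact Set.mem_Ioi.2 (by positivity)
  have hlim : Tendsto (fun n : ℕ => (M : ℝ) * (1 / n)) atTop (𝓝 0) := by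
    simpa using tendsto_one_div_atTop_nhds_zero_nat.const_mul (M : ℝ)
  refine squeeze_zero_norm' ?_ hlim
  filter_upwards [eventually_ge_atTop 1] with n hn
  have h1 := hb 1 one_pos ((le_max_right _ _).trans hM) n hn
  have h2 := hb x hx ((le_max_left _ _).trans hM) n hn
  have h3 : Complex.digamma (1 + n) = g (1 + n) := by
    rw [← digamma_ofReal (by positivity)]
    push_cast
    rfl
  have h4 : Complex.digamma (x + n) = g (x + n) := by
    rw [← digamma_ofReal (by positivity)]
    push_cast
    rfl
  rw [h3, h4, ← Complex.ofReal_sub, Complex.norm_real, Real.norm_eq_abs, abs_le]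
  constructor <;> linarith [h1.1, h1.2, h2.1, h2.2]

theorem norm_one_div_sub_one_div_le {ε R : ℝ} (hε : 0 < ε) (hε1 : ε ≤ 1) {z : ℂ} (hz : ε < z.re)
    (hR : ‖z‖ < R) (j : ℕ) :
    ‖1 / ((1 : ℂ) + j) - 1 / (z + j)‖ ≤ (R + 1) / ε * (1 / ((j + 1 : ℕ) : ℝ) ^ 2) := by
  have h1 : ((1 : ℂ) + j) ≠ 0 := by
    rw [add_comm]
    exact Nat.cast_add_one_ne_zero j
  have h2 : ε * (j + 1) ≤ ‖z + j‖ := by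
    refine le_trans ?_ (Complex.re_le_norm _)
    simp only [Complex.add_re, Complex.natCast_re]
    nlinarith [Nat.cast_nonneg (α := ℝ) j]
  have h3 : 0 < ‖z + j‖ := lt_of_lt_of_le (by positivity) h2
  have h4 : z + j ≠ 0 := norm_pos_iff.1 h3
  have h5 : 1 / ((1 : ℂ) + j) - 1 / (z + j) = (z - 1) / ((1 + j) * (z + j)) := by
    field_simp
    ring
  have h6 : ‖(1 : ℂ) + j‖ = j + 1 := by
    rw [add_comm]
    exact_mod_cast Complex.norm_natCast (j + 1)
  have h7 : ‖z - 1‖ ≤ R + 1 := (norm_sub_le _ _).trans (by rw [norm_one]; linarith)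
  have hR0 : 0 ≤ R + 1 := by linarith [norm_nonneg z]
  rw [h5, norm_div, norm_mul, h6]
  calc ‖z - 1‖ / ((j + 1) * ‖z + j‖) ≤ (R + 1) / ((j + 1) * (ε * (j + 1))) := by gcongr
    _ = _ := by
      push_cast
      field_simp

/-- The partial fraction series of the digamma function holds at positive reals, by the recurrence
and the vanishing of the remainder. The identity theorem extends it to complex arguments, and it is
then differentiated term by term. -/
theorem hasSum_deriv_digamma {z : ℂ} (hz : 0 < z.re) :
    HasSum (fun j : ℕ => 1 / (z + j) ^ 2) (deriv Complex.digamma z) := by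
  obtain ⟨ε, hε, hε1, hεz⟩ : ∃ ε > 0, ε < 1 ∧ ε < z.re :=
    ⟨min 1 z.re / 2, by positivity, by linarith [min_le_left 1 z.re, (by positivity : 0 < min 1 z.re)],
      by linarith [min_le_right 1 z.re, (by positivity : 0 < min 1 z.re)]⟩
  obtain ⟨R, hR1, hRz⟩ : ∃ R > 1, ‖z‖ < R := ⟨‖z‖ + 2, by linarith [norm_nonneg z], by linarith⟩
  -- A convex region containing `1` and `z`, bounded and away from the imaginary axis, on which the
  -- terms are uniformly `O(1 / (j + 1)²)`.
  let U : Set ℂ := {w | ε < w.re} ∩ Metric.ball 0 R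
  have hUo : IsOpen U := (isOpen_lt continuous_const Complex.continuous_re).inter Metric.isOpen_ball
  have hUc : IsPreconnected U :=
    ((convex_halfSpace_re_gt ε).inter (convex_ball 0 R)).isPreconnected
  have hzU : z ∈ U := ⟨hεz, by simpa using hRz⟩
  have h1U : (1 : ℂ) ∈ U := ⟨by simpa using hε1, by simpa using hR1⟩
  have hpos : ∀ w ∈ U, 0 < w.re := fun w hw => hε.trans hw.1
  have hne : ∀ w ∈ U, ∀ j : ℕ, w + j ≠ 0 := fun w hw j hj => by
    have h1 := congrArg Complex.re hj
    simp only [Complex.add_re, Complex.natCast_re, Complex.zero_re] at h1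
    linarith [hpos w hw, Nat.cast_nonneg (α := ℝ) j]
  let f : ℕ → ℂ → ℂ := fun j w => 1 / (1 + j) - 1 / (w + j)
  have hder : ∀ j, ∀ w ∈ U, HasDerivAt (f j) (1 / (w + j) ^ 2) w := fun j w hw => by
    have := (((hasDerivAt_id w).add_const (j : ℂ)).inv (hne w hw j)).const_sub (1 / (1 + (j : ℂ)))
    simp only [← one_div] at this
    exact this.congr_deriv (by simp [neg_div])
  have hf : ∀ j, DifferentiableOn ℂ (f j) U := fun j w hw =>
    (hder j w hw).differentiableAt.differentiableWithinAt
  have hsum : Summable fun j : ℕ => (R + 1) / ε * (1 / ((j + 1 : ℕ) : ℝ) ^ 2) :=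
    (((summable_nat_add_iff 1).2 (Real.summable_one_div_nat_pow.2 one_lt_two))).mul_left _
  have hbd : ∀ j, ∀ w ∈ U, ‖f j w‖ ≤ (R + 1) / ε * (1 / ((j + 1 : ℕ) : ℝ) ^ 2) := fun j w hw =>
    norm_one_div_sub_one_div_le hε hε1.le hw.1 (by simpa using hw.2) j
  have hreal : ∀ x : ℝ, (x : ℂ) ∈ U →
      Complex.digamma x = Complex.digamma 1 + ∑' j, f j x := by
    intro x hx
    have hx0 : 0 < x := by simpa using hpos _ hx
    have h1 : HasSum (fun j => f j x) (∑' j, f j x) :=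
      (Summable.of_norm_bounded hsum fun j => hbd j _ hx).hasSum
    have h2 := h1.tendsto_sum_nat
    have h3 : ∀ n : ℕ, ∑ j ∈ Finset.range n, f j x = Complex.digamma (1 + n) -
        Complex.digamma (x + n) + (Complex.digamma x - Complex.digamma 1) := fun n => by
      rw [digamma_add_nat (by simp), digamma_add_nat (by simpa using hx0), Finset.sum_sub_distrib]
      ring
    simp_rw [h3] at h2
    have h4 := tendsto_nhds_unique h2 ((tendsto_digamma_sub_digamma hx0).add_const _)
    rw [h4]
    ring
  have hdig : DifferentiableOn ℂ Complex.digamma U := fun w hw =>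
    (differentiableAt_digamma (hpos w hw)).differentiableWithinAt
  have hser : DifferentiableOn ℂ (fun w => Complex.digamma 1 + ∑' j, f j w) U :=
    (Complex.differentiableOn_tsum_of_summable_norm hsum hf hUo hbd).const_add _
  have hfreq : ∃ᶠ w in 𝓝[≠] (1 : ℂ), Complex.digamma w = Complex.digamma 1 + ∑' j, f j w := by
    have h1 : Tendsto (fun x : ℝ => (x : ℂ)) (𝓝[≠] 1) (𝓝[≠] (1 : ℂ)) := by
      refine tendsto_nhdsWithin_iff.2 ⟨?_, ?_⟩
      · exact (Complex.continuous_ofReal.tendsto' 1 1 (by simp)).mono_left nhdsWithin_le_nhds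
      · filter_upwards [self_mem_nhdsWithin] with x hx
        simpa using hx
    refine h1.frequently (Eventually.frequently ?_)
    have h2 := h1.eventually (mem_nhdsWithin_of_mem_nhds (hUo.mem_nhds h1U))
    filter_upwards [h2] with x hx using hreal x hx
  have heq := (hdig.analyticOnNhd hUo).eqOn_of_preconnected_of_frequently_eq
    (hser.analyticOnNhd hUo) hUc h1U hfreq
  have h1 := Complex.hasSum_deriv_of_summable_norm hsum hf hUo hbd hzU
  rw [(heq.eventuallyEq_of_mem (hUo.mem_nhds hzU)).deriv_eq, deriv_const_add]
  simpa only [(hder _ z hzU).deriv] using h1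

theorem hasSum_deriv_digamma_sub {a : ℝ} (ha : 0 < a) (τ : ℝ) :
    HasSum (fun j : ℕ => ((-(4 * (a + j) * τ / ((a + j) ^ 2 + τ ^ 2) ^ 2) : ℝ) : ℂ))
      (-Complex.I * (deriv Complex.digamma (a + τ * Complex.I) -
        deriv Complex.digamma (a - τ * Complex.I))) := by
  have h1 := hasSum_deriv_digamma (z := a + τ * Complex.I) (by simpa using ha)
  have h2 := hasSum_deriv_digamma (z := a - τ * Complex.I) (by simpa using ha)
  have key : ∀ j : ℕ, ((-(4 * (a + j) * τ / ((a + j) ^ 2 + τ ^ 2) ^ 2) : ℝ) : ℂ) =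
      -Complex.I * (1 / (a + τ * Complex.I + j) ^ 2 - 1 / (a - τ * Complex.I + j) ^ 2) := fun j => ?_
  · rw [funext key]
    exact (h1.sub h2).mul_left (-Complex.I)
  have hj : 0 < a + j := by positivity
  have hp : (a + τ * Complex.I + j : ℂ) ≠ 0 := fun hc => by
    have := congrArg Complex.re hc
    simp at this
    linarith
  have hq : (a - τ * Complex.I + j : ℂ) ≠ 0 := fun hc => by
    have := congrArg Complex.re hc
    simp at this
    linarith
  have hpq : ((a + j) ^ 2 + τ ^ 2 : ℂ) = (a + τ * Complex.I + j) * (a - τ * Complex.I + j) := by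
    linear_combination (τ : ℂ) ^ 2 * Complex.I_sq
  push_cast
  rw [hpq]
  field_simp
  linear_combination (-4 * (τ : ℂ) * (a + j)) * Complex.I_sq

end Trigamma

/-! ### Fourier transforms of Gaussians -/

section GaussianSchwartz

open scoped ContDiff

variable {E : Type*} [NormedAddCommGroup E] [InnerProductSpace ℝ E]

theorem exists_one_add_pow_mul_exp_le {b : ℝ} (hb : 0 < b) (K : ℕ) :
    ∃ M, ∀ r : ℝ, 0 ≤ r → (1 + r) ^ K * Real.exp (-(b * r ^ 2)) ≤ M := by
  -- The constant comes from `1 + r ≤ 2 (1 + r²)` and `x ^ K ≤ K! exp x` at `x = b + b r²`; the part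
  -- `exp b` is what the Gaussian leaves over.
  refine ⟨(2 / b) ^ K * K.factorial * Real.exp b, fun r hr => ?_⟩
  have h1 : 1 + r ≤ 2 / b * (b + b * r ^ 2) := by
    field_simp
    nlinarith [sq_nonneg (r - 1)]
  have h2 : (b + b * r ^ 2) ^ K ≤ K.factorial * Real.exp (b + b * r ^ 2) := by
    have := Real.pow_div_factorial_le_exp (b + b * r ^ 2) (by positivity) K
    rwa [div_le_iff₀ (by positivity), mul_comm (Real.exp _)] at this
  calc (1 + r) ^ K * Real.exp (-(b * r ^ 2))
      ≤ (2 / b * (b + b * r ^ 2)) ^ K * Real.exp (-(b * r ^ 2)) := by gcongr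
    _ ≤ (2 / b) ^ K * (K.factorial * Real.exp (b + b * r ^ 2)) * Real.exp (-(b * r ^ 2)) := by
        rw [mul_pow]
        gcongr
    _ = _ := by
        rw [Real.exp_add, Real.exp_neg]
        field_simp

/-- The Gaussian `x ↦ exp (-b ‖x‖ ^ 2)` as a real-valued Schwartz function. -/
def realGaussian {b : ℝ} (hb : 0 < b) : 𝓢(E, ℝ) where
  toFun := Real.exp ∘ fun x => -b * ‖x‖ ^ 2
  smooth' := Real.contDiff_exp.comp (contDiff_const.mul (contDiff_norm_sq ℝ))
  decay' k n := by
    have hu : (fun x : E => -b * ‖x‖ ^ 2).HasTemperateGrowth :=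
      (Function.HasTemperateGrowth.const (-b)).mul (Function.hasTemperateGrowth_norm_sq E)
    obtain ⟨p, C, hC0, hC⟩ := hu.norm_iteratedFDeriv_le_uniform n
    obtain ⟨M, hM⟩ := exists_one_add_pow_mul_exp_le hb (k + p * n)
    refine ⟨n.factorial * (1 + C) ^ n * M, fun x => ?_⟩
    have h1 := norm_iteratedFDeriv_comp_le (𝕜 := ℝ) (N := ∞) (n := n) Real.contDiff_exp hu.1
      (mod_cast le_top) x (C := Real.exp (-b * ‖x‖ ^ 2)) (D := (1 + C) * (1 + ‖x‖) ^ p)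
      (fun i _ => by
        rw [norm_iteratedFDeriv_eq_norm_iteratedDeriv, iteratedDeriv_eq_iterate,
          Real.iter_deriv_exp, Real.norm_eq_abs, Real.abs_exp])
      (fun i hi hin => by
        have hone : 1 ≤ (1 + C) * (1 + ‖x‖) ^ p :=
          one_le_mul_of_one_le_of_one_le (by linarith)
            (one_le_pow₀ (by linarith [norm_nonneg x]))
        refine (hC i hin x).trans (le_trans ?_ (le_self_pow₀ hone (by omega)))
        gcongr
        linarith)
    calc ‖x‖ ^ k * ‖iteratedFDeriv ℝ n (Real.exp ∘ fun x => -b * ‖x‖ ^ 2) x‖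
        ≤ (1 + ‖x‖) ^ k *
          (n.factorial * Real.exp (-b * ‖x‖ ^ 2) * ((1 + C) * (1 + ‖x‖) ^ p) ^ n) := by
          gcongr
          linarith
      _ = n.factorial * (1 + C) ^ n *
          ((1 + ‖x‖) ^ (k + p * n) * Real.exp (-(b * ‖x‖ ^ 2))) := by
          rw [mul_pow, pow_add, pow_mul, neg_mul]
          ring
      _ ≤ _ := by
          gcongr
          exact hM _ (norm_nonneg x)

/-- The Gaussian `x ↦ exp (-b ‖x‖ ^ 2)` as a complex-valued Schwartz function. -/
def gaussian {b : ℝ} (hb : 0 < b) : 𝓢(E, ℂ) :=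
  SchwartzMap.postcompCLM Complex.ofRealCLM (realGaussian hb)

theorem gaussian_apply {b : ℝ} (hb : 0 < b) (x : E) :
    gaussian hb x = Complex.exp (-(b * ‖x‖ ^ 2)) := by
  change ((Real.exp (-b * ‖x‖ ^ 2) : ℝ) : ℂ) = _
  push_cast
  rw [neg_mul]

variable [FiniteDimensional ℝ E] [MeasurableSpace E] [BorelSpace E]

open FourierTransform LineDeriv

theorem fourierInv_gaussian {b : ℝ} (hb : 0 < b) (w : E) :
    (𝓕⁻ (gaussian hb : E → ℂ)) w = (Real.pi / b : ℂ) ^ (Module.finrank ℝ E / 2 : ℂ) *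
      Complex.exp (-Real.pi ^ 2 * ‖w‖ ^ 2 / b) := by
  have h1 := fourier_gaussian_innerProductSpace (V := E) (b := b) (by simpa using hb) (-w)
  have h2 : (gaussian hb : E → ℂ) = fun v => Complex.exp (-b * ‖v‖ ^ 2) := by
    ext x
    rw [gaussian_apply, neg_mul]
  rw [Real.fourierInv_eq_fourier_neg, h2, h1, norm_neg]

theorem fourierInv_lineDeriv_apply (f : 𝓢(E, ℂ)) (m w : E) :
    (𝓕⁻ (∂_{m} f)) w = -(2 * Real.pi * Complex.I) * (inner ℝ w m * (𝓕⁻ f) w) := by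
  rw [SchwartzMap.fourierInv_lineDerivOp_eq]
  change -(2 * Real.pi * Complex.I) • (SchwartzMap.smulLeftCLM ℂ (inner ℝ · m) (𝓕⁻ f)) w = _
  rw [SchwartzMap.smulLeftCLM_apply_apply (by fun_prop), Complex.real_smul, smul_eq_mul]

end GaussianSchwartz

/-! ### Fourier transforms of powers times Gaussians on `ℂ`. -/

section Hermite

open FourierTransform LineDeriv

/-- The Schwartz function `z ↦ z ^ n exp (-b ‖z‖ ^ 2)` on `ℂ`. -/
def powGaussian {b : ℝ} (hb : 0 < b) (n : ℕ) : 𝓢(ℂ, ℂ) :=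
  SchwartzMap.smulLeftCLM ℂ (fun z : ℂ => z ^ n) (gaussian hb)

theorem powGaussian_apply {b : ℝ} (hb : 0 < b) (n : ℕ) (z : ℂ) :
    powGaussian hb n z = z ^ n * Complex.exp (-(b * ‖z‖ ^ 2)) := by
  have h : (fun z : ℂ => z ^ n).HasTemperateGrowth := Function.HasTemperateGrowth.id'.pow n
  rw [powGaussian, SchwartzMap.smulLeftCLM_apply_apply h, gaussian_apply, smul_eq_mul]

theorem lineDeriv_powGaussian {b : ℝ} (hb : 0 < b) (n : ℕ) (m z : ℂ) :
    ∂_{m} (powGaussian hb n) z = (n * z ^ (n - 1) * m - b * z ^ n *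
      (m * (starRingEnd ℂ) z + z * (starRingEnd ℂ) m)) * Complex.exp (-(b * ‖z‖ ^ 2)) := by
  rw [SchwartzMap.lineDerivOp_apply]
  refine HasLineDerivAt.lineDeriv ?_
  have h1 : ∀ c w : ℂ, HasDerivAt (fun t : ℝ => w + t * c) c 0 := fun c w =>
    (((Complex.ofRealCLM.hasDerivAt (x := 0)).mul_const c).const_add w).congr_deriv (by simp)
  have h2 := ((h1 m z).pow n).mul
    ((((h1 m z).mul (h1 ((starRingEnd ℂ) m) ((starRingEnd ℂ) z))).const_mul (b : ℂ)).neg.cexp)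
  have h3 : (fun t : ℝ => powGaussian hb n (z + t • m)) = fun t : ℝ => (z + t * m) ^ n *
      Complex.exp (-(b * ((z + t * m) * ((starRingEnd ℂ) z + t * (starRingEnd ℂ) m)))) := by
    ext t
    rw [powGaussian_apply, ← Complex.mul_conj', Complex.real_smul, map_add, map_mul,
      Complex.conj_ofReal]
  rw [HasLineDerivAt, h3]
  refine h2.congr_deriv ?_
  simp only [Pi.mul_apply, Pi.pow_apply, Pi.neg_apply]
  simp [Complex.mul_conj']
  ring

/-- The operator `∂₁ + i ∂ᵢ = 2 ∂/∂z̄` kills `z ^ n` and multiplies the Gaussian by `-2 b z`, so it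
raises the power by one. The inverse Fourier transform turns it into multiplication by `-2πi w`. -/
theorem fourierInv_powGaussian_succ {b : ℝ} (hb : 0 < b) (n : ℕ) (w : ℂ) :
    (𝓕⁻ (powGaussian hb (n + 1))) w =
      Real.pi * Complex.I / b * w * (𝓕⁻ (powGaussian hb n)) w := by
  have h1 : ∂_{(1 : ℂ)} (powGaussian hb n) + Complex.I • ∂_{Complex.I} (powGaussian hb n) =
      (-(2 * b : ℂ)) • powGaussian hb (n + 1) := by
    ext z
    change ∂_{(1 : ℂ)} (powGaussian hb n) z + Complex.I * ∂_{Complex.I} (powGaussian hb n) z =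
      -(2 * b : ℂ) * powGaussian hb (n + 1) z
    rw [lineDeriv_powGaussian, lineDeriv_powGaussian, powGaussian_apply, map_one, Complex.conj_I]
    generalize Complex.exp (-(b * ‖z‖ ^ 2)) = e
    generalize (starRingEnd ℂ) z = y
    linear_combination (n * z ^ (n - 1) * e - b * z ^ n * e * y + b * z ^ n * z * e) * Complex.I_sq
  have h2 := congrArg (fun f => (𝓕⁻ f : 𝓢(ℂ, ℂ)) w) h1
  simp only [FourierTransform.fourierInv_add, FourierTransform.fourierInv_smul] at h2
  change (𝓕⁻ (∂_{(1 : ℂ)} (powGaussian hb n))) w +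
    Complex.I * (𝓕⁻ (∂_{Complex.I} (powGaussian hb n))) w =
      -(2 * b : ℂ) * (𝓕⁻ (powGaussian hb (n + 1))) w at h2
  rw [fourierInv_lineDeriv_apply, fourierInv_lineDeriv_apply] at h2
  have h3 : ((inner ℝ w (1 : ℂ) : ℝ) : ℂ) + Complex.I * (inner ℝ w Complex.I : ℝ) = w := by
    rw [Complex.inner, Complex.inner]
    apply Complex.ext <;> simp
  have hb0 : (b : ℂ) ≠ 0 := Complex.ofReal_ne_zero.2 hb.ne'
  field_simp
  linear_combination (1 / 2 : ℂ) * h2 + (Real.pi * Complex.I * (𝓕⁻ (powGaussian hb n)) w) * h3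

end Hermite

/-! ### Characters of the archimedean places -/

section Characters

variable {F : Type*} [NontriviallyNormedField F] [ProperSpace F]

theorem quasiChar_inv_zero (χ : Fˣ →ₜ* Circle) (x : F) :
    quasiChar χ⁻¹ 0 x = (starRingEnd ℂ) (quasiChar χ 0 x) := by
  by_cases hx : x = 0
  · simp [hx]
  · rw [quasiChar_of_ne _ _ hx, quasiChar_of_ne _ _ hx, Complex.cpow_zero, mul_one, mul_one,
      ← Circle.coe_inv_eq_conj]
    rfl

theorem quasiChar_one_zero {x : F} (hx : x ≠ 0) : quasiChar 1 0 x = 1 := by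
  rw [quasiChar_of_ne _ _ hx, Complex.cpow_zero, mul_one]
  rfl

theorem quasiChar_signChar {x : ℝ} (hx : x ≠ 0) : quasiChar signChar 0 x * (‖x‖ : ℂ) = x := by
  rw [quasiChar_of_ne _ _ hx, Complex.cpow_zero, mul_one]
  change ((x : ℂ) / (‖(x : ℂ)‖ : ℂ)) * _ = _
  rw [Complex.norm_real, div_mul_cancel₀]
  simpa using hx

theorem quasiChar_complexChar (N : ℤ) {x : ℂ} (hx : x ≠ 0) :
    quasiChar (complexChar N) 0 x = (x / ‖x‖) ^ N := by
  rw [quasiChar_of_ne _ _ hx, Complex.cpow_zero, mul_one]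
  change ((unitVal (Units.mk0 x hx) ^ N : Circle) : ℂ) = _
  rw [Circle.coe_zpow, coe_unitVal]
  rfl

theorem quasiChar_complexChar_natCast (n : ℕ) {x : ℂ} (hx : x ≠ 0) :
    quasiChar (complexChar n) 0 x * (‖x‖ : ℂ) ^ n = x ^ n := by
  rw [quasiChar_complexChar _ hx, zpow_natCast, ← mul_pow, div_mul_cancel₀]
  simpa using hx

theorem complexChar_neg (N : ℤ) : complexChar (-N) = (complexChar N)⁻¹ := by
  apply ContinuousMonoidHom.ext
  intro u
  exact zpow_neg (unitVal u) N

end Characters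

/-! ### Explicit spectral functions -/

section ExplicitGamma

open FourierTransform

theorem hasSum_spectralK_aux {a : ℝ} (ha : 0 < a) (τ : ℝ) (d : ℝ) {f : ℕ → ℝ} {k z w : ℂ}
    (hk : k = -Complex.I * (d ^ 2 / 4 * (deriv Complex.digamma z - deriv Complex.digamma w)))
    (hz : z = a + τ * Complex.I) (hw : w = a - τ * Complex.I)
    (hf : ∀ j : ℕ, f j = d ^ 2 / 4 * -(4 * (a + j) * τ / ((a + j) ^ 2 + τ ^ 2) ^ 2)) :
    HasSum (fun j : ℕ => (f j : ℂ)) k := by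
  have h := (hasSum_deriv_digamma_sub ha τ).mul_left ((d ^ 2 / 4 : ℝ) : ℂ)
  have h1 : (fun j : ℕ => (f j : ℂ)) = fun j : ℕ => ((d ^ 2 / 4 : ℝ) : ℂ) *
      ((-(4 * (a + j) * τ / ((a + j) ^ 2 + τ ^ 2) ^ 2) : ℝ) : ℂ) :=
    funext fun j => by rw [hf, Complex.ofReal_mul]
  have h2 : k = ((d ^ 2 / 4 : ℝ) : ℂ) * (-Complex.I *
      (deriv Complex.digamma (a + τ * Complex.I) - deriv Complex.digamma (a - τ * Complex.I))) := by
    rw [hk, hz, hw]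
    push_cast
    ring
  rw [h1, h2]
  exact h

theorem fourier_gaussian_real (x : ℝ) :
    fourier (archChar ℝ) volume (gaussian Real.pi_pos : 𝓢(ℝ, ℂ)) x =
      (gaussian Real.pi_pos : 𝓢(ℝ, ℂ)) x := by
  have hpi : (Real.pi : ℂ) ≠ 0 := Complex.ofReal_ne_zero.2 Real.pi_ne_zero
  rw [fourier_real_eq, fourierInv_gaussian, gaussian_apply, div_self hpi, Complex.one_cpow, one_mul]
  congr 1
  field_simp

theorem spectralK_real_one {s : ℂ} (h0 : 0 < s.re) (h1 : s.re < 1) :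
    spectralK (archChar ℝ) volume (schwartz ℝ) 1 s =
      -(Complex.I / 4) *
        (deriv Complex.digamma (s / 2) - deriv Complex.digamma ((1 - s) / 2)) := by
  have h := isTestSpace_real.spectralK_of_gaussian (χ := 1) Real.pi_pos 0
    (ρ := (gaussian Real.pi_pos : 𝓢(ℝ, ℂ))) ⟨_, rfl⟩
    (fun x hx => by rw [quasiChar_one_zero hx, gaussian_apply, pow_zero, one_mul, one_mul])
    (k := 1) (fun x hx => by
      rw [fourier_gaussian_real, inv_one, quasiChar_one_zero hx, gaussian_apply, pow_zero, one_mul,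
        one_mul, one_mul]) h0 h1
  rw [h, Module.finrank_self]
  simp only [Nat.cast_zero, Nat.cast_one, zero_add, one_mul]
  ring

/-- The Schwartz function `x ↦ x exp (-π x ^ 2)` on `ℝ`. -/
def oddGaussian : 𝓢(ℝ, ℂ) :=
  SchwartzMap.smulLeftCLM ℂ (fun x : ℝ => (x : ℂ)) (gaussian Real.pi_pos : 𝓢(ℝ, ℂ))

theorem oddGaussian_apply (x : ℝ) :
    oddGaussian x = x * Complex.exp (-(Real.pi * ‖x‖ ^ 2)) := by
  rw [oddGaussian, SchwartzMap.smulLeftCLM_apply_apply Function.Complex.hasTemperateGrowth_ofReal,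
    gaussian_apply, smul_eq_mul]

open LineDeriv in
-- The odd Gaussian is, up to the factor `-2π`, the derivative of the self-dual Gaussian.
theorem fourier_oddGaussian (x : ℝ) :
    fourier (archChar ℝ) volume oddGaussian x = Complex.I * oddGaussian x := by
  have hpi : (Real.pi : ℂ) ≠ 0 := Complex.ofReal_ne_zero.2 Real.pi_ne_zero
  have h1 : ∂_{(1 : ℝ)} (gaussian Real.pi_pos : 𝓢(ℝ, ℂ)) = (-(2 * Real.pi : ℂ)) • oddGaussian := by
    ext y
    change _ = -(2 * Real.pi : ℂ) * oddGaussian y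
    rw [SchwartzMap.lineDerivOp_apply_eq_fderiv, oddGaussian_apply, fderiv_apply_one_eq_deriv]
    have h2 : ((gaussian Real.pi_pos : 𝓢(ℝ, ℂ)) : ℝ → ℂ) =
        fun t : ℝ => Complex.exp (-(Real.pi * (t : ℂ) ^ 2)) := by
      ext t
      rw [gaussian_apply, ← Complex.ofReal_pow, ← Complex.ofReal_pow, Real.norm_eq_abs, sq_abs]
    have h3 := (((Complex.ofRealCLM.hasDerivAt (x := y)).pow 2).const_mul (Real.pi : ℂ)).neg.cexp
    have h4 : ((‖y‖ : ℝ) : ℂ) ^ 2 = (y : ℂ) ^ 2 := by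
      rw [← Complex.ofReal_pow, ← Complex.ofReal_pow, Real.norm_eq_abs, sq_abs]
    rw [h2, h4]
    refine h3.deriv.trans ?_
    simp
    ring
  have h2 := congrArg (fun f => (𝓕⁻ f : 𝓢(ℝ, ℂ)) x) h1
  simp only [FourierTransform.fourierInv_smul] at h2
  change _ = -(2 * Real.pi : ℂ) * (𝓕⁻ oddGaussian) x at h2
  rw [fourierInv_lineDeriv_apply, SchwartzMap.fourierInv_coe, ← fourier_real_eq,
    fourier_gaussian_real, SchwartzMap.fourierInv_coe, ← fourier_real_eq, gaussian_apply] at h2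
  have h3 : ((inner ℝ x (1 : ℝ) : ℝ) : ℂ) = x := by simp
  rw [h3] at h2
  rw [oddGaussian_apply]
  have h4 : (2 * Real.pi : ℂ) ≠ 0 := mul_ne_zero two_ne_zero hpi
  apply mul_left_cancel₀ h4
  linear_combination h2

theorem spectralK_real_signChar {s : ℂ} (h0 : 0 < s.re) (h1 : s.re < 1) :
    spectralK (archChar ℝ) volume (schwartz ℝ) signChar s =
      -(Complex.I / 4) *
        (deriv Complex.digamma ((1 + s) / 2) - deriv Complex.digamma ((2 - s) / 2)) := by
  have hρ : ∀ x : ℝ, x ≠ 0 → oddGaussian x = quasiChar signChar 0 x *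
      ((‖x‖ : ℂ) ^ 1 * Complex.exp (-(Real.pi * ‖x‖ ^ 2))) := fun x hx => by
    rw [pow_one, ← mul_assoc, quasiChar_signChar hx, oddGaussian_apply]
  have h := isTestSpace_real.spectralK_of_gaussian (χ := signChar) Real.pi_pos 1
    (ρ := oddGaussian) ⟨_, rfl⟩ hρ (k := Complex.I) (fun x hx => by
      have h2 := congrArg (starRingEnd ℂ) (quasiChar_signChar hx)
      rw [map_mul, Complex.conj_ofReal, Complex.conj_ofReal, ← quasiChar_inv_zero] at h2
      rw [fourier_oddGaussian, pow_one, ← mul_assoc (quasiChar _ _ _), h2, oddGaussian_apply]) h0 h1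
  rw [h, Module.finrank_self]
  simp only [Nat.cast_one, one_mul, one_pow]
  rw [show (1 + (1 - s)) = 2 - s by ring]
  ring

/-- With `b = 2π` the Gaussian is its own transform for this character and measure, and each further
power of `z` contributes a factor `i x̄`. -/
theorem fourier_powGaussian (n : ℕ) (x : ℂ) :
    fourier (archChar ℂ) complexMeasure (powGaussian Real.two_pi_pos n) x =
      Complex.I ^ n * ((starRingEnd ℂ) x ^ n * Complex.exp (-((2 * Real.pi : ℝ) * ‖x‖ ^ 2))) := by
  have hpi : (Real.pi : ℂ) ≠ 0 := Complex.ofReal_ne_zero.2 Real.pi_ne_zero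
  induction n with
  | zero =>
    have h1 : (powGaussian Real.two_pi_pos 0 : ℂ → ℂ) = (gaussian Real.two_pi_pos : 𝓢(ℂ, ℂ)) := by
      ext z
      rw [powGaussian_apply, gaussian_apply, pow_zero, one_mul]
    rw [fourier_complex_eq, h1, fourierInv_gaussian, Complex.finrank_real_complex, twoConj_apply,
      norm_mul, Complex.norm_conj]
    have h2 : (Real.pi / (2 * Real.pi : ℝ) : ℂ) = 1 / 2 := by
      push_cast
      field_simp
    rw [h2]
    simp only [Nat.cast_ofNat, pow_zero, one_mul]
    rw [div_self two_ne_zero, Complex.cpow_one, ← mul_assoc, mul_one_div_cancel two_ne_zero, one_mul]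
    congr 1
    push_cast
    simp
    field_simp
  | succ n ih =>
    rw [fourier_complex_eq, ← SchwartzMap.fourierInv_coe] at ih ⊢
    rw [fourierInv_powGaussian_succ]
    have h2 : (Real.pi * Complex.I / (2 * Real.pi : ℝ) : ℂ) * twoConj x =
        Complex.I * (starRingEnd ℂ) x := by
      rw [twoConj_apply]
      push_cast
      field_simp
    rw [h2, pow_succ, pow_succ]
    linear_combination (Complex.I * (starRingEnd ℂ) x) * ih

theorem spectralK_complex (N : ℤ) {s : ℂ} (h0 : 0 < s.re) (h1 : s.re < 1) :
    spectralK (archChar ℂ) complexMeasure (schwartz ℂ) (complexChar N) s =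
      -Complex.I *
        (deriv Complex.digamma (((|N| : ℤ) : ℂ) / 2 + s) -
          deriv Complex.digamma (((|N| : ℤ) : ℂ) / 2 + 1 - s)) := by
  -- The test function is `z ^ n` times the Gaussian when `N = n`, and its complex conjugate when `N
  -- = -n`.
  suffices key : ∀ n : ℕ, ∃ (k : ℂ) (ρ : ℂ → ℂ), n = N.natAbs → ρ ∈ schwartz ℂ ∧
      (∀ x, x ≠ 0 → ρ x = quasiChar (complexChar N) 0 x *
        ((‖x‖ : ℂ) ^ n * Complex.exp (-((2 * Real.pi : ℝ) * ‖x‖ ^ 2)))) ∧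
      ∀ x, x ≠ 0 → fourier (archChar ℂ) complexMeasure ρ x =
        k * (quasiChar (complexChar N)⁻¹ 0 x *
          ((‖x‖ : ℂ) ^ n * Complex.exp (-((2 * Real.pi : ℝ) * ‖x‖ ^ 2)))) by
    obtain ⟨k, ρ, hρ⟩ := key N.natAbs
    obtain ⟨hρS, hρ1, hρ2⟩ := hρ rfl
    have h := isTestSpace_complex.spectralK_of_gaussian Real.two_pi_pos _ hρS hρ1 hρ2 h0 h1
    have hN : ((|N| : ℤ) : ℂ) = (N.natAbs : ℂ) := by
      rw [Int.abs_eq_natAbs]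
      rfl
    rw [h, Complex.finrank_real_complex, hN]
    have e1 : ((N.natAbs : ℂ) + (2 : ℕ) * s) / 2 = N.natAbs / 2 + s := by
      push_cast
      ring
    have e2 : ((N.natAbs : ℂ) + (2 : ℕ) * (1 - s)) / 2 = N.natAbs / 2 + 1 - s := by
      push_cast
      ring
    rw [e1, e2]
    push_cast
    ring
  have hconj : ∀ (n : ℕ) {x : ℂ}, x ≠ 0 →
      quasiChar (complexChar n)⁻¹ 0 x * (‖x‖ : ℂ) ^ n = (starRingEnd ℂ) x ^ n := fun n x hx => by
    rw [quasiChar_inv_zero, ← Complex.conj_ofReal, ← map_pow, ← map_mul,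
      quasiChar_complexChar_natCast n hx, map_pow]
  intro n
  rcases N.eq_nat_or_neg with ⟨m, rfl | rfl⟩
  · refine ⟨Complex.I ^ n, powGaussian Real.two_pi_pos n, fun hn => ?_⟩
    obtain rfl : n = m := by simpa using hn
    refine ⟨⟨_, rfl⟩, fun x hx => ?_, fun x hx => ?_⟩
    · rw [← mul_assoc, quasiChar_complexChar_natCast n hx, powGaussian_apply]
    · rw [← mul_assoc (quasiChar _ _ _), hconj n hx, fourier_powGaussian]
  · refine ⟨Complex.I ^ n, fun x => (starRingEnd ℂ) (powGaussian Real.two_pi_pos n x),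
      fun hn => ?_⟩
    obtain rfl : n = m := by simpa using hn
    have hexp : ∀ x : ℂ, (starRingEnd ℂ) (Complex.exp (-((2 * Real.pi : ℝ) * ‖x‖ ^ 2))) =
        Complex.exp (-((2 * Real.pi : ℝ) * ‖x‖ ^ 2)) := fun x => by
      rw [← Complex.exp_conj]
      simp only [map_neg, map_mul, Complex.conj_ofReal, map_pow]
    refine ⟨⟨SchwartzMap.postcompCLM (𝕜 := ℝ) (Complex.conjCLE : ℂ →L[ℝ] ℂ)
      (powGaussian Real.two_pi_pos n), rfl⟩, fun x hx => ?_, fun x hx => ?_⟩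
    · change (starRingEnd ℂ) (powGaussian Real.two_pi_pos n x) = _
      rw [← mul_assoc, complexChar_neg, hconj n hx, powGaussian_apply, map_mul, hexp, map_pow]
    · rw [← mul_assoc (quasiChar _ _ _), complexChar_neg, inv_inv,
        quasiChar_complexChar_natCast n hx, fourier_conj, fourier_powGaussian, map_mul, map_mul,
        hexp, norm_neg, map_pow, map_pow, Complex.conj_I, Complex.conj_conj, neg_pow,
        neg_pow (x : ℂ)]
      -- One sign `(-1) ^ n` comes from conjugating `i ^ n`, the other from the reflection in the
      -- transform of a conjugate.
      have : ((-1 : ℂ) ^ n) * (-1) ^ n = 1 := by rw [← mul_pow]; simp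
      linear_combination (Complex.I ^ n * x ^ n *
        Complex.exp (-((2 * Real.pi : ℝ) * ‖x‖ ^ 2))) * this

end ExplicitGamma

end LocalCommutator

end

/-! ### The theorem at all three kinds of places. -/

open LocalCommutator in
theorem mainTheorem3 :
    -- finite places
    (∀ (F : Type*) [NontriviallyNormedField F] [IsUltrametricDist F] [ProperSpace F]
        [MeasurableSpace F] [BorelSpace F]
        (ψ : AddChar F Circle), Continuous ψ → ψ ≠ 1 →
        ∀ (μ : Measure F) [μ.IsAddHaarMeasure], IsSelfDual ψ μ (bruhat F) →
      HasGammaFactor ψ μ (bruhat F) ∧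
      (∃ C : ℝ, ∀ (χ : Fˣ →ₜ* Circle) (t : ℝ),
        ‖spectralK ψ μ (bruhat F) χ (1 / 2 + t * Complex.I)‖ ≤ C) ∧
      CommutatorIsBoundedHermitian ψ μ (bruhat F)) ∧
    -- the real place
    (HasGammaFactor (archChar ℝ) volume (schwartz ℝ) ∧
      (∃ C : ℝ, ∀ (χ : ℝˣ →ₜ* Circle) (t : ℝ),
        ‖spectralK (archChar ℝ) volume (schwartz ℝ) χ (1 / 2 + t * Complex.I)‖ ≤ C) ∧
      CommutatorIsBoundedHermitian (archChar ℝ) volume (schwartz ℝ) ∧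
      (∀ s : ℂ, 0 < s.re → s.re < 1 →
        spectralK (archChar ℝ) volume (schwartz ℝ) 1 s =
          -(Complex.I / 4) *
            (deriv Complex.digamma (s / 2) - deriv Complex.digamma ((1 - s) / 2)) ∧
        spectralK (archChar ℝ) volume (schwartz ℝ) signChar s =
          -(Complex.I / 4) *
            (deriv Complex.digamma ((1 + s) / 2) - deriv Complex.digamma ((2 - s) / 2))) ∧
      (∀ t : ℝ,
        HasSum (fun j : ℕ =>
            ((-((4 * j + 1) * (2 * t) / ((2 * j + 1 / 2) ^ 2 + t ^ 2) ^ 2) : ℝ) : ℂ))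
          (spectralK (archChar ℝ) volume (schwartz ℝ) 1 (1 / 2 + t * Complex.I)) ∧
        HasSum (fun j : ℕ =>
            ((-((4 * j + 3) * (2 * t) / ((2 * j + 3 / 2) ^ 2 + t ^ 2) ^ 2) : ℝ) : ℂ))
          (spectralK (archChar ℝ) volume (schwartz ℝ) signChar (1 / 2 + t * Complex.I)))) ∧
    -- the complex place
    (HasGammaFactor (archChar ℂ) complexMeasure (schwartz ℂ) ∧
      (∃ C : ℝ, ∀ (χ : ℂˣ →ₜ* Circle) (t : ℝ),
        ‖spectralK (archChar ℂ) complexMeasure (schwartz ℂ) χ (1 / 2 + t * Complex.I)‖ ≤ C) ∧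
      CommutatorIsBoundedHermitian (archChar ℂ) complexMeasure (schwartz ℂ) ∧
      (∀ (N : ℤ) (s : ℂ), 0 < s.re → s.re < 1 →
        spectralK (archChar ℂ) complexMeasure (schwartz ℂ) (complexChar N) s =
          -Complex.I *
            (deriv Complex.digamma (((|N| : ℤ) : ℂ) / 2 + s) -
              deriv Complex.digamma (((|N| : ℤ) : ℂ) / 2 + 1 - s))) ∧
      (∀ (N : ℤ) (t : ℝ),
        HasSum (fun j : ℕ =>
            ((-((2 * j + ((|N| : ℤ) : ℝ) + 1) * (2 * t) /
              ((j + (((|N| : ℤ) : ℝ) + 1) / 2) ^ 2 + t ^ 2) ^ 2) : ℝ) : ℂ))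
          (spectralK (archChar ℂ) complexMeasure (schwartz ℂ) (complexChar N)
            (1 / 2 + t * Complex.I)))) := by
  refine ⟨?_, ⟨isTestSpace_real.hasGammaFactor, isTestSpace_real.exists_norm_spectralK_le,
    isTestSpace_real.commutatorIsBoundedHermitian,
    fun s h0 h1 => ⟨spectralK_real_one h0 h1, spectralK_real_signChar h0 h1⟩, fun t => ⟨?_, ?_⟩⟩,
    isTestSpace_complex.hasGammaFactor, isTestSpace_complex.exists_norm_spectralK_le,
    isTestSpace_complex.commutatorIsBoundedHermitian, fun N s h0 h1 => spectralK_complex N h0 h1,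
    fun N t => ?_⟩
  · intro F _ _ _ _ _ ψ hψ hψ1 μ _ hdual
    have h := isTestSpace_bruhat hψ hψ1 hdual
    exact ⟨h.hasGammaFactor, h.exists_norm_spectralK_le, h.commutatorIsBoundedHermitian⟩
  -- At `s = 1/2 + it`, the argument `s / 2` equals `1/4 + i t/2`.
  · refine hasSum_spectralK_aux (a := 1 / 4) (by norm_num) (t / 2) 1
      ((spectralK_real_one (by simp) (by norm_num)).trans ?_) rfl rfl fun j => ?_
    · push_cast
      ring_nf
    · have : 0 < (2 * (j : ℝ) + 1 / 2) ^ 2 + t ^ 2 := by positivity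
      have h2 : ((1 / 4 : ℝ) + j) ^ 2 + (t / 2) ^ 2 =
          ((2 * (j : ℝ) + 1 / 2) ^ 2 + t ^ 2) / 4 := by ring
      rw [h2]
      field_simp
      ring
  -- At `s = 1/2 + it`, the argument `(1 + s) / 2` equals `3/4 + i t/2`.
  · refine hasSum_spectralK_aux (a := 3 / 4) (by norm_num) (t / 2) 1
      ((spectralK_real_signChar (by simp) (by norm_num)).trans ?_) rfl rfl fun j => ?_
    · push_cast
      ring_nf
    · have : 0 < (2 * (j : ℝ) + 3 / 2) ^ 2 + t ^ 2 := by positivity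
      have h2 : ((3 / 4 : ℝ) + j) ^ 2 + (t / 2) ^ 2 =
          ((2 * (j : ℝ) + 3 / 2) ^ 2 + t ^ 2) / 4 := by ring
      rw [h2]
      field_simp
      ring
  · have hN : (0 : ℝ) ≤ ((|N| : ℤ) : ℝ) := by exact_mod_cast abs_nonneg N
    -- Here `|N|/2 + s = (|N| + 1)/2 + it`, and real dimension `2` makes the factor `d² / 4` equal
    -- to `1`.
    refine hasSum_spectralK_aux (a := (((|N| : ℤ) : ℝ) + 1) / 2) (by positivity) t 2
      ((spectralK_complex N (by simp) (by norm_num)).trans ?_) rfl rfl fun j => ?_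
    · generalize |N| = M
      push_cast
      ring_nf
    · rw [add_comm (j : ℝ)]
      ring
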